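/- For $\tau\in\{0,1\}$ and integers $d\ge1$, $1\le i\le d+1$, put $m=2d+2+\tau$. Let $(a;q)_\infty=\prod_{j\ge0}(1-aq^j)$ and $(a_1,\dots,a_r;q)_\infty=\prod_{s=1}^r(a_s;q)_\infty$, and define integers $D^\tau_{i,d}(n)$ by $$\sum_{n\ge0}D_{i,d}^\tau(n)q^n=\frac{(q^i,q^{m-i},q^m;q^m)_\infty}{(q;q)_\infty},\qquad D_{i,d}^\tau(n)=0\ \text{ for } n<0,$$ and, for $k\ge1$, integers $C_{i,m}^k(n)$ by $$\sum_{n\ge0}C_{i,m}^k(n)q^n=(-1)^{k-1}\left(\frac1{(q;q)_\infty}\sum_{-k<\ell\le k}(-1)^\ell q^{\ell(3\ell-1)/2}-1\right)(q^i,q^{m-i},q^m;q^m)_\infty .$$ Let $\varepsilon_{m,i}(n)=(-1)^j$ if $n=m\binom j2+ij$ for some (necessarily unique) $j\in\mathbb Z$, and $\varepsilon_{m,i}(n)=0$ otherwise. Theorem. Let $\tau\in\{0,1\}$, $d\ge1$, $2-\tau\le i\le d+\tau$, $k\ge1$ and $m=2d+2+\tau$. Then for all $n\ge 0$ $$C_{i,m}^k(n)=(-1)^{k-1}\sum_{-k<\ell\le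 k}(-1)^\ell D_{i,d}^\tau\bigl(n-\ell(3\ell-1)/2\bigr)+(-1)^k\varepsilon_{m,i}(n).$$ These numbers are zero for $0\le n<k(3k+1)/2$. For $n\ge k(3k+1)/2$ they are positive, except for the following cases: $$C_{2,5}^1(5)=C_{2,5}^1(7)=C_{2,5}^1(9)=C_{2,5}^1(11)=0,$$ $$C_{1,5}^1(7)=C_{1,5}^1(13)=-1,$$ $$C_{1,5}^1(9)=C_{1,5}^1(11)=C_{1,5}^2(12)=0,\qquad C_{1,7}^1(9)=0,$$ $$C_{1,2d+3}^1(5)=0\ (d\ge1),\qquad C_{1,2d+3}^1(7)=0\ (d\ge2),$$ $$C_{1,2d+3}^k\left(\tfrac{k(3k+1)}2+1\right)=0\ (d\ge1,\ k\ge1).$$ -/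

import Mathlib

namespace TruncatedPentagonal

open PowerSeries
open scoped PowerSeries.WithPiTopology

/-- The infinite product `(q^a; q^m)_∞ = ∏_{j ≥ 0} (1 - q^(a + m j))` as a formal power series
over `ℤ` (used for `a, m ≥ 1`). -/
noncomputable def qPochInf (a m : ℕ) : PowerSeries ℤ :=
  ∏' j : ℕ, (1 - (X : PowerSeries ℤ) ^ (a + m * j))

/-- The product defining `qPochInf` converges. -/
theorem multipliable_qPochInf (a m : ℕ) (hm : 1 ≤ m) :
    Multipliable fun j : ℕ => (1 - (X : PowerSeries ℤ) ^ (a + m * j)) := by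
  simp only [sub_eq_add_neg]
  refine PowerSeries.WithPiTopology.multipliable_one_add_of_tendsto_order_atTop_nhds_top ℤ ?_
  refine ENat.tendsto_nhds_top_iff_natCast_lt.mpr fun n => Filter.eventually_atTop.mpr ⟨n + 1, ?_⟩
  intro j hj
  rw [order_neg, order_X_pow]
  norm_cast
  nlinarith

/-- The product `(q^i, q^(m-i), q^m; q^m)_∞` (used for `1 ≤ i < m`). -/
noncomputable def thetaProd (i m : ℕ) : PowerSeries ℤ :=
  qPochInf i m * qPochInf (m - i) m * qPochInf m m

/-- `1 / (q; q)_∞`. -/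
noncomputable def invEuler : PowerSeries ℤ := invOfUnit (qPochInf 1 1) 1

/-- `D_{i,d}^τ(n)`: the coefficient of `q^n` in
`(q^i, q^(2d+2+τ-i), q^(2d+2+τ); q^(2d+2+τ))_∞ / (q; q)_∞`, which is `0` for negative `n`. -/
noncomputable def D (τ d i : ℕ) (n : ℤ) : ℤ :=
  if 0 ≤ n then coeff n.toNat (thetaProd i (2 * d + 2 + τ) * invEuler) else 0

/-- The truncated pentagonal number series `∑_{-k < ℓ ≤ k} (-1)^ℓ q^(ℓ(3ℓ-1)/2)`. -/
noncomputable def truncPentagonal (k : ℕ) : PowerSeries ℤ :=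
  ∑ ℓ ∈ Finset.Ioc (-(k : ℤ)) (k : ℤ), (Int.negOnePow ℓ : ℤ) • X ^ pentagonal ℓ

/-- `C_{i,m}^k(n)` (for `k ≥ 1`): the coefficient of `q^n` in
`(-1)^(k-1) ((q;q)_∞⁻¹ ∑_{-k < ℓ ≤ k} (-1)^ℓ q^(ℓ(3ℓ-1)/2) - 1) (q^i, q^(m-i), q^m; q^m)_∞`. -/
noncomputable def C (k i m n : ℕ) : ℤ :=
  coeff n ((-1) ^ (k - 1) * (invEuler * truncPentagonal k - 1) * thetaProd i m)

/-- The signed indicator of the set `{m j(j-1)/2 + i j : j ∈ ℤ}`: the sum of `(-1)^j` over all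
integers `j` with `m j(j-1)/2 + i j = n`. For `0 < 2 i < m` there is at most one such `j`. -/
noncomputable def thetaSign (m i n : ℕ) : ℤ :=
  ∑ᶠ j ∈ {j : ℤ | (m : ℤ) * (j * (j - 1) / 2) + (i : ℤ) * j = (n : ℤ)}, (Int.negOnePow j : ℤ)

/-- The cases in which `C_{i,m}^k(n) = -1`. -/
def IsNegCase (k i m n : ℕ) : Prop :=
  k = 1 ∧ i = 1 ∧ m = 5 ∧ (n = 7 ∨ n = 13)

/-- The cases with `n ≥ k(3k+1)/2` in which `C_{i,m}^k(n) = 0`. -/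
def IsZeroCase (k i m n : ℕ) : Prop :=
  (k = 1 ∧ i = 2 ∧ m = 5 ∧ (n = 5 ∨ n = 7 ∨ n = 9 ∨ n = 11)) ∨
  (k = 1 ∧ i = 1 ∧ m = 5 ∧ (n = 9 ∨ n = 11)) ∨
  (k = 2 ∧ i = 1 ∧ m = 5 ∧ n = 12) ∨
  (k = 1 ∧ i = 1 ∧ m = 7 ∧ n = 9) ∨
  (k = 1 ∧ i = 1 ∧ (∃ e : ℕ, 1 ≤ e ∧ m = 2 * e + 3) ∧ n = 5) ∨
  (k = 1 ∧ i = 1 ∧ (∃ e : ℕ, 2 ≤ e ∧ m = 2 * e + 3) ∧ n = 7) ∨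
  (i = 1 ∧ (∃ e : ℕ, 1 ≤ e ∧ m = 2 * e + 3) ∧ n = k * (3 * k + 1) / 2 + 1)

end TruncatedPentagonal

/-!
Write `M` for the set of positive integers not congruent to `0, ±i` modulo `m` and `H_A` for the
generating function of partitions with parts in `A`. Cancelling factors,
`(q^i, q^(m-i), q^m; q^m)_∞ / (q; q)_∞ = H_M`, so the generating function of `C` is `T_k * H_M`,
where `T_k` is the signed tail of the pentagonal number series. It has order `k (3 k + 1) / 2`, and
`T_k + T_(k+1) = q^(k (3 k + 1) / 2) (1 - q^(2 k + 1))`. The formula for `C` follows by expanding,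
once the coefficients of the theta product are known from the Jacobi triple product
(`coeff_thetaProd`), which is obtained from a finite form given by the `q`-binomial theorem.

Positivity rests on one observation: if `a` is a sum of parts from `A`, then `(1 - q^a) * H_A` has
nonnegative coefficients (`nonneg_one_sub_mul_partsSeries`). Consequently a product of several
factors `1 - q^a` times `H_M` is nonnegative as soon as the exponents are sums of parts taken from
pairwise disjoint subsets of `M`; this is checked with small numerical semigroups.

For large `k`, two steps of the recursion turn the claim `T_k H_M ≥ q^(k (3 k + 1) / 2) l_k H_M` into
an inequality without tails (`nonneg_pentagonalTail_sub`). With `l_k = 1 - q^(k-1)` for `i ≥ 2` and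
`l_k = 1 - q^(k-2)` for `i = 1`, the difference of its two sides is a sum of products of the kind
above, and `l_k H_M` is positive where needed. Exponents up to the order of the next tail only see
the factor `1 - q^(2 k + 1)`. This settles `k ≥ 2` for `i ≥ 2`, except for `m = 5`, `i = k = 2`, and
`k ≥ 4` for `i = 1`.

In the cases left over with `k = 2, 3` the tail is bounded below by an explicit polynomial times
`H_M`, and `M` may be replaced by a finite subset `S`. The coefficients of a polynomial over
`∏_{p ∈ S} (1 - q^p)` are bounded below from finite tables: for three factors the differences of a
suitable step are eventually constant (`le_coeff_partsQuotient_of_mul_eq`), and each further factor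
propagates a bound from one period (`le_coeff_partsQuotient_cons`).

For `k = 1` the coefficient is that of `(1 - q) H_M` minus a coefficient of the theta series. If
`i ≥ 2`, then `(1 - q) H_M = H_(M \ {1})`, with coefficients at least `2` at the exponents `n > 0`
of positive sign in the theta series, apart from two exponents for `m = 5`. If `i = 1`, tables for a
finite `S ⊆ M` are used, and the parts outside `S` lower a coefficient by at most `1`
(`sub_le_coeff_mul_partsSeries`). The exceptional values come from the same tables.
-/

namespace TruncatedPentagonal

open PowerSeries
open scoped PowerSeries.WithPiTopology

/-! ### Coefficientwise nonnegative power series -/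

/-- All coefficients of `f` are nonnegative. -/
def Nonneg (f : PowerSeries ℤ) : Prop := ∀ n, 0 ≤ coeff n f

theorem Nonneg.zero : Nonneg 0 := fun n => by simp

theorem Nonneg.X_pow (e : ℕ) : Nonneg (X ^ e) := fun n => by
  rw [coeff_X_pow]; split_ifs <;> simp

theorem Nonneg.add {f g : PowerSeries ℤ} (hf : Nonneg f) (hg : Nonneg g) : Nonneg (f + g) :=
  fun n => by rw [map_add]; exact add_nonneg (hf n) (hg n)

theorem Nonneg.mul {f g : PowerSeries ℤ} (hf : Nonneg f) (hg : Nonneg g) : Nonneg (f * g) :=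
  fun n => by
    rw [coeff_mul]
    exact Finset.sum_nonneg fun x _ => mul_nonneg (hf _) (hg _)

theorem Nonneg.coeff_le {f g : PowerSeries ℤ} (h : Nonneg (g - f)) (n : ℕ) :
    coeff n f ≤ coeff n g := by
  have := h n
  rw [map_sub] at this
  linarith

/-- Multiplying a nonnegative series by a nonnegative series with constant term `1` does not
decrease any coefficient. -/
theorem Nonneg.coeff_le_mul {f g : PowerSeries ℤ} (hf : Nonneg f) (hg : Nonneg g)
    (hg0 : coeff 0 g = 1) (n : ℕ) : coeff n f ≤ coeff n (f * g) := by
  rw [coeff_mul]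
  calc coeff n f = coeff n f * coeff 0 g := by rw [hg0, mul_one]
    _ ≤ _ := Finset.single_le_sum (f := fun x : ℕ × ℕ => coeff x.1 f * coeff x.2 g)
        (fun x _ => mul_nonneg (hf _) (hg _)) (a := (n, 0)) (by simp)

/-! ### Generating functions of partitions with restricted parts -/

/-- The generating function of the partitions all of whose parts lie in `A`. -/
noncomputable def partsSeries (A : Set ℕ) : PowerSeries ℤ := by
  classical exact PowerSeries.mk fun n => ((Nat.Partition.restricted n (· ∈ A)).card : ℤ)

/-- The product of `1 - q^a` over the positive elements `a` of `A`. -/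
noncomputable def partsProd (A : Set ℕ) : PowerSeries ℤ := by
  classical exact ∏' n : ℕ, if n + 1 ∈ A then (1 - (X : PowerSeries ℤ) ^ (n + 1)) else 1

theorem nonneg_partsSeries (A : Set ℕ) : Nonneg (partsSeries A) := fun n => by
  simp [partsSeries]

theorem coeff_zero_partsSeries (A : Set ℕ) : coeff 0 (partsSeries A) = 1 := by
  classical
  simp only [partsSeries, coeff_mk]
  rw [Nat.Partition.restricted, Finset.filter_true_of_mem]
  · simp
  · intro x _ i hi
    have := Nat.Partition.parts_pos x hi
    have h2 := Multiset.single_le_sum (fun _ _ => Nat.zero_le _) i hi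
    rw [x.parts_sum] at h2
    omega

/-- There is no partition of `n` with parts in `A` if `A` has no positive element up to `n`. -/
theorem coeff_partsSeries_eq_zero {A : Set ℕ} {n : ℕ} (hn : 1 ≤ n)
    (h : ∀ a ∈ A, 1 ≤ a → n < a) : coeff n (partsSeries A) = 0 := by
  classical
  simp only [partsSeries, coeff_mk]
  rw [Nat.cast_eq_zero, Finset.card_eq_zero, Finset.eq_empty_iff_forall_notMem]
  intro x hx
  simp only [Nat.Partition.restricted, Finset.mem_filter, Finset.mem_univ, true_and] at hx
  have hs := x.parts_sum
  rcases Multiset.empty_or_exists_mem x.parts with h0 | ⟨a, ha⟩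
  · rw [h0] at hs; simp at hs; omega
  · have h1 := h a (hx a ha) (x.parts_pos ha)
    have h2 := Multiset.single_le_sum (fun _ _ => Nat.zero_le _) a ha
    omega

theorem multipliable_partsProd (A : Set ℕ) [DecidablePred (· ∈ A)] :
    Multipliable fun n : ℕ => if n + 1 ∈ A then (1 - (X : PowerSeries ℤ) ^ (n + 1)) else 1 := by
  have : (fun n : ℕ => if n + 1 ∈ A then (1 - (X : PowerSeries ℤ) ^ (n + 1)) else 1) =
      fun n => 1 + if n + 1 ∈ A then -(X : PowerSeries ℤ) ^ (n + 1) else 0 := by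
    funext n; split_ifs <;> ring
  rw [this]
  refine PowerSeries.WithPiTopology.multipliable_one_add_of_tendsto_order_atTop_nhds_top ℤ ?_
  refine ENat.tendsto_nhds_top_iff_natCast_lt.mpr fun n => Filter.eventually_atTop.mpr ⟨n, ?_⟩
  intro j hj
  split_ifs
  · rw [order_neg, order_X_pow]
    norm_cast
    omega
  · simp

theorem partsProd_mul_partsSeries (A : Set ℕ) : partsProd A * partsSeries A = 1 := by
  classical
  have h := Nat.Partition.hasProd_powerSeriesMk_card_restricted ℤ (· ∈ A)
  unfold partsProd partsSeries
  rw [← h.tprod_eq, ← (multipliable_partsProd A).tprod_mul h.multipliable]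
  refine (tprod_congr fun n => ?_).trans tprod_one
  split_ifs
  · rw [mul_comm]
    simp_rw [pow_mul]
    have h0 : constantCoeff ((X : PowerSeries ℤ) ^ (n + 1)) = 0 := by simp
    exact WithPiTopology.tsum_pow_mul_one_sub_of_constantCoeff_eq_zero h0
  · simp

theorem partsProd_union {A B : Set ℕ} (h : Disjoint A B) :
    partsProd (A ∪ B) = partsProd A * partsProd B := by
  classical
  unfold partsProd
  rw [← (multipliable_partsProd A).tprod_mul (multipliable_partsProd B)]
  refine tprod_congr fun n => ?_
  have : n + 1 ∈ A → n + 1 ∉ B := fun hA => Set.disjoint_left.mp h hA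
  by_cases hA : n + 1 ∈ A <;> by_cases hB : n + 1 ∈ B <;> simp_all

theorem partsProd_progression {a m : ℕ} (ha : 1 ≤ a) (hm : 1 ≤ m) :
    partsProd (Set.range fun j : ℕ => a + m * j) = qPochInf a m := by
  classical
  unfold partsProd qPochInf
  have hinj : Function.Injective fun j : ℕ => a + m * j - 1 := by
    intro x y hxy
    have : m * x = m * y := by simp only at hxy; omega
    exact Nat.eq_of_mul_eq_mul_left (by omega) this
  rw [← hinj.tprod_eq]
  · refine tprod_congr fun j => ?_
    have h1 : a + m * j - 1 + 1 = a + m * j := by omega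
    rw [h1, if_pos ⟨j, rfl⟩]
  · intro n hn
    rw [Function.mem_mulSupport] at hn
    by_cases hA : n + 1 ∈ Set.range fun j : ℕ => a + m * j
    · obtain ⟨j, hj⟩ := hA
      exact ⟨j, by simp only at hj ⊢; omega⟩
    · simp [hA] at hn

theorem partsProd_singleton {p : ℕ} (hp : 1 ≤ p) : partsProd {p} = 1 - X ^ p := by
  classical
  unfold partsProd
  rw [tprod_eq_mulSingle (p - 1)]
  · rw [Nat.sub_add_cancel hp]; simp
  · intro n hn
    rw [if_neg]
    simp only [Set.mem_singleton_iff]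
    omega

theorem partsSeries_eq_of_mul_eq_one {A : Set ℕ} {f : PowerSeries ℤ} (h : partsProd A * f = 1) :
    f = partsSeries A := by
  calc f = f * (partsProd A * partsSeries A) := by rw [partsProd_mul_partsSeries, mul_one]
    _ = partsProd A * f * partsSeries A := by ring
    _ = _ := by rw [h, one_mul]

theorem partsSeries_union {A B : Set ℕ} (h : Disjoint A B) :
    partsSeries (A ∪ B) = partsSeries A * partsSeries B := by
  refine (partsSeries_eq_of_mul_eq_one ?_).symm
  rw [partsProd_union h]
  linear_combination partsProd_mul_partsSeries A * partsProd B * partsSeries B +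
    partsProd_mul_partsSeries B

theorem partsSeries_subset {A B : Set ℕ} (h : A ⊆ B) :
    partsSeries B = partsSeries A * partsSeries (B \ A) := by
  rw [← partsSeries_union Set.disjoint_sdiff_right, Set.union_sdiff_cancel h]

theorem one_sub_mul_partsSeries_singleton {p : ℕ} (hp : 1 ≤ p) :
    (1 - X ^ p) * partsSeries {p} = 1 := by
  rw [← partsProd_singleton hp, partsProd_mul_partsSeries]

theorem one_sub_mul_partsSeries {A : Set ℕ} {p : ℕ} (hp : 1 ≤ p) (h : p ∈ A) :
    (1 - X ^ p) * partsSeries A = partsSeries (A \ {p}) := by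
  rw [partsSeries_subset (Set.singleton_subset_iff.mpr h), ← mul_assoc,
    one_sub_mul_partsSeries_singleton hp, one_mul]

/-- If `a` is a sum of elements of `A`, then removing a fixed partition of `a` injects the
partitions of `n` containing it into those of `n - a`; on generating functions, multiplication by
`1 - q^a` preserves nonnegativity. -/
theorem nonneg_one_sub_mul_partsSeries {A : Set ℕ} (hA : ∀ p ∈ A, 1 ≤ p) {a : ℕ}
    (ha : a ∈ AddSubmonoid.closure A) : Nonneg ((1 - X ^ a) * partsSeries A) := by
  induction ha using AddSubmonoid.closure_induction with
  | mem p hp =>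
    rw [one_sub_mul_partsSeries (hA p hp) hp]
    exact nonneg_partsSeries _
  | zero => simpa using Nonneg.zero
  | add x y _ _ hx hy =>
    have : (1 - X ^ (x + y)) * partsSeries A = (1 - X ^ x) * partsSeries A +
        X ^ x * ((1 - X ^ y) * partsSeries A) := by ring
    rw [this]
    exact hx.add ((Nonneg.X_pow x).mul hy)

theorem one_le_coeff_partsSeries {A : Set ℕ} (hA : ∀ p ∈ A, 1 ≤ p) {a : ℕ}
    (ha : a ∈ AddSubmonoid.closure A) : 1 ≤ coeff a (partsSeries A) := by
  have h := nonneg_one_sub_mul_partsSeries hA ha a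
  rw [sub_mul, one_mul, map_sub, coeff_X_pow_mul', if_pos le_rfl, Nat.sub_self,
    coeff_zero_partsSeries] at h
  linarith

/-! ### The quotient `(q^i, q^(m-i), q^m; q^m)_∞ / (q; q)_∞` counts restricted partitions -/

/-- The positive integers incongruent to `0, i, -i` modulo `m` (for `0 < i < m`). -/
def allowedParts (m i : ℕ) : Set ℕ := {n | 1 ≤ n ∧ n % m ≠ 0 ∧ n % m ≠ i ∧ n % m ≠ m - i}

theorem mem_progression {a m n : ℕ} (ha : a < m) :
    n ∈ Set.range (fun j : ℕ => a + m * j) ↔ n % m = a := by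
  constructor
  · rintro ⟨j, rfl⟩
    simp [Nat.mod_eq_of_lt ha]
  · intro h
    exact ⟨n / m, by rw [← h]; exact Nat.mod_add_div n m⟩

theorem mem_progression_self {m n : ℕ} (hm : 1 ≤ m) :
    n ∈ Set.range (fun j : ℕ => m + m * j) ↔ 1 ≤ n ∧ n % m = 0 := by
  constructor
  · rintro ⟨j, rfl⟩
    simp; omega
  · rintro ⟨h, h0⟩
    have h1 := Nat.mod_add_div n m
    rw [h0, zero_add] at h1
    have h2 : n / m ≠ 0 := by rintro h2; rw [h2] at h1; omega
    obtain ⟨t, ht⟩ := Nat.exists_eq_succ_of_ne_zero h2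
    refine ⟨t, ?_⟩
    rw [← h1, ht]; simp only [Nat.succ_eq_add_one]; ring

theorem thetaProd_mul_partsProd {m i : ℕ} (hi : 1 ≤ i) (him : 2 * i < m) :
    thetaProd i m * partsProd (allowedParts m i) = qPochInf 1 1 := by
  have e1 : thetaProd i m = partsProd (Set.range (fun j : ℕ => i + m * j) ∪
      (Set.range (fun j : ℕ => (m - i) + m * j) ∪ Set.range (fun j : ℕ => m + m * j))) := by
    rw [partsProd_union, partsProd_union, partsProd_progression, partsProd_progression,
      partsProd_progression, thetaProd, mul_assoc]
    any_goals omega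
    · rw [Set.disjoint_left]
      intro n hn hn'
      rw [mem_progression (by omega)] at hn
      rw [mem_progression_self (by omega)] at hn'
      omega
    · rw [Set.disjoint_left]
      intro n hn hn'
      rw [Set.mem_union, mem_progression_self (by omega), mem_progression (by omega)] at hn'
      rw [mem_progression (by omega)] at hn
      omega
  rw [e1, ← partsProd_union, ← partsProd_progression le_rfl le_rfl]
  · congr 1
    ext n
    simp only [Set.mem_union]
    rw [mem_progression_self (by omega), mem_progression (by omega), mem_progression (by omega),
      mem_progression_self le_rfl, allowedParts, Set.mem_ofPred_eq]
    rcases Nat.eq_zero_or_pos n with rfl | hn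
    · simp; omega
    · simp only [Nat.mod_one, and_true]
      constructor
      · intro; omega
      · intro; by_cases n % m = 0 <;> by_cases n % m = i <;> by_cases n % m = m - i <;> simp_all
  · rw [Set.disjoint_left]
    intro n hn hn'
    simp only [Set.mem_union] at hn
    rw [mem_progression_self (by omega), mem_progression (by omega), mem_progression (by omega)]
      at hn
    simp only [allowedParts, Set.mem_ofPred_eq] at hn'
    omega

theorem qPochInf_one_one_eq : qPochInf 1 1 = pentagonalSeries ℤ := by
  rw [← WithPiTopology.tprod_one_sub_X_pow ℤ, qPochInf]
  exact tprod_congr fun j => by rw [one_mul, add_comm]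

theorem constantCoeff_qPochInf_one_one : constantCoeff (qPochInf 1 1) = 1 := by
  rw [qPochInf_one_one_eq, ← coeff_zero_eq_constantCoeff_apply]
  have h := coeff_pentagonalSeries_pentagonal ℤ 0
  have h0 : pentagonal 0 = 0 := by simp [pentagonal_def]
  rw [h0] at h
  simpa using h

theorem invEuler_mul : qPochInf 1 1 * invEuler = 1 :=
  mul_invOfUnit _ _ (by simpa using constantCoeff_qPochInf_one_one)

theorem thetaProd_mul_invEuler {m i : ℕ} (hi : 1 ≤ i) (him : 2 * i < m) :
    thetaProd i m * invEuler = partsSeries (allowedParts m i) := by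
  refine partsSeries_eq_of_mul_eq_one ?_
  rw [← invEuler_mul, ← thetaProd_mul_partsProd hi him]
  ring

/-! ### The tail of the pentagonal number series -/

/-- The signed tail of the pentagonal number series; it has order `k (3 k + 1) / 2` and leading
coefficient `1`. -/
noncomputable def pentagonalTail (k : ℕ) : PowerSeries ℤ :=
  (-1) ^ (k - 1) * (truncPentagonal k - qPochInf 1 1)

/-- The generalized pentagonal number `k (3 k + 1) / 2`. -/
def pentExp (k : ℕ) : ℕ := k * (3 * k + 1) / 2

theorem two_mul_pentExp (k : ℕ) : 2 * pentExp k = k * (3 * k + 1) := by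
  refine Nat.mul_div_cancel' ?_
  rcases Nat.even_or_odd' k with ⟨c, rfl | rfl⟩
  · exact ⟨c * (3 * (2 * c) + 1), by ring⟩
  · exact ⟨(2 * c + 1) * (3 * c + 2), by ring⟩

theorem pentExp_succ (k : ℕ) : pentExp (k + 1) = pentExp k + (3 * k + 2) := by
  have h1 := two_mul_pentExp k
  have h2 := two_mul_pentExp (k + 1)
  nlinarith

theorem le_pentExp (k : ℕ) : k ≤ pentExp k := by
  have h1 := two_mul_pentExp k
  nlinarith [Nat.zero_le k, mul_self_nonneg (k : ℤ)]

theorem pentagonal_neg_natCast (k : ℕ) : pentagonal (-(k : ℤ)) = pentExp k := by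
  have h1 := two_mul_pentExp k
  have h2 := two_mul_natCast_pentagonal_neg (k : ℤ)
  zify at h1 ⊢
  linarith

theorem pentagonal_natCast_succ (k : ℕ) : pentagonal ((k : ℤ) + 1) = pentExp k + (2 * k + 1) := by
  have h1 := two_mul_pentExp k
  have h2 := two_mul_natCast_pentagonal ((k : ℤ) + 1)
  zify at h1 ⊢
  linarith

theorem truncPentagonal_succ (k : ℕ) : truncPentagonal (k + 1) =
    truncPentagonal k + (-1) ^ k * X ^ pentExp k * (1 - X ^ (2 * k + 1)) := by
  have e : Finset.Ioc (-((k + 1 : ℕ) : ℤ)) ((k + 1 : ℕ) : ℤ) =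
      insert (-(k : ℤ)) (insert ((k : ℤ) + 1) (Finset.Ioc (-(k : ℤ)) (k : ℤ))) := by
    ext x; simp only [Finset.mem_insert, Finset.mem_Ioc]; push_cast; omega
  unfold truncPentagonal
  rw [e, Finset.sum_insert (by simp; omega), Finset.sum_insert (by simp),
    pentagonal_neg_natCast, pentagonal_natCast_succ, Int.negOnePow_neg, Int.negOnePow_succ]
  simp only [Int.coe_negOnePow_natCast, Units.val_neg, zsmul_eq_mul]
  push_cast
  ring

/-- The recursion behind Euler's proof of the pentagonal number theorem. -/
theorem pentagonalTail_add_succ {k : ℕ} (hk : 1 ≤ k) :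
    pentagonalTail k + pentagonalTail (k + 1) = X ^ pentExp k * (1 - X ^ (2 * k + 1)) := by
  obtain ⟨j, rfl⟩ : ∃ j, k = j + 1 := ⟨k - 1, by omega⟩
  unfold pentagonalTail
  rw [truncPentagonal_succ (j + 1)]
  simp only [Nat.add_sub_cancel]
  have h : ((-1 : PowerSeries ℤ) ^ j) * (-1) ^ j = 1 := by
    rw [← mul_pow]; simp
  have h2 : (-1 : PowerSeries ℤ) ^ (j + 1) = - (-1) ^ j := by ring
  rw [h2]
  linear_combination (X ^ pentExp (j + 1) * (1 - X ^ (2 * (j + 1) + 1))) * h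

theorem pentagonalTail_eq_add {k : ℕ} (hk : 1 ≤ k) : pentagonalTail k =
    X ^ pentExp k * (1 - X ^ (2 * k + 1) - X ^ (3 * k + 2) * (1 - X ^ (2 * k + 3))) +
      pentagonalTail (k + 2) := by
  have e1 := pentagonalTail_add_succ hk
  have e2 := pentagonalTail_add_succ (show 1 ≤ k + 1 by omega)
  rw [pentExp_succ k, pow_add, show 2 * (k + 1) + 1 = 2 * k + 3 by ring] at e2
  linear_combination e1 - e2

theorem coeff_truncPentagonal (k n : ℕ) : coeff n (truncPentagonal k) =
    ∑ ℓ ∈ Finset.Ioc (-(k : ℤ)) (k : ℤ),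
      if n = pentagonal ℓ then (Int.negOnePow ℓ : ℤ) else 0 := by
  unfold truncPentagonal
  rw [map_sum]
  refine Finset.sum_congr rfl fun ℓ _ => ?_
  rw [map_zsmul, coeff_X_pow]
  split_ifs <;> simp

theorem coeff_pentagonalTail_eq_zero {k n : ℕ} (h : n < pentExp k) :
    coeff n (pentagonalTail k) = 0 := by
  have key : coeff n (truncPentagonal k - qPochInf 1 1) = 0 := by
    rw [map_sub, qPochInf_one_one_eq, coeff_truncPentagonal, sub_eq_zero]
    by_cases hn : n ∈ Set.range pentagonal
    · obtain ⟨ℓ, rfl⟩ := hn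
      rw [coeff_pentagonalSeries_pentagonal, Finset.sum_eq_single ℓ]
      · rw [if_pos rfl]; rfl
      · intro b _ hb
        rw [if_neg]
        rw [pentagonal_inj]; exact fun h => hb h.symm
      · intro hℓ
        exfalso
        apply hℓ
        have h1 := two_mul_pentExp k
        have h2 := two_mul_natCast_pentagonal ℓ
        zify at h h1
        rw [Finset.mem_Ioc]
        constructor <;> by_contra hc <;> nlinarith
    · rw [coeff_pentagonalSeries_eq_zero _ hn]
      refine Finset.sum_eq_zero fun ℓ _ => if_neg ?_
      rintro rfl; exact hn ⟨ℓ, rfl⟩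
  unfold pentagonalTail
  rcases neg_one_pow_eq_or (PowerSeries ℤ) (k - 1) with h | h <;> rw [h] <;>
    simp only [one_mul, neg_one_mul, map_neg, key, neg_zero]

/-- The generating function of `C` is the signed tail times a generating function of partitions. -/
theorem C_eq_coeff_pentagonalTail {m i : ℕ} (hi : 1 ≤ i) (him : 2 * i < m) (k n : ℕ) :
    C k i m n = coeff n (pentagonalTail k * partsSeries (allowedParts m i)) := by
  unfold C
  congr 1
  rw [← thetaProd_mul_invEuler hi him, pentagonalTail]
  linear_combination (-1) ^ (k - 1) * thetaProd i m * invEuler_mul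

/-- Multiplying by a series does not lower the order of the tail. -/
theorem coeff_pentagonalTail_mul_eq_zero {k n : ℕ} (h : n < pentExp k) (G : PowerSeries ℤ) :
    coeff n (pentagonalTail k * G) = 0 := by
  rw [coeff_mul]
  refine Finset.sum_eq_zero fun x hx => ?_
  rw [Finset.HasAntidiagonal.mem_antidiagonal] at hx
  rw [coeff_pentagonalTail_eq_zero (by omega), zero_mul]

/-- Below the order of the next tail, only the first two terms of the tail contribute. -/
theorem coeff_pentagonalTail_mul_of_lt {k t : ℕ} (hk : 1 ≤ k) (h : t < 3 * k + 2)
    (G : PowerSeries ℤ) : coeff (pentExp k + t) (pentagonalTail k * G) =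
      coeff t ((1 - X ^ (2 * k + 1)) * G) := by
  have e : pentagonalTail k * G =
      X ^ pentExp k * ((1 - X ^ (2 * k + 1)) * G) - pentagonalTail (k + 1) * G := by
    rw [← mul_assoc, ← pentagonalTail_add_succ hk]; ring
  rw [e, map_sub, coeff_pentagonalTail_mul_eq_zero (by rw [pentExp_succ]; omega), sub_zero,
    coeff_X_pow_mul', if_pos (by omega), Nat.add_sub_cancel_left]

/-- A lower bound for the tails. If a family `l` of series satisfies the two-step inequality
obtained from the recursion of the tails, then the tail of index `k` is at least
`q^(k (3 k + 1) / 2) l_k`, after multiplication by `G`. -/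
theorem nonneg_pentagonalTail_sub {G : PowerSeries ℤ} {l : ℕ → PowerSeries ℤ} {k₀ : ℕ}
    (hk₀ : 1 ≤ k₀)
    (h : ∀ k ≥ k₀, Nonneg ((1 - X ^ (2 * k + 1) - X ^ (3 * k + 2) * (1 - X ^ (2 * k + 3))
      - l k + X ^ (6 * k + 7) * l (k + 2)) * G)) {k : ℕ} (hk : k₀ ≤ k) :
    Nonneg ((pentagonalTail k - X ^ pentExp k * l k) * G) := by
  intro n
  -- downward induction on `k`: the coefficient vanishes once `k (3 k + 1) / 2 > n`
  induction hN : n + 1 - k using Nat.strong_induction_on generalizing k with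
  | _ N ih =>
  by_cases hlt : n < pentExp k
  · rw [sub_mul, map_sub, coeff_pentagonalTail_mul_eq_zero hlt, mul_assoc, coeff_X_pow_mul',
      if_neg (by omega), sub_zero]
  · have hkn := le_pentExp k
    have e3 : pentExp (k + 2) = pentExp k + (6 * k + 7) := by
      rw [pentExp_succ (k + 1), pentExp_succ k]; ring
    have e : (pentagonalTail k - X ^ pentExp k * l k) * G =
        X ^ pentExp k * ((1 - X ^ (2 * k + 1) - X ^ (3 * k + 2) * (1 - X ^ (2 * k + 3))
          - l k + X ^ (6 * k + 7) * l (k + 2)) * G) +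
        (pentagonalTail (k + 2) - X ^ pentExp (k + 2) * l (k + 2)) * G := by
      rw [e3, pow_add]
      linear_combination G * pentagonalTail_eq_add (hk₀.trans hk)
    rw [e, map_add]
    exact add_nonneg (((Nonneg.X_pow _).mul (h k hk)) n) (ih _ (by omega) (by omega) rfl)

/-! ### Gaussian binomial coefficients -/

/-- The Gaussian binomial coefficient of `n` and `k` at `Q`, defined by the `q`-Pascal rule. -/
def gaussBinom {R : Type*} [CommRing R] (Q : R) : ℕ → ℕ → R
  | _, 0 => 1
  | 0, _ + 1 => 0
  | n + 1, k + 1 => gaussBinom Q n k + Q ^ (k + 1) * gaussBinom Q n (k + 1)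

section GaussBinom

variable {R : Type*} [CommRing R] (Q : R)

theorem gaussBinom_zero_right (n : ℕ) : gaussBinom Q n 0 = 1 := by
  cases n <;> rfl

theorem gaussBinom_succ_succ (n k : ℕ) : gaussBinom Q (n + 1) (k + 1) =
    gaussBinom Q n k + Q ^ (k + 1) * gaussBinom Q n (k + 1) := rfl

theorem gaussBinom_eq_zero {n k : ℕ} (h : n < k) : gaussBinom Q n k = 0 := by
  induction n generalizing k with
  | zero => obtain ⟨j, rfl⟩ : ∃ j, k = j + 1 := ⟨k - 1, by omega⟩; rfl
  | succ n ih =>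
    obtain ⟨j, rfl⟩ : ∃ j, k = j + 1 := ⟨k - 1, by omega⟩
    rw [gaussBinom_succ_succ, ih (by omega), ih (by omega)]; ring

/-- The second `q`-Pascal rule. -/
theorem gaussBinom_succ_succ' {n k : ℕ} (h : k ≤ n) : gaussBinom Q (n + 1) (k + 1) =
    Q ^ (n - k) * gaussBinom Q n k + gaussBinom Q n (k + 1) := by
  induction n generalizing k with
  | zero =>
    obtain rfl : k = 0 := by omega
    simp [gaussBinom]
  | succ n ih =>
    rcases Nat.eq_zero_or_pos k with rfl | hk
    · have h1 := ih (Nat.zero_le n)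
      have h2 := gaussBinom_succ_succ Q n 0
      have h3 := gaussBinom_succ_succ Q (n + 1) 0
      simp only [gaussBinom_zero_right, Nat.sub_zero, zero_add, pow_one] at h1 h2 h3 ⊢
      rw [pow_succ]
      linear_combination h3 + Q * h1 - h2
    · obtain ⟨j, rfl⟩ : ∃ j, k = j + 1 := ⟨k - 1, by omega⟩
      have h1 := ih (show j ≤ n by omega)
      have h2 := gaussBinom_succ_succ Q n j
      have h3 := gaussBinom_succ_succ Q (n + 1) (j + 1)
      have h4 := gaussBinom_succ_succ Q n (j + 1)
      obtain ⟨r, hr⟩ : ∃ r, n = j + r := ⟨n - j, by omega⟩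
      have e1 : n - j = r := by omega
      have e2 : n + 1 - (j + 1) = r := by omega
      rw [e1] at h1
      rw [e2]
      rcases Nat.lt_or_ge n (j + 1) with hlt | hge
      · have e3 : r = 0 := by omega
        subst e3
        have z1 : gaussBinom Q n (j + 1) = 0 := gaussBinom_eq_zero Q (by omega)
        have z2 : gaussBinom Q n (j + 1 + 1) = 0 := gaussBinom_eq_zero Q (by omega)
        rw [h3, h4, z1, z2]
        ring
      · have h5 := ih hge
        obtain ⟨s, rfl⟩ : ∃ s, r = s + 1 := ⟨r - 1, by omega⟩
        have e4 : n - (j + 1) = s := by omega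
        rw [e4] at h5
        linear_combination h3 + h1 + Q ^ (j + 2) * h5 - Q ^ (s + 1) * h2 - h4

theorem one_sub_mul_gaussBinom {n k : ℕ} (h : k ≤ n) :
    (1 - Q ^ (k + 1)) * gaussBinom Q (n + 1) (k + 1) = (1 - Q ^ (n + 1)) * gaussBinom Q n k := by
  have h1 := gaussBinom_succ_succ Q n k
  have h2 := gaussBinom_succ_succ' Q h
  have h3 : Q ^ (n + 1) = Q ^ (k + 1) * Q ^ (n - k) := by rw [← pow_add]; congr 1; omega
  rw [h3]
  linear_combination h1 - Q ^ (k + 1) * h2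

/-- The homogeneous `q`-binomial theorem. -/
theorem prod_add_mul_pow (x y : R) (n : ℕ) : ∏ r ∈ Finset.range n, (x + y * Q ^ r) =
    ∑ k ∈ Finset.range (n + 1), Q ^ (k.choose 2) * gaussBinom Q n k * y ^ k * x ^ (n - k) := by
  induction n with
  | zero => simp [gaussBinom]
  | succ n ih =>
    rw [Finset.prod_range_succ, ih, Finset.sum_range_succ' _ (n + 1)]
    have e : ∀ k ∈ Finset.range (n + 1),
        Q ^ ((k + 1).choose 2) * gaussBinom Q (n + 1) (k + 1) * y ^ (k + 1) *
          x ^ (n + 1 - (k + 1)) =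
        Q ^ (k.choose 2) * gaussBinom Q n k * y ^ k * x ^ (n - k) * (y * Q ^ n) +
        Q ^ ((k + 1).choose 2) * gaussBinom Q n (k + 1) * y ^ (k + 1) * x ^ (n - k) := by
      intro k hk
      rw [Finset.mem_range] at hk
      rw [gaussBinom_succ_succ' Q (by omega : k ≤ n), Nat.add_sub_add_right]
      have h1 : Q ^ ((k + 1).choose 2) * Q ^ (n - k) = Q ^ (k.choose 2) * Q ^ n := by
        rw [← pow_add, ← pow_add]; congr 1
        have h2 := Nat.choose_succ_succ' k 1
        simp only [Nat.choose_one_right, Nat.reduceAdd] at h2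
        omega
      linear_combination (gaussBinom Q n k * y ^ (k + 1) * x ^ (n - k)) * h1
    rw [Finset.sum_congr rfl e, Finset.sum_add_distrib, ← Finset.sum_mul, mul_add, add_comm,
      add_assoc]
    congr 1
    conv_lhs => rw [Finset.sum_range_succ', add_mul, Finset.sum_mul]
    conv_rhs => rw [Finset.sum_range_succ, gaussBinom_eq_zero Q (Nat.lt_succ_self n)]
    simp only [gaussBinom_zero_right, mul_zero, zero_mul, add_zero, Nat.sub_zero, pow_zero, mul_one,
      pow_succ x n]
    refine congrArg₂ _ (Finset.sum_congr rfl fun k hk => ?_) (by ring)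
    rw [Finset.mem_range] at hk
    have h2 : n - k = n - (k + 1) + 1 := by omega
    rw [h2, pow_succ]; ring

end GaussBinom

/-! ### The Jacobi triple product -/

theorem qPochInf_mul_partsSeries {a m : ℕ} (ha : 1 ≤ a) (hm : 1 ≤ m) :
    qPochInf a m * partsSeries (Set.range fun j : ℕ => a + m * j) = 1 := by
  rw [← partsProd_progression ha hm, partsProd_mul_partsSeries]

theorem X_pow_dvd_qPochInf_sub_one {a m : ℕ} (ha : 1 ≤ a) (hm : 1 ≤ m) :
    X ^ a ∣ qPochInf a m - 1 := by
  have h : X ^ a ∣ 1 - partsSeries (Set.range fun j : ℕ => a + m * j) := by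
    rw [X_pow_dvd_iff]
    intro n hn
    rcases Nat.eq_zero_or_pos n with rfl | hn0
    · rw [map_sub, coeff_zero_partsSeries]; simp
    · rw [map_sub, coeff_one, if_neg (by omega), coeff_partsSeries_eq_zero hn0, sub_zero]
      rintro _ ⟨j, rfl⟩ _
      simp only
      omega
  have e : qPochInf a m - 1 =
      qPochInf a m * (1 - partsSeries (Set.range fun j : ℕ => a + m * j)) := by
    rw [mul_sub, qPochInf_mul_partsSeries ha hm]; ring
  rw [e]
  exact h.mul_left _

theorem qPochInf_eq_prod_mul {a m : ℕ} (hm : 1 ≤ m) (N : ℕ) : qPochInf a m =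
    (∏ j ∈ Finset.range N, (1 - X ^ (a + m * j))) * qPochInf (a + m * N) m := by
  have e : (fun j : ℕ => 1 - (X : PowerSeries ℤ) ^ (a + m * (j + N))) =
      fun j : ℕ => 1 - (X : PowerSeries ℤ) ^ (a + m * N + m * j) := by
    funext j; congr 2; ring
  have h : Multipliable fun j : ℕ => 1 - (X : PowerSeries ℤ) ^ (a + m * (j + N)) := by
    rw [e]; exact multipliable_qPochInf _ _ hm
  have := h.prod_mul_tprod_nat_mul'
    (f := fun j : ℕ => 1 - (X : PowerSeries ℤ) ^ (a + m * j))
  rw [qPochInf, ← this, e, qPochInf]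

theorem X_pow_dvd_qPochInf_sub_prod {a m : ℕ} (ha : 1 ≤ a) (hm : 1 ≤ m) (N : ℕ) :
    X ^ (a + m * N) ∣ qPochInf a m - ∏ j ∈ Finset.range N, (1 - X ^ (a + m * j)) := by
  have e : qPochInf a m - ∏ j ∈ Finset.range N, (1 - X ^ (a + m * j)) =
      (∏ j ∈ Finset.range N, (1 - X ^ (a + m * j))) * (qPochInf (a + m * N) m - 1) := by
    conv_lhs => rw [qPochInf_eq_prod_mul hm N]
    ring
  rw [e]
  exact (X_pow_dvd_qPochInf_sub_one (by omega) hm).mul_left _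

/-- The exponent `m j (j - 1) / 2 + i j` of the theta series as a natural number; it is nonnegative
for `i < m`. -/
def thetaExp (m i : ℕ) (j : ℤ) : ℕ := ((m : ℤ) * (j * (j - 1) / 2) + (i : ℤ) * j).toNat

theorem two_mul_choose_two (j : ℤ) : 2 * (j * (j - 1) / 2) = j * (j - 1) :=
  Int.two_mul_ediv_two_of_even (by grind)

theorem natCast_thetaExp {m i : ℕ} (him : i < m) (j : ℤ) :
    (thetaExp m i j : ℤ) = (m : ℤ) * (j * (j - 1) / 2) + (i : ℤ) * j := by
  refine Int.toNat_of_nonneg ?_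
  have h := two_mul_choose_two j
  have him' : (i : ℤ) < m := by exact_mod_cast him
  have hi0 : (0 : ℤ) ≤ i := by positivity
  rcases le_or_gt 0 j with hj | hj
  · have h1 : 0 ≤ j * (j - 1) := by
      rcases eq_or_lt_of_le hj with rfl | hj
      · simp
      · exact mul_nonneg hj.le (by omega)
    have : 0 ≤ j * (j - 1) / 2 := by omega
    positivity
  · nlinarith [mul_nonneg_of_nonpos_of_nonpos hj.le (by omega : j + 1 ≤ 0)]

theorem two_mul_thetaExp {m i : ℕ} (him : i < m) (j : ℤ) :
    2 * (thetaExp m i j : ℤ) = (m : ℤ) * (j * (j - 1)) + 2 * (i : ℤ) * j := by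
  have h := two_mul_choose_two j
  rw [natCast_thetaExp him]
  linear_combination (m : ℤ) * h

theorem two_mul_natCast_choose_two (n : ℕ) : 2 * ((n.choose 2 : ℕ) : ℤ) = n * (n - 1) := by
  induction n with
  | zero => simp
  | succ n ih =>
    rw [Nat.choose_succ_succ' n 1, Nat.choose_one_right]
    push_cast
    linear_combination ih

/-- A finite form of the Jacobi triple product. -/
theorem prod_mul_prod_eq_sum {m i : ℕ} (him : i < m) (N : ℕ) :
    (∏ j ∈ Finset.range N, (1 - (X : PowerSeries ℤ) ^ (i + m * j))) *
      ∏ j ∈ Finset.range N, (1 - X ^ (m - i + m * j)) =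
    ∑ k ∈ Finset.range (2 * N + 1), (-1) ^ (k + N) * X ^ thetaExp m i ((k : ℤ) - N) *
      gaussBinom (X ^ m) (2 * N) k := by
  have h := prod_add_mul_pow ((X : PowerSeries ℤ) ^ m) (X ^ (m * N)) (-X ^ i) (2 * N)
  set c : ℕ := m * N * N + ∑ r ∈ Finset.range N, (i + m * r) with hc
  have h2c : 2 * (c : ℤ) = 2 * m * N * N + 2 * i * N + m * N * (N - 1) := by
    have : 2 * ((∑ r ∈ Finset.range N, (i + m * r) : ℕ) : ℤ) = 2 * i * N + m * N * (N - 1) := by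
      clear hc h
      induction N with
      | zero => simp
      | succ n ih => rw [Finset.sum_range_succ]; push_cast at ih ⊢; linear_combination ih
    rw [hc]; push_cast at this ⊢; linear_combination this
  have hl : ∏ r ∈ Finset.range (2 * N), ((X : PowerSeries ℤ) ^ (m * N) + -X ^ i * (X ^ m) ^ r) =
      (-1) ^ N * X ^ c * ((∏ j ∈ Finset.range N, (1 - (X : PowerSeries ℤ) ^ (i + m * j))) *
      ∏ j ∈ Finset.range N, (1 - X ^ (m - i + m * j))) := by
    rw [two_mul, Finset.prod_range_add]
    have h1 : ∏ r ∈ Finset.range N, ((X : PowerSeries ℤ) ^ (m * N) + -X ^ i * (X ^ m) ^ (N + r)) =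
        X ^ (m * N * N) * ∏ j ∈ Finset.range N, (1 - (X : PowerSeries ℤ) ^ (i + m * j)) := by
      have : ∀ r ∈ Finset.range N, (X : PowerSeries ℤ) ^ (m * N) + -X ^ i * (X ^ m) ^ (N + r) =
          X ^ (m * N) * (1 - X ^ (i + m * r)) := by
        intro r _
        rw [← pow_mul, mul_add m, pow_add, pow_add]; ring
      rw [Finset.prod_congr rfl this, Finset.prod_mul_distrib, Finset.prod_const,
        Finset.card_range, ← pow_mul]
    have h2 : ∏ r ∈ Finset.range N, ((X : PowerSeries ℤ) ^ (m * N) + -X ^ i * (X ^ m) ^ r) =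
        (-1) ^ N * X ^ (∑ r ∈ Finset.range N, (i + m * r)) *
          ∏ j ∈ Finset.range N, (1 - X ^ (m - i + m * j)) := by
      rw [← Finset.prod_range_reflect (fun j => 1 - (X : PowerSeries ℤ) ^ (m - i + m * j)),
        ← Finset.prod_pow_eq_pow_sum]
      have : ((-1 : PowerSeries ℤ)) ^ N = ∏ r ∈ Finset.range N, (-1) := by simp
      rw [this, ← Finset.prod_mul_distrib, ← Finset.prod_mul_distrib]
      refine Finset.prod_congr rfl fun r hr => ?_
      rw [Finset.mem_range] at hr
      have e1 : m * N = (i + m * r) + (m - i + m * (N - 1 - r)) := by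
        obtain ⟨s, rfl⟩ : ∃ s, N = r + s + 1 := ⟨N - r - 1, by omega⟩
        have : r + s + 1 - 1 - r = s := by omega
        rw [this]
        have e3 : m * (r + s + 1) = m * r + m * s + m := by ring
        omega
      rw [e1, ← pow_mul, pow_add, pow_add X i]; ring
    rw [h1, h2, hc, pow_add]; ring
  have hr : ∑ k ∈ Finset.range (2 * N + 1), ((X : PowerSeries ℤ) ^ m) ^ (k.choose 2) *
      gaussBinom (X ^ m) (2 * N) k * (-X ^ i) ^ k * (X ^ (m * N)) ^ (2 * N - k) =
      (-1) ^ N * X ^ c * ∑ k ∈ Finset.range (2 * N + 1), (-1) ^ (k + N) *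
        X ^ thetaExp m i ((k : ℤ) - N) * gaussBinom (X ^ m) (2 * N) k := by
    rw [Finset.mul_sum]
    refine Finset.sum_congr rfl fun k hk => ?_
    rw [Finset.mem_range] at hk
    have e : m * k.choose 2 + i * k + m * N * (2 * N - k) = c + thetaExp m i ((k : ℤ) - N) := by
      have h1 := two_mul_thetaExp him ((k : ℤ) - N)
      have h2 := two_mul_natCast_choose_two k
      zify [show k ≤ 2 * N by omega]
      refine mul_left_cancel₀ (two_ne_zero (α := ℤ)) ?_
      linear_combination m * h2 - h1 - h2c
    have e2 : (-1 : PowerSeries ℤ) ^ N * (-1) ^ (k + N) = (-1) ^ k := by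
      rw [pow_add, mul_left_comm, ← mul_pow]; simp
    have e3 : (X : PowerSeries ℤ) ^ c * X ^ thetaExp m i ((k : ℤ) - N) =
        (X ^ m) ^ (k.choose 2) * (X ^ i) ^ k * (X ^ (m * N)) ^ (2 * N - k) := by
      rw [← pow_mul, ← pow_mul, ← pow_mul, ← pow_add, ← pow_add, ← pow_add, e]
    rw [neg_pow (X ^ i) k]
    linear_combination (-gaussBinom (X ^ m) (2 * N) k * (-1) ^ k) * e3 -
      (X ^ c * X ^ thetaExp m i ((k : ℤ) - N) * gaussBinom (X ^ m) (2 * N) k) * e2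
  rw [hl, hr] at h
  refine mul_left_cancel₀ ?_ h
  refine mul_ne_zero (pow_ne_zero _ (by simp)) (pow_ne_zero _ X_ne_zero)

/-- A Gaussian binomial coefficient at `q^m` agrees with `1 / (q^m; q^m)_∞` to high order. -/
theorem X_pow_dvd_gaussBinom_mul_prod {m n k : ℕ} (h : k ≤ n) :
    (X : PowerSeries ℤ) ^ (m * (n - k + 1)) ∣
      gaussBinom (X ^ m) n k * (∏ j ∈ Finset.range k, (1 - X ^ (m + m * j))) - 1 := by
  induction k generalizing n with
  | zero => simp [gaussBinom_zero_right]
  | succ k ih =>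
    obtain ⟨n, rfl⟩ : ∃ j, n = j + 1 := ⟨n - 1, by omega⟩
    have h1 := ih (show k ≤ n by omega)
    have h2 := one_sub_mul_gaussBinom ((X : PowerSeries ℤ) ^ m) (show k ≤ n by omega)
    rw [Nat.add_sub_add_right, Finset.prod_range_succ]
    have e : gaussBinom ((X : PowerSeries ℤ) ^ m) (n + 1) (k + 1) *
        ((∏ j ∈ Finset.range k, (1 - X ^ (m + m * j))) * (1 - X ^ (m + m * k))) - 1 =
        (gaussBinom (X ^ m) n k * (∏ j ∈ Finset.range k, (1 - X ^ (m + m * j))) - 1) -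
        X ^ (m * (n + 1)) *
          (gaussBinom (X ^ m) n k * (∏ j ∈ Finset.range k, (1 - X ^ (m + m * j)))) := by
      rw [← pow_mul, ← pow_mul] at h2
      have e1 : m + m * k = m * (k + 1) := by ring
      rw [e1]
      linear_combination (∏ j ∈ Finset.range k, (1 - (X : PowerSeries ℤ) ^ (m + m * j))) * h2
    rw [e]
    refine dvd_sub h1 (Dvd.dvd.mul_right (pow_dvd_pow _ ?_) _)
    exact Nat.mul_le_mul_left _ (by omega)

theorem natAbs_le_thetaExp {m i : ℕ} (hi : 1 ≤ i) (him : i < m) (j : ℤ) :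
    j.natAbs ≤ thetaExp m i j := by
  have h := two_mul_thetaExp him j
  have him' : (i : ℤ) + 1 ≤ m := by exact_mod_cast him
  have hi' : (1 : ℤ) ≤ i := by exact_mod_cast hi
  zify
  rcases le_or_gt 0 j with hj | hj
  · rw [abs_of_nonneg hj]
    have h1 : 0 ≤ j * (j - 1) := by
      rcases eq_or_lt_of_le hj with rfl | hj
      · simp
      · exact mul_nonneg hj.le (by omega)
    nlinarith [mul_nonneg (show (0 : ℤ) ≤ m by omega) h1]
  · rw [abs_of_neg hj]
    have h1 : 0 ≤ j * (j + 1) := mul_nonneg_of_nonpos_of_nonpos hj.le (by omega)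
    nlinarith [mul_nonneg (show (0 : ℤ) ≤ m by omega) h1]

/-- The **Jacobi triple product** `(q^i, q^(m-i), q^m; q^m)_∞ = ∑ (-1)^j q^(m j (j-1)/2 + i j)`,
up to terms of order at least `N`. -/
theorem X_pow_dvd_thetaProd_sub_sum {m i : ℕ} (hi : 1 ≤ i) (him : i < m) (N : ℕ) :
    (X : PowerSeries ℤ) ^ N ∣ thetaProd i m - ∑ k ∈ Finset.range (2 * N + 1),
      (-1) ^ (k + N) * X ^ thetaExp m i ((k : ℤ) - N) := by
  have hm : 1 ≤ m := by omega
  have hN : N ≤ m * N := Nat.le_mul_of_pos_left N hm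
  have h1 := (pow_dvd_pow (X : PowerSeries ℤ) (show N ≤ i + m * N by omega)).trans
    (X_pow_dvd_qPochInf_sub_prod hi hm N)
  have h2 := (pow_dvd_pow (X : PowerSeries ℤ) (show N ≤ m - i + m * N by omega)).trans
    (X_pow_dvd_qPochInf_sub_prod (show 1 ≤ m - i by omega) hm N)
  set A := ∏ j ∈ Finset.range N, (1 - (X : PowerSeries ℤ) ^ (i + m * j))
  set B := ∏ j ∈ Finset.range N, (1 - (X : PowerSeries ℤ) ^ (m - i + m * j))
  have h3 : (X : PowerSeries ℤ) ^ N ∣ A * B * qPochInf m m -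
      ∑ k ∈ Finset.range (2 * N + 1), (-1) ^ (k + N) * X ^ thetaExp m i ((k : ℤ) - N) := by
    rw [prod_mul_prod_eq_sum him N, Finset.sum_mul, ← Finset.sum_sub_distrib]
    refine Finset.dvd_sum fun k hk => ?_
    rw [Finset.mem_range] at hk
    have h4 := X_pow_dvd_gaussBinom_mul_prod (m := m) (show k ≤ 2 * N by omega)
    have h5 := X_pow_dvd_qPochInf_sub_prod hm hm k
    set e := min (2 * N - k + 1) (k + 1) with he
    have h6 : (X : PowerSeries ℤ) ^ (m * e) ∣
        gaussBinom (X ^ m) (2 * N) k * qPochInf m m - 1 := by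
      have e1 : gaussBinom ((X : PowerSeries ℤ) ^ m) (2 * N) k * qPochInf m m - 1 =
          (gaussBinom (X ^ m) (2 * N) k * (∏ j ∈ Finset.range k, (1 - X ^ (m + m * j))) - 1) +
          gaussBinom (X ^ m) (2 * N) k *
            (qPochInf m m - ∏ j ∈ Finset.range k, (1 - X ^ (m + m * j))) := by ring
      rw [e1]
      refine dvd_add ((pow_dvd_pow _ ?_).trans h4) (((pow_dvd_pow _ ?_).trans h5).mul_left _)
      · exact Nat.mul_le_mul_left _ (min_le_left _ _)
      · calc m * e ≤ m * (k + 1) := Nat.mul_le_mul_left _ (min_le_right _ _)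
          _ = _ := by ring
    have e2 : (-1 : PowerSeries ℤ) ^ (k + N) * X ^ thetaExp m i ((k : ℤ) - N) *
        gaussBinom (X ^ m) (2 * N) k * qPochInf m m -
        (-1) ^ (k + N) * X ^ thetaExp m i ((k : ℤ) - N) =
        (-1) ^ (k + N) * (X ^ thetaExp m i ((k : ℤ) - N) *
          (gaussBinom (X ^ m) (2 * N) k * qPochInf m m - 1)) := by ring
    rw [e2]
    refine Dvd.dvd.mul_left ?_ _
    have h9 : (X : PowerSeries ℤ) ^ (thetaExp m i ((k : ℤ) - N) + m * e) ∣
        X ^ thetaExp m i ((k : ℤ) - N) *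
          (gaussBinom (X ^ m) (2 * N) k * qPochInf m m - 1) := by
      rw [pow_add]; exact mul_dvd_mul_left _ h6
    refine (pow_dvd_pow _ ?_).trans h9
    -- with `a = |k - N|`, the exponent is at least `m (a (a - 1) / 2 + N - a + 1)`
    have h7 := two_mul_thetaExp him ((k : ℤ) - N)
    have him' : (i : ℤ) + 1 ≤ m := by exact_mod_cast him
    have hi' : (1 : ℤ) ≤ i := by exact_mod_cast hi
    have hN' : (N : ℤ) ≤ m * N := by exact_mod_cast hN
    zify
    rcases le_or_gt N k with hkN | hkN
    · have he' : (e : ℤ) = 2 * N - k + 1 := by omega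
      obtain ⟨a, rfl⟩ : ∃ a, k = N + a := ⟨k - N, by omega⟩
      rw [he']
      push_cast at h7 ⊢
      have h8 : (0 : ℤ) ≤ (a - 1) * (a - 2) := by
        rcases (by omega : a ≤ 1 ∨ 2 ≤ a) with h | h
        · exact mul_nonneg_of_nonpos_of_nonpos (by omega) (by omega)
        · exact mul_nonneg (by omega) (by omega)
      nlinarith [mul_nonneg (show (0 : ℤ) ≤ m by omega) h8,
        mul_nonneg (show (0 : ℤ) ≤ i by omega) (show (0 : ℤ) ≤ a by omega)]
    · have he' : (e : ℤ) = k + 1 := by omega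
      obtain ⟨a, rfl⟩ : ∃ a, N = k + a := ⟨N - k, by omega⟩
      rw [he']
      push_cast at h7 hN' ⊢
      have h8 : (0 : ℤ) ≤ (a - 1) * (a - 2) := by
        rcases (by omega : a ≤ 1 ∨ 2 ≤ a) with h | h
        · exact mul_nonneg_of_nonpos_of_nonpos (by omega) (by omega)
        · exact mul_nonneg (by omega) (by omega)
      nlinarith [mul_nonneg (show (0 : ℤ) ≤ m by omega) h8,
        mul_nonneg (show (0 : ℤ) ≤ m - i by omega) (show (0 : ℤ) ≤ a by omega)]
  have e : thetaProd i m - ∑ k ∈ Finset.range (2 * N + 1),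
      (-1) ^ (k + N) * X ^ thetaExp m i ((k : ℤ) - N) =
      (qPochInf i m - A) * (qPochInf (m - i) m * qPochInf m m) +
      (qPochInf (m - i) m - B) * (A * qPochInf m m) +
      (A * B * qPochInf m m - ∑ k ∈ Finset.range (2 * N + 1),
        (-1) ^ (k + N) * X ^ thetaExp m i ((k : ℤ) - N)) := by
    rw [thetaProd]; ring
  rw [e]
  exact dvd_add (dvd_add (h1.mul_right _) (h2.mul_right _)) h3

theorem thetaSign_eq_sum {m i : ℕ} (hi : 1 ≤ i) (him : i < m) {n N : ℕ} (h : n ≤ N) :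
    thetaSign m i n = ∑ j ∈ Finset.Icc (-(N : ℤ)) N,
      if thetaExp m i j = n then (Int.negOnePow j : ℤ) else 0 := by
  unfold thetaSign
  have e : {j : ℤ | (m : ℤ) * (j * (j - 1) / 2) + (i : ℤ) * j = (n : ℤ)} =
      ↑((Finset.Icc (-(N : ℤ)) N).filter fun j => thetaExp m i j = n) := by
    ext j
    have h1 := natCast_thetaExp him j
    have h2 := natAbs_le_thetaExp hi him j
    simp only [Set.mem_ofPred_eq, Finset.coe_filter, Finset.mem_Icc]
    omega
  rw [e, finsum_mem_coe_finset, Finset.sum_filter]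

/-- The coefficients of the theta product. -/
theorem coeff_thetaProd {m i : ℕ} (hi : 1 ≤ i) (him : i < m) (n : ℕ) :
    coeff n (thetaProd i m) = thetaSign m i n := by
  have h := X_pow_dvd_iff.mp (X_pow_dvd_thetaProd_sub_sum hi him (n + 1)) n (Nat.lt_succ_self n)
  rw [map_sub, sub_eq_zero] at h
  rw [h, thetaSign_eq_sum hi him (Nat.le_succ n), map_sum]
  refine Finset.sum_bij' (fun k _ => (k : ℤ) - ((n + 1 : ℕ) : ℤ))
    (fun j _ => (j + ((n + 1 : ℕ) : ℤ)).toNat) ?_ ?_ ?_ ?_ ?_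
  · intro k hk; rw [Finset.mem_range] at hk; rw [Finset.mem_Icc]; omega
  · intro j hj; rw [Finset.mem_Icc] at hj; rw [Finset.mem_range]; omega
  · intro k hk; simp
  · intro j hj; rw [Finset.mem_Icc] at hj; omega
  · intro k hk
    have e1 : (-1 : PowerSeries ℤ) ^ (k + (n + 1)) =
        PowerSeries.C ((-1) ^ (k + (n + 1))) := by rw [map_pow, map_neg, map_one]
    rw [e1, coeff_C_mul, coeff_X_pow]
    have e2 : (((k : ℤ) - ((n + 1 : ℕ) : ℤ)).negOnePow : ℤ) = (-1) ^ (k + (n + 1)) := by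
      rw [Int.negOnePow_sub, ← Int.negOnePow_add]
      have := Int.coe_negOnePow_natCast (k + (n + 1))
      push_cast at this ⊢
      exact this
    rw [e2]
    by_cases hn : thetaExp m i ((k : ℤ) - ((n + 1 : ℕ) : ℤ)) = n
    · rw [if_pos hn, if_pos hn.symm, mul_one]
    · rw [if_neg hn, if_neg (fun h => hn h.symm), mul_zero]

/-! ### The signs of the theta series -/

theorem thetaExp_injective {m i : ℕ} (hi : 1 ≤ i) (him : 2 * i < m) :
    Function.Injective (thetaExp m i) := by
  intro j l h
  have h1 := two_mul_thetaExp (show i < m by omega) j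
  have h2 := two_mul_thetaExp (show i < m by omega) l
  rw [h] at h1
  have h3 : (j - l) * ((m : ℤ) * (j + l - 1) + 2 * i) = 0 := by linear_combination h2 - h1
  rcases mul_eq_zero.mp h3 with h4 | h4
  · omega
  · exfalso
    have h5 : (m : ℤ) ∣ 2 * i := ⟨-(j + l - 1), by linear_combination h4⟩
    have h6 := Int.le_of_dvd (by omega) h5
    omega

theorem thetaSign_thetaExp {m i : ℕ} (hi : 1 ≤ i) (him : 2 * i < m) (j : ℤ) :
    thetaSign m i (thetaExp m i j) = Int.negOnePow j := by
  rw [thetaSign_eq_sum hi (by omega) le_rfl, Finset.sum_eq_single j]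
  · simp
  · intro l _ hl
    exact if_neg fun h => hl (thetaExp_injective hi him h)
  · intro hj
    have := natAbs_le_thetaExp hi (show i < m by omega) j
    rw [Finset.mem_Icc] at hj
    omega

theorem thetaSign_of_eq {m i n : ℕ} (hi : 1 ≤ i) (him : 2 * i < m) (j : ℤ)
    (h : 2 * (n : ℤ) = m * (j * (j - 1)) + 2 * i * j) : thetaSign m i n = Int.negOnePow j := by
  have h1 := two_mul_thetaExp (show i < m by omega) j
  have h2 : n = thetaExp m i j := by zify; linarith
  rw [h2, thetaSign_thetaExp hi him]

theorem thetaSign_eq_zero_or {m i : ℕ} (hi : 1 ≤ i) (him : 2 * i < m) (n : ℕ) :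
    thetaSign m i n = 0 ∨ ∃ j : ℤ, 2 * (n : ℤ) = m * (j * (j - 1)) + 2 * i * j ∧
      thetaSign m i n = Int.negOnePow j := by
  by_cases h : ∃ j, thetaExp m i j = n
  · obtain ⟨j, rfl⟩ := h
    exact Or.inr ⟨j, two_mul_thetaExp (by omega) j, thetaSign_thetaExp hi him j⟩
  · left
    rw [thetaSign_eq_sum hi (by omega) le_rfl]
    exact Finset.sum_eq_zero fun j _ => if_neg fun hj => h ⟨j, hj⟩

/-- The exponents of the theta series grow with the absolute value of the index. -/
theorem le_two_mul_of_le_abs {m i n : ℕ} (him : 2 * i < m) {j a : ℤ} (ha : 3 ≤ a)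
    (h : 2 * (n : ℤ) = m * (j * (j - 1)) + 2 * i * j) (hj : a ≤ |j|) :
    m * (a * (a - 1)) + 2 * i * a ≤ 2 * (n : ℤ) := by
  have him' : 2 * (i : ℤ) < m := by exact_mod_cast him
  have hi0 : (0 : ℤ) ≤ i := by positivity
  rw [h]
  rcases le_or_gt 0 j with hj0 | hj0
  · rw [abs_of_nonneg hj0] at hj
    have h1 : a * (a - 1) ≤ j * (j - 1) := by nlinarith
    nlinarith [mul_le_mul_of_nonneg_left h1 (show (0 : ℤ) ≤ m by omega),
      mul_le_mul_of_nonneg_left hj hi0]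
  · rw [abs_of_neg hj0] at hj
    have h1 : a * a ≤ j * j := by nlinarith
    nlinarith [mul_le_mul_of_nonneg_left h1 (show (0 : ℤ) ≤ m by omega),
      mul_nonneg (show (0 : ℤ) ≤ m - 2 * i by omega) (show (0 : ℤ) ≤ -j by omega),
      mul_nonneg (show (0 : ℤ) ≤ m - 2 * i by omega) (show (0 : ℤ) ≤ a by omega)]

theorem thetaSign_eq_zero {m i n : ℕ} (hi : 1 ≤ i) (him : 2 * i < m) (h0 : n ≠ 0) (h1 : n ≠ i)
    (h2 : n ≠ m - i) (h3 : n ≠ m + 2 * i) (h4 : n ≠ 3 * m - 2 * i) (h5 : n < 3 * m + 3 * i) :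
    thetaSign m i n = 0 := by
  rcases thetaSign_eq_zero_or hi him n with h | ⟨j, hj, -⟩
  · exact h
  · exfalso
    rcases le_or_gt 3 |j| with h3j | h3j
    · have := le_two_mul_of_le_abs him le_rfl hj h3j
      omega
    · rw [abs_lt] at h3j
      obtain ⟨hl, hu⟩ := h3j
      interval_cases j <;> omega

theorem thetaSign_le_one {m i : ℕ} (hi : 1 ≤ i) (him : 2 * i < m) (n : ℕ) :
    thetaSign m i n ≤ 1 := by
  rcases thetaSign_eq_zero_or hi him n with h | ⟨j, -, h⟩
  · rw [h]; norm_num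
  · rw [h]; rcases Int.even_or_odd j with he | ho
    · rw [Int.negOnePow_even j he]; norm_num
    · rw [Int.negOnePow_odd j ho]; norm_num

/-- The positive signs come from even indices, hence sit at few small exponents. -/
theorem thetaSign_nonpos {m i n : ℕ} (hi : 1 ≤ i) (him : 2 * i < m) (h0 : n ≠ 0)
    (h1 : n ≠ m + 2 * i) (h2 : n ≠ 3 * m - 2 * i) (h3 : n < 6 * m + 4 * i) :
    thetaSign m i n ≤ 0 := by
  rcases thetaSign_eq_zero_or hi him n with h | ⟨j, hj, h⟩
  · rw [h]
  · rcases Int.even_or_odd j with he | ho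
    · exfalso
      obtain ⟨l, rfl⟩ := he
      rcases le_or_gt 4 |l + l| with h3j | h3j
      · have := le_two_mul_of_le_abs him (by norm_num) hj h3j
        omega
      · rw [abs_lt] at h3j
        obtain ⟨hl, hu⟩ := h3j
        have hl' : -1 ≤ l := by omega
        have hu' : l ≤ 1 := by omega
        interval_cases l <;> omega
    · rw [h, Int.negOnePow_odd j ho]; norm_num

theorem thetaSign_self {m i : ℕ} (hi : 1 ≤ i) (him : 2 * i < m) : thetaSign m i i = -1 := by
  rw [thetaSign_of_eq hi him 1 (by ring)]; simp

theorem thetaSign_sub {m i : ℕ} (hi : 1 ≤ i) (him : 2 * i < m) :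
    thetaSign m i (m - i) = -1 := by
  rw [thetaSign_of_eq hi him (-1) (by rw [Nat.cast_sub (by omega)]; ring)]; simp

/-! ### The coefficients of the truncated series -/

/-- The expression of `C` in terms of the coefficients of the quotient. -/
theorem C_eq_sum_D {τ d i k : ℕ} (hi : 1 ≤ i) (him : i < 2 * d + 2 + τ) (hk : 1 ≤ k) (n : ℕ) :
    C k i (2 * d + 2 + τ) n =
      (-1) ^ (k - 1) * (∑ ℓ ∈ Finset.Ioc (-(k : ℤ)) (k : ℤ),
        (Int.negOnePow ℓ : ℤ) * D τ d i ((n : ℤ) - ℓ * (3 * ℓ - 1) / 2))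
      + (-1) ^ k * thetaSign (2 * d + 2 + τ) i n := by
  have hD : ∀ ℓ : ℤ, D τ d i ((n : ℤ) - ℓ * (3 * ℓ - 1) / 2) =
      coeff n (X ^ pentagonal ℓ * (thetaProd i (2 * d + 2 + τ) * invEuler)) := by
    intro ℓ
    rw [D, coeff_X_pow_mul', ← natCast_pentagonal]
    by_cases h : pentagonal ℓ ≤ n
    · rw [if_pos h, if_pos (by omega)]
      congr 2
      omega
    · rw [if_neg h, if_neg (by omega)]
  have hs : ∑ ℓ ∈ Finset.Ioc (-(k : ℤ)) (k : ℤ),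
      (Int.negOnePow ℓ : ℤ) * D τ d i ((n : ℤ) - ℓ * (3 * ℓ - 1) / 2) =
      coeff n (truncPentagonal k * (thetaProd i (2 * d + 2 + τ) * invEuler)) := by
    rw [truncPentagonal, Finset.sum_mul, map_sum]
    refine Finset.sum_congr rfl fun ℓ _ => ?_
    rw [hD, smul_mul_assoc, map_zsmul, smul_eq_mul]
  have hc : ∀ f : PowerSeries ℤ, coeff n ((-1) ^ (k - 1) * f) = (-1) ^ (k - 1) * coeff n f := by
    intro f
    have e : (-1 : PowerSeries ℤ) ^ (k - 1) = PowerSeries.C ((-1) ^ (k - 1)) := by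
      rw [map_pow, map_neg, map_one]
    rw [e, coeff_C_mul]
  obtain ⟨j, rfl⟩ : ∃ j, k = j + 1 := ⟨k - 1, by omega⟩
  rw [hs, ← coeff_thetaProd hi him, C, mul_assoc, hc, sub_mul, one_mul, map_sub,
    mul_comm (thetaProd i (2 * d + 2 + τ)) invEuler, ← mul_assoc (truncPentagonal _),
    mul_comm (truncPentagonal _) invEuler, Nat.add_sub_cancel, pow_succ]
  ring

/-- For `k = 1`, the truncated series is a difference of consecutive partition numbers, up to the
theta series. -/
theorem C_one_eq {m i : ℕ} (hi : 1 ≤ i) (him : 2 * i < m) (n : ℕ) :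
    C 1 i m n = coeff n ((1 - X) * partsSeries (allowedParts m i)) - thetaSign m i n := by
  rw [C_eq_coeff_pentagonalTail hi him, ← coeff_thetaProd hi (by omega), ← map_sub]
  congr 1
  have h0 : truncPentagonal 0 = 0 := by simp [truncPentagonal]
  have h1 := truncPentagonal_succ 0
  have h2 : pentExp 0 = 0 := rfl
  rw [h0, h2] at h1
  have h3 : thetaProd i m = qPochInf 1 1 * partsSeries (allowedParts m i) := by
    rw [← thetaProd_mul_invEuler hi him]
    linear_combination (-thetaProd i m) * invEuler_mul
  rw [pentagonalTail, h1, h3]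
  ring

/-! ### Numerical semigroups generated by allowed parts -/

theorem closure_mono {A B : Set ℕ} (h : A ⊆ B) {a : ℕ} (ha : a ∈ AddSubmonoid.closure A) :
    a ∈ AddSubmonoid.closure B := AddSubmonoid.closure_mono h ha

theorem mem_closure_self {A : Set ℕ} {a : ℕ} (h : a ∈ A) : a ∈ AddSubmonoid.closure A :=
  AddSubmonoid.subset_closure h

theorem mem_closure_one (a : ℕ) : a ∈ AddSubmonoid.closure ({1} : Set ℕ) := by
  rw [AddSubmonoid.mem_closure_singleton]; exact ⟨a, by simp⟩

theorem mem_closure_pair {x y a : ℕ} (h : x + y = a) :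
    a ∈ AddSubmonoid.closure ({x, y} : Set ℕ) :=
  h ▸ add_mem (mem_closure_self (by simp)) (mem_closure_self (by simp))

theorem mem_closure_of_one_mem {M : Set ℕ} (h : 1 ∈ M) (a : ℕ) : a ∈ AddSubmonoid.closure M :=
  closure_mono (Set.singleton_subset_iff.mpr h) (mem_closure_one a)

theorem mem_closure_two_of_even {a : ℕ} (h : a % 2 = 0) :
    a ∈ AddSubmonoid.closure ({2} : Set ℕ) := by
  rw [AddSubmonoid.mem_closure_singleton]; exact ⟨a / 2, by simp; omega⟩

theorem mem_closure_of_sum_eq {A : Set ℕ} (L : List ℕ) {a : ℕ} (hL : ∀ x ∈ L, x ∈ A)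
    (h : L.sum = a) : a ∈ AddSubmonoid.closure A :=
  h ▸ AddSubmonoid.list_sum_mem _ fun x hx => mem_closure_self (hL x hx)

/-- A criterion for a numerical semigroup to contain all integers from `F` on: `T` lists, for each
residue modulo the generator `p`, a sum of generators in that residue class which is less than
`F + p`. -/
theorem mem_closure_of_table {A : Set ℕ} {p F : ℕ} (T : List (List ℕ)) (hp0 : 1 ≤ p) (hp : p ∈ A)
    (hT : ∀ L ∈ T, ∀ x ∈ L, x ∈ A)
    (h : ∀ r < p, ∃ L ∈ T, L.sum % p = r ∧ L.sum < F + p) {a : ℕ} (ha : F ≤ a) :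
    a ∈ AddSubmonoid.closure A := by
  obtain ⟨L, hL, hmod, hlt⟩ := h (a % p) (Nat.mod_lt _ hp0)
  have hle : L.sum ≤ a := by
    by_contra hc
    have h1 : p ∣ L.sum - a := (Nat.modEq_iff_dvd' (by omega)).mp hmod.symm
    have h2 := Nat.le_of_dvd (by omega) h1
    omega
  obtain ⟨c, hc⟩ : p ∣ a - L.sum := (Nat.modEq_iff_dvd' hle).mp hmod
  have e : a = L.sum + c • p := by rw [smul_eq_mul, mul_comm]; omega
  rw [e]
  exact add_mem (AddSubmonoid.list_sum_mem _ fun x hx => mem_closure_self (hT L hL x hx))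
    (AddSubmonoid.nsmul_mem _ (mem_closure_self hp) c)

theorem mem_closure_two_three {a : ℕ} (h : 2 ≤ a) : a ∈ AddSubmonoid.closure ({2, 3} : Set ℕ) :=
  mem_closure_of_table (p := 2) (F := 2) [[], [3]] (by norm_num) (by simp) (by simp) (by decide) h

theorem mem_closure_two_five {a : ℕ} (h : 4 ≤ a) : a ∈ AddSubmonoid.closure ({2, 5} : Set ℕ) :=
  mem_closure_of_table (p := 2) (F := 4) [[], [5]] (by norm_num) (by simp) (by simp) (by decide) h

theorem mem_closure_two_seven {a : ℕ} (h : 6 ≤ a) : a ∈ AddSubmonoid.closure ({2, 7} : Set ℕ) :=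
  mem_closure_of_table (p := 2) (F := 6) [[], [7]] (by norm_num) (by simp) (by simp) (by decide) h

theorem mem_closure_three_four {a : ℕ} (h : 6 ≤ a) : a ∈ AddSubmonoid.closure ({3, 4} : Set ℕ) :=
  mem_closure_of_table (p := 3) (F := 6) [[], [4], [4, 4]] (by norm_num) (by simp) (by simp)
    (by decide) h

theorem mem_closure_three_five {a : ℕ} (h : 8 ≤ a) : a ∈ AddSubmonoid.closure ({3, 5} : Set ℕ) :=
  mem_closure_of_table (p := 3) (F := 8) [[], [5], [5, 5]] (by norm_num) (by simp) (by simp)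
    (by decide) h

theorem mem_closure_three_seven {a : ℕ} (h : 12 ≤ a) :
    a ∈ AddSubmonoid.closure ({3, 7} : Set ℕ) :=
  mem_closure_of_table (p := 3) (F := 12) [[], [7], [7, 7]] (by norm_num) (by simp) (by simp)
    (by decide) h

theorem mem_closure_four_five {a : ℕ} (h : 12 ≤ a) : a ∈ AddSubmonoid.closure ({4, 5} : Set ℕ) :=
  mem_closure_of_table (p := 4) (F := 12) [[], [5], [5, 5], [5, 5, 5]] (by norm_num) (by simp)
    (by simp) (by decide) h

theorem mem_closure_three_five_seven {a : ℕ} (h : 5 ≤ a) :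
    a ∈ AddSubmonoid.closure ({3, 5, 7} : Set ℕ) :=
  mem_closure_of_table (p := 3) (F := 5) [[], [5], [7]] (by norm_num) (by simp) (by simp)
    (by decide) h

theorem mem_closure_four_six_nine_eleven {a : ℕ} (h : 8 ≤ a) :
    a ∈ AddSubmonoid.closure ({4, 6, 9, 11} : Set ℕ) :=
  mem_closure_of_table (p := 4) (F := 8) [[], [9], [6], [11]] (by norm_num) (by simp) (by simp)
    (by decide) h

theorem mem_closure_four_seven_nine {a : ℕ} (h : 11 ≤ a) :
    a ∈ AddSubmonoid.closure ({4, 7, 9} : Set ℕ) :=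
  mem_closure_of_table (p := 4) (F := 11) [[], [9], [7, 7], [7]] (by norm_num) (by simp) (by simp)
    (by decide) h

theorem mem_closure_five_six_eight_nine {a : ℕ} (h : 8 ≤ a) :
    a ∈ AddSubmonoid.closure ({5, 6, 8, 9} : Set ℕ) :=
  mem_closure_of_table (p := 5) (F := 8) [[], [6], [6, 6], [8], [9]] (by norm_num) (by simp)
    (by simp) (by decide) h

theorem mem_closure_five_six_seven {a : ℕ} (h : 10 ≤ a) :
    a ∈ AddSubmonoid.closure ({5, 6, 7} : Set ℕ) :=
  mem_closure_of_table (p := 5) (F := 10) [[], [6], [7], [6, 7], [7, 7]] (by norm_num) (by simp)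
    (by simp) (by decide) h

theorem mem_closure_five_to_twelve {a : ℕ} (h : 14 ≤ a) :
    a ∈ AddSubmonoid.closure ({5, 9, 10, 11, 12} : Set ℕ) :=
  mem_closure_of_table (p := 5) (F := 14) [[], [11], [12], [9, 9], [9]] (by norm_num) (by simp)
    (by simp) (by decide) h

theorem mem_closure_three_eight {a : ℕ} (h : 14 ≤ a) :
    a ∈ AddSubmonoid.closure ({3, 8} : Set ℕ) :=
  mem_closure_of_table (p := 3) (F := 14) [[], [8, 8], [8]] (by norm_num) (by simp)
    (by simp) (by decide) h

theorem mem_closure_three_seven_eight {a : ℕ} (h : 6 ≤ a) :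
    a ∈ AddSubmonoid.closure ({3, 7, 8} : Set ℕ) :=
  mem_closure_of_table (p := 3) (F := 6) [[], [7], [8]] (by norm_num) (by simp)
    (by simp) (by decide) h

theorem mem_closure_seven_to_twenty_three {a : ℕ} (h : 17 ≤ a) :
    a ∈ AddSubmonoid.closure ({7, 12, 13, 17, 18, 22, 23} : Set ℕ) :=
  mem_closure_of_table (p := 7) (F := 17) [[], [22], [23], [17], [18], [12], [13]] (by norm_num)
    (by simp) (by simp) (by decide) h

theorem mem_allowedParts_of_lt {m i n : ℕ} (h1 : 1 ≤ n) (h2 : n < m) (h3 : n ≠ i)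
    (h4 : n ≠ m - i) : n ∈ allowedParts m i := by
  rw [allowedParts, Set.mem_ofPred_eq, Nat.mod_eq_of_lt h2]
  omega

theorem one_le_of_mem_allowedParts {m i n : ℕ} (h : n ∈ allowedParts m i) : 1 ≤ n := h.1

theorem not_mem_allowedParts_iff {m i n : ℕ} (hn : 1 ≤ n) :
    n ∉ allowedParts m i ↔ n % m = 0 ∨ n % m = i ∨ n % m = m - i := by
  rw [allowedParts, Set.mem_ofPred_eq]; tauto

/-! ### Products of factors `1 - q^a` with a generating function of partitions -/

theorem nonneg_mul_mul_partsSeries {M A B : Set ℕ} (hM : ∀ p ∈ M, 1 ≤ p) (hA : A ⊆ M) (hB : B ⊆ M)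
    (hAB : Disjoint A B) {u v : ℕ} (hu : u ∈ AddSubmonoid.closure A)
    (hv : v ∈ AddSubmonoid.closure B) :
    Nonneg ((1 - X ^ u) * (1 - X ^ v) * partsSeries M) := by
  have hB' : B ⊆ M \ A := Set.subset_sdiff.mpr ⟨hB, hAB.symm⟩
  have e : (1 - X ^ u) * (1 - X ^ v) * partsSeries M = ((1 - X ^ u) * partsSeries A) *
      ((1 - X ^ v) * partsSeries B) * partsSeries ((M \ A) \ B) := by
    rw [partsSeries_subset hA, partsSeries_subset hB']; ring
  rw [e]
  exact ((nonneg_one_sub_mul_partsSeries (fun p hp => hM p (hA hp)) hu).mul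
    (nonneg_one_sub_mul_partsSeries (fun p hp => hM p (hB hp)) hv)).mul (nonneg_partsSeries _)

/-- Factors `1 - q^u`, `1 - q^v`, `1 - q^w` are harmless if `u, v, w` are sums of parts taken from
pairwise disjoint sets. -/
theorem nonneg_mul_mul_mul_partsSeries {M A B C : Set ℕ} (hM : ∀ p ∈ M, 1 ≤ p) (hA : A ⊆ M)
    (hB : B ⊆ M) (hC : C ⊆ M) (hAB : Disjoint A B) (hAC : Disjoint A C) (hBC : Disjoint B C)
    {u v w : ℕ} (hu : u ∈ AddSubmonoid.closure A) (hv : v ∈ AddSubmonoid.closure B)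
    (hw : w ∈ AddSubmonoid.closure C) :
    Nonneg ((1 - X ^ u) * (1 - X ^ v) * (1 - X ^ w) * partsSeries M) := by
  have hB' : B ⊆ M \ A := Set.subset_sdiff.mpr ⟨hB, hAB.symm⟩
  have hC' : C ⊆ M \ A := Set.subset_sdiff.mpr ⟨hC, hAC.symm⟩
  have e : (1 - X ^ u) * (1 - X ^ v) * (1 - X ^ w) * partsSeries M =
      ((1 - X ^ u) * partsSeries A) * ((1 - X ^ v) * (1 - X ^ w) * partsSeries (M \ A)) := by
    rw [partsSeries_subset hA]; ring
  rw [e]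
  exact (nonneg_one_sub_mul_partsSeries (fun p hp => hM p (hA hp)) hu).mul
    (nonneg_mul_mul_partsSeries (fun p hp => hM p hp.1) hB' hC' hBC hv hw)

theorem coeff_le_coeff_mul_partsSeries {S M : Set ℕ} (hS : S ⊆ M) {f : PowerSeries ℤ}
    (hf : Nonneg (f * partsSeries S)) (n : ℕ) :
    coeff n (f * partsSeries S) ≤ coeff n (f * partsSeries M) := by
  rw [partsSeries_subset hS, ← mul_assoc]
  exact hf.coeff_le_mul (nonneg_partsSeries _) (coeff_zero_partsSeries _) n

/-- Parts exceeding `n` do not matter for the coefficient of `q^n`. -/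
theorem coeff_mul_partsSeries_eq {S M : Set ℕ} (hS : S ⊆ M) (f : PowerSeries ℤ) {n : ℕ}
    (h : ∀ p ∈ M, 1 ≤ p → p ≤ n → p ∈ S) :
    coeff n (f * partsSeries M) = coeff n (f * partsSeries S) := by
  rw [partsSeries_subset hS, ← mul_assoc, coeff_mul, Finset.sum_eq_single (n, 0)]
  · rw [coeff_zero_partsSeries, mul_one]
  · rintro ⟨a, b⟩ hab hne
    rw [Finset.HasAntidiagonal.mem_antidiagonal] at hab
    simp only at hab ⊢
    have hb : 1 ≤ b := by
      rcases Nat.eq_zero_or_pos b with rfl | hb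
      · exact absurd (by rw [← hab, add_zero]) hne
      · exact hb
    rw [coeff_partsSeries_eq_zero hb, mul_zero]
    intro p hp hp1
    by_contra hlt
    exact hp.2 (h p hp.1 hp1 (by omega))
  · intro hn
    exact absurd (by simp [Finset.HasAntidiagonal.mem_antidiagonal]) hn

theorem coeff_one_sub_mul_partsSeries_le {M : Set ℕ} (hM : ∀ p ∈ M, 1 ≤ p) {a b : ℕ}
    (hab : a ≤ b) (h : b - a ∈ AddSubmonoid.closure M) (n : ℕ) :
    coeff n ((1 - X ^ a) * partsSeries M) ≤ coeff n ((1 - X ^ b) * partsSeries M) := by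
  refine Nonneg.coeff_le ?_ n
  have e : (1 - X ^ b) * partsSeries M - (1 - X ^ a) * partsSeries M =
      X ^ a * ((1 - X ^ (b - a)) * partsSeries M) := by
    obtain ⟨c, rfl⟩ := Nat.exists_eq_add_of_le hab
    rw [Nat.add_sub_cancel_left, pow_add]; ring
  rw [e]
  exact (Nonneg.X_pow _).mul (nonneg_one_sub_mul_partsSeries hM h)

/-! ### The lower bound for the tails for `i ≥ 2` -/

/-- If `1` is an allowed part, then one of three factors `1 - q^a` is always harmless. -/
theorem nonneg_triple_of_one_mem {M A B : Set ℕ} (hM : ∀ p ∈ M, 1 ≤ p) (h1 : 1 ∈ M) (hA : A ⊆ M)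
    (hB : B ⊆ M) (hA1 : 1 ∉ A) (hB1 : 1 ∉ B) (hAB : Disjoint A B) {u v : ℕ} (w : ℕ)
    (hu : u ∈ AddSubmonoid.closure A) (hv : v ∈ AddSubmonoid.closure B) :
    Nonneg ((1 - X ^ u) * (1 - X ^ v) * (1 - X ^ w) * partsSeries M) :=
  nonneg_mul_mul_mul_partsSeries hM hA hB (Set.singleton_subset_iff.mpr h1) hAB
    (Set.disjoint_singleton_right.mpr hA1) (Set.disjoint_singleton_right.mpr hB1) hu hv
    (mem_closure_one w)

/-- If `1` and `2` are allowed parts, then the even one of `k + 2` and `3 k + 5` is a multiple of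
`2`, so it suffices to treat `2 k + 3`. -/
theorem nonneg_triple_of_two_mem {M B : Set ℕ} (hM : ∀ p ∈ M, 1 ≤ p) (h1 : 1 ∈ M) (h2 : 2 ∈ M)
    (hB : B ⊆ M) (hB1 : 1 ∉ B) (hB2 : 2 ∉ B) {k : ℕ}
    (hv : 2 * k + 3 ∈ AddSubmonoid.closure B) :
    Nonneg ((1 - X ^ (k + 2)) * (1 - X ^ (2 * k + 3)) * (1 - X ^ (3 * k + 5)) *
      partsSeries M) := by
  have hA : ({2} : Set ℕ) ⊆ M := Set.singleton_subset_iff.mpr h2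
  have hd : Disjoint ({2} : Set ℕ) B := Set.disjoint_singleton_left.mpr hB2
  rcases Nat.even_or_odd' k with ⟨c, hc | hc⟩
  · exact nonneg_triple_of_one_mem hM h1 hA hB (by simp) hB1 hd _
      (mem_closure_two_of_even (by omega)) hv
  · have := nonneg_triple_of_one_mem hM h1 hA hB (by simp) hB1 hd (k + 2)
      (mem_closure_two_of_even (show (3 * k + 5) % 2 = 0 by omega)) hv
    convert this using 1
    ring

theorem nonneg_triple_two_five {k : ℕ} (hk : 2 ≤ k) :
    Nonneg ((1 - X ^ (k + 2)) * (1 - X ^ (2 * k + 3)) * (1 - X ^ (3 * k + 5)) *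
      partsSeries (allowedParts 5 2)) := by
  have hM : ∀ p ∈ allowedParts 5 2, 1 ≤ p := fun _ => one_le_of_mem_allowedParts
  have h1 : 1 ∈ allowedParts 5 2 := by simp [allowedParts]
  have hmem : ∀ n, n % 5 = 1 ∨ n % 5 = 4 → n ∈ allowedParts 5 2 := by
    intro n hn; simp only [allowedParts, Set.mem_ofPred_eq]; omega
  rcases (by omega : k % 5 = 3 ∨ k % 5 = 4 ∨ k % 5 = 2 ∨ k % 5 = 0 ∨ k % 5 = 1)
    with h | h | h | h | h
  · have := nonneg_triple_of_one_mem (A := {2 * k + 3}) (B := {3 * k + 5}) hM h1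
      (Set.singleton_subset_iff.mpr (hmem _ (by omega)))
      (Set.singleton_subset_iff.mpr (hmem _ (by omega))) (by simp) (by simp)
      (by simp; omega) (k + 2) (mem_closure_self rfl) (mem_closure_self rfl)
    convert this using 1; ring
  · exact nonneg_triple_of_one_mem (A := {k + 2}) (B := {2 * k + 3}) hM h1
      (Set.singleton_subset_iff.mpr (hmem _ (by omega)))
      (Set.singleton_subset_iff.mpr (hmem _ (by omega))) (by simp) (by simp)
      (by simp; omega) _ (mem_closure_self rfl) (mem_closure_self rfl)
  · have := nonneg_triple_of_one_mem (A := {k + 2}) (B := {3 * k + 5}) hM h1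
      (Set.singleton_subset_iff.mpr (hmem _ (by omega)))
      (Set.singleton_subset_iff.mpr (hmem _ (by omega))) (by simp) (by simp)
      (by simp; omega) (2 * k + 3) (mem_closure_self rfl) (mem_closure_self rfl)
    convert this using 1; ring
  · have := nonneg_triple_of_one_mem (A := {4, 2 * k - 1}) (B := {6, 3 * k - 1}) hM h1
      (Set.pair_subset (hmem _ (by omega)) (hmem _ (by omega)))
      (Set.pair_subset (hmem _ (by omega)) (hmem _ (by omega)))
      (by simp; omega) (by simp; omega)
      (by rw [Set.disjoint_left]; intro x; simp; omega) (k + 2)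
      (mem_closure_pair (show 4 + (2 * k - 1) = 2 * k + 3 by omega))
      (mem_closure_pair (show 6 + (3 * k - 1) = 3 * k + 5 by omega))
    convert this using 1; ring
  · have := nonneg_triple_of_one_mem (A := {4, 2 * k - 1}) (B := {9, 3 * k - 4}) hM h1
      (Set.pair_subset (hmem _ (by omega)) (hmem _ (by omega)))
      (Set.pair_subset (hmem _ (by omega)) (hmem _ (by omega)))
      (by simp; omega) (by simp; omega)
      (by rw [Set.disjoint_left]; intro x; simp; omega) (k + 2)
      (mem_closure_pair (show 4 + (2 * k - 1) = 2 * k + 3 by omega))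
      (mem_closure_pair (show 9 + (3 * k - 4) = 3 * k + 5 by omega))
    convert this using 1; ring

theorem nonneg_triple_two_six {k : ℕ} (hk : 2 ≤ k) :
    Nonneg ((1 - X ^ (k + 2)) * (1 - X ^ (2 * k + 3)) * (1 - X ^ (3 * k + 5)) *
      partsSeries (allowedParts 6 2)) := by
  have hM : ∀ p ∈ allowedParts 6 2, 1 ≤ p := fun _ => one_le_of_mem_allowedParts
  have h1 : 1 ∈ allowedParts 6 2 := by simp [allowedParts]
  have hmem : ∀ n, n % 2 = 1 → n ∈ allowedParts 6 2 := by
    intro n hn; simp only [allowedParts, Set.mem_ofPred_eq]; omega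
  rcases (by omega : k % 2 = 1 ∨ k % 2 = 0) with h | h
  · exact nonneg_triple_of_one_mem (A := {k + 2}) (B := {2 * k + 3}) hM h1
      (Set.singleton_subset_iff.mpr (hmem _ (by omega)))
      (Set.singleton_subset_iff.mpr (hmem _ (by omega))) (by simp) (by simp)
      (by simp; omega) _ (mem_closure_self rfl) (mem_closure_self rfl)
  · have := nonneg_triple_of_one_mem (A := {2 * k + 3}) (B := {3 * k + 5}) hM h1
      (Set.singleton_subset_iff.mpr (hmem _ (by omega)))
      (Set.singleton_subset_iff.mpr (hmem _ (by omega))) (by simp) (by simp)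
      (by simp; omega) (k + 2) (mem_closure_self rfl) (mem_closure_self rfl)
    convert this using 1; ring

theorem nonneg_triple_two_seven {k : ℕ} (hk : 2 ≤ k) :
    Nonneg ((1 - X ^ (k + 2)) * (1 - X ^ (2 * k + 3)) * (1 - X ^ (3 * k + 5)) *
      partsSeries (allowedParts 7 2)) := by
  have hM : ∀ p ∈ allowedParts 7 2, 1 ≤ p := fun _ => one_le_of_mem_allowedParts
  have h1 : 1 ∈ allowedParts 7 2 := by simp [allowedParts]
  have hmem : ∀ n, n % 7 = 1 ∨ n % 7 = 3 ∨ n % 7 = 4 ∨ n % 7 = 6 → n ∈ allowedParts 7 2 := by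
    intro n hn; simp only [allowedParts, Set.mem_ofPred_eq]; omega
  rcases (by omega : k % 7 = 5 ∨ (k % 7 = 6 ∨ k % 7 = 4) ∨ k % 7 = 0 ∨ (k % 7 = 1 ∨ k % 7 = 2) ∨
    k % 7 = 3) with h | h | h | h | h
  · have := nonneg_triple_of_one_mem (A := {2 * k + 3}) (B := {3 * k + 5}) hM h1
      (Set.singleton_subset_iff.mpr (hmem _ (by omega)))
      (Set.singleton_subset_iff.mpr (hmem _ (by omega))) (by simp) (by simp)
      (by simp; omega) (k + 2) (mem_closure_self rfl) (mem_closure_self rfl)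
    convert this using 1; ring
  · exact nonneg_triple_of_one_mem (A := {k + 2}) (B := {2 * k + 3}) hM h1
      (Set.singleton_subset_iff.mpr (hmem _ (by omega)))
      (Set.singleton_subset_iff.mpr (hmem _ (by omega))) (by simp) (by simp)
      (by simp; omega) _ (mem_closure_self rfl) (mem_closure_self rfl)
  · have := nonneg_triple_of_one_mem (A := {2 * k + 3}) (B := {4, 3 * k + 1}) hM h1
      (Set.singleton_subset_iff.mpr (hmem _ (by omega)))
      (Set.pair_subset (hmem _ (by omega)) (hmem _ (by omega)))
      (by simp) (by simp; omega)
      (by rw [Set.disjoint_left]; intro x; simp; omega) (k + 2)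
      (mem_closure_self rfl)
      (mem_closure_pair (show 4 + (3 * k + 1) = 3 * k + 5 by omega))
    convert this using 1; ring
  · have := nonneg_triple_of_one_mem (A := {k + 2}) (B := {3 * k + 5}) hM h1
      (Set.singleton_subset_iff.mpr (hmem _ (by omega)))
      (Set.singleton_subset_iff.mpr (hmem _ (by omega))) (by simp) (by simp)
      (by simp; omega) (2 * k + 3) (mem_closure_self rfl) (mem_closure_self rfl)
    convert this using 1; ring
  · have := nonneg_triple_of_one_mem (A := {3, 2 * k}) (B := {4, 3 * k + 1}) hM h1
      (Set.pair_subset (hmem _ (by omega)) (hmem _ (by omega)))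
      (Set.pair_subset (hmem _ (by omega)) (hmem _ (by omega)))
      (by simp; omega) (by simp; omega)
      (by rw [Set.disjoint_left]; intro x; simp; omega) (k + 2)
      (mem_closure_pair (show 3 + 2 * k = 2 * k + 3 by omega))
      (mem_closure_pair (show 4 + (3 * k + 1) = 3 * k + 5 by omega))
    convert this using 1; ring

/-- For `i = 2` and `m ≥ 8`, one of `k + 2` and `2 k + 3` is itself an allowed part. -/
theorem add_two_mem_or_mem {m k : ℕ} (hm : 8 ≤ m) (h : k + 2 ∉ allowedParts m 2) :
    2 * k + 3 ∈ allowedParts m 2 := by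
  have key : ∀ q r, 2 * k + 3 = m * q + r → r < m → r ≠ 0 → r ≠ 2 → r ≠ m - 2 →
      2 * k + 3 ∈ allowedParts m 2 := by
    intro q r h1 h2 h3 h4 h5
    refine ⟨by omega, ?_⟩
    rw [h1, Nat.mul_add_mod, Nat.mod_eq_of_lt h2]
    exact ⟨h3, h4, h5⟩
  have hq := Nat.div_add_mod (k + 2) m
  rw [not_mem_allowedParts_iff (by omega)] at h
  set q := (k + 2) / m
  rcases h with h | h | h
  · rw [h] at hq
    obtain ⟨t, ht⟩ : ∃ t, q = t + 1 := by
      refine ⟨q - 1, ?_⟩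
      rcases Nat.eq_zero_or_pos q with h0 | h0
      · rw [h0] at hq; omega
      · omega
    rw [ht] at hq
    refine key (2 * t + 1) (m - 1) ?_ (by omega) (by omega) (by omega) (by omega)
    have : m * (2 * t + 1) = 2 * (m * (t + 1)) - m := by
      rw [mul_add, mul_add]; have := mul_left_comm m 2 t; omega
    rw [this]; nlinarith [Nat.sub_add_cancel (show m ≤ 2 * (m * (t + 1)) by nlinarith),
      Nat.sub_add_cancel (show 1 ≤ m by omega)]
  · rw [h] at hq
    refine key (2 * q) 3 ?_ (by omega) (by omega) (by omega) (by omega)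
    have := mul_left_comm m 2 q; omega
  · rw [h] at hq
    refine key (2 * q + 1) (m - 5) ?_ (by omega) (by omega) (by omega) (by omega)
    have := mul_left_comm m 2 q
    rw [mul_add]; omega

theorem nonneg_triple_two {m k : ℕ} (hm : 8 ≤ m) (hk : 2 ≤ k) :
    Nonneg ((1 - X ^ (k + 2)) * (1 - X ^ (2 * k + 3)) * (1 - X ^ (3 * k + 5)) *
      partsSeries (allowedParts m 2)) := by
  have hM : ∀ p ∈ allowedParts m 2, 1 ≤ p := fun _ => one_le_of_mem_allowedParts
  have hmem : ∀ n, n = 1 ∨ n = 3 ∨ n = 4 ∨ n = 5 → n ∈ allowedParts m 2 := fun n hn =>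
    mem_allowedParts_of_lt (by omega) (by omega) (by omega) (by omega)
  have h1 := hmem 1 (by norm_num)
  have h34 : ({3, 4} : Set ℕ) ⊆ allowedParts m 2 :=
    Set.pair_subset (hmem _ (by norm_num)) (hmem _ (by norm_num))
  have h35 : ({3, 5} : Set ℕ) ⊆ allowedParts m 2 :=
    Set.pair_subset (hmem _ (by norm_num)) (hmem _ (by norm_num))
  by_cases hu : k + 2 ∈ allowedParts m 2
  · rcases Nat.eq_or_lt_of_le hk with rfl | hk3
    · have := nonneg_triple_of_one_mem (A := {4}) (B := {3, 5}) hM h1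
        (Set.singleton_subset_iff.mpr hu) h35 (by simp) (by simp)
        (by simp) 7 (mem_closure_self rfl) (mem_closure_three_five (show 8 ≤ 11 by norm_num))
      convert this using 1; ring
    · exact nonneg_triple_of_one_mem (A := {k + 2}) (B := {3, 4}) hM h1
        (Set.singleton_subset_iff.mpr hu) h34 (by simp) (by simp)
        (by simp; omega) _ (mem_closure_self rfl) (mem_closure_three_four (by omega))
  · have hv := add_two_mem_or_mem hm hu
    have := nonneg_triple_of_one_mem (A := {2 * k + 3}) (B := {3, 4}) hM h1
        (Set.singleton_subset_iff.mpr hv) h34 (by simp) (by simp)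
        (by simp; omega) (k + 2) (mem_closure_self rfl)
        (mem_closure_three_four (show 6 ≤ 3 * k + 5 by omega))
    convert this using 1; ring

theorem nonneg_triple_three {m k : ℕ} (hm : 7 ≤ m) (hk : 2 ≤ k) :
    Nonneg ((1 - X ^ (k + 2)) * (1 - X ^ (2 * k + 3)) * (1 - X ^ (3 * k + 5)) *
      partsSeries (allowedParts m 3)) := by
  have hM : ∀ p ∈ allowedParts m 3, 1 ≤ p := fun _ => one_le_of_mem_allowedParts
  have h1 : 1 ∈ allowedParts m 3 :=
    mem_allowedParts_of_lt (by omega) (by omega) (by omega) (by omega)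
  have h2 : 2 ∈ allowedParts m 3 :=
    mem_allowedParts_of_lt (by omega) (by omega) (by omega) (by omega)
  rcases (by omega : m = 7 ∨ m = 8 ∨ 9 ≤ m) with rfl | rfl | hm9
  · have hB : ({5, 6, 8, 9} : Set ℕ) ⊆ allowedParts 7 3 := by
      simp [Set.insert_subset_iff, allowedParts]
    rcases Nat.eq_or_lt_of_le hk with rfl | hk3
    · have := nonneg_triple_of_one_mem (A := {2}) (B := {5, 6, 8, 9}) hM h1
        (Set.singleton_subset_iff.mpr h2) hB (by simp) (by simp)
        (by simp) 7 (mem_closure_two_of_even (show 4 % 2 = 0 by norm_num))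
        (mem_closure_five_six_eight_nine (show 8 ≤ 11 by norm_num))
      convert this using 1; ring
    · exact nonneg_triple_of_two_mem hM h1 h2 hB (by simp) (by simp)
        (mem_closure_five_six_eight_nine (by omega))
  · have hB : ({4, 7, 9} : Set ℕ) ⊆ allowedParts 8 3 := by
      simp [Set.insert_subset_iff, allowedParts]
    refine nonneg_triple_of_two_mem hM h1 h2 hB (by simp) (by simp) ?_
    rcases (by omega : k = 2 ∨ k = 3 ∨ 4 ≤ k) with rfl | rfl | hk4
    · exact mem_closure_self (by simp)
    · exact mem_closure_self (by simp)
    · exact mem_closure_four_seven_nine (by omega)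
  · have h4 : 4 ∈ allowedParts m 3 :=
      mem_allowedParts_of_lt (by omega) (by omega) (by omega) (by omega)
    have h5 : 5 ∈ allowedParts m 3 :=
      mem_allowedParts_of_lt (by omega) (by omega) (by omega) (by omega)
    have h45 : ({4, 5} : Set ℕ) ⊆ allowedParts m 3 := Set.pair_subset h4 h5
    rcases (by omega : k = 2 ∨ k = 4 ∨ k = 3 ∨ 5 ≤ k) with rfl | rfl | rfl | hk5
    · exact nonneg_triple_of_one_mem (A := {4}) (B := {2, 5}) hM h1
        (Set.singleton_subset_iff.mpr h4) (Set.pair_subset h2 h5) (by simp) (by simp)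
        (by simp) 11 (mem_closure_self rfl) (mem_closure_two_five (show 4 ≤ 7 by norm_num))
    · have := nonneg_triple_of_one_mem (A := {2}) (B := {4, 5}) hM h1
        (Set.singleton_subset_iff.mpr h2) h45 (by simp) (by simp)
        (by simp) 11 (mem_closure_two_of_even (show 6 % 2 = 0 by norm_num))
        (mem_closure_four_five (show 12 ≤ 17 by norm_num))
      convert this using 1; ring
    · exact nonneg_triple_of_two_mem hM h1 h2 h45 (by simp) (by simp)
        (mem_closure_pair (show 4 + 5 = 9 by norm_num))
    · exact nonneg_triple_of_two_mem hM h1 h2 h45 (by simp) (by simp)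
        (mem_closure_four_five (by omega))

theorem nonneg_triple_four_le {m i k : ℕ} (hi : 4 ≤ i) (him : 2 * i < m) (hk : 2 ≤ k) :
    Nonneg ((1 - X ^ (k + 2)) * (1 - X ^ (2 * k + 3)) * (1 - X ^ (3 * k + 5)) *
      partsSeries (allowedParts m i)) := by
  have hM : ∀ p ∈ allowedParts m i, 1 ≤ p := fun _ => one_le_of_mem_allowedParts
  have h1 : 1 ∈ allowedParts m i :=
    mem_allowedParts_of_lt (by omega) (by omega) (by omega) (by omega)
  have h2 : 2 ∈ allowedParts m i :=
    mem_allowedParts_of_lt (by omega) (by omega) (by omega) (by omega)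
  have h3 : 3 ∈ allowedParts m i :=
    mem_allowedParts_of_lt (by omega) (by omega) (by omega) (by omega)
  have hA : ({2} : Set ℕ) ⊆ allowedParts m i := Set.singleton_subset_iff.mpr h2
  rcases (by omega : 5 ≤ i ∨ i = 4 ∧ m = 9 ∨ i = 4 ∧ 10 ≤ m) with hi5 | ⟨rfl, rfl⟩ | ⟨rfl, hm⟩
  · have h4 : 4 ∈ allowedParts m i :=
      mem_allowedParts_of_lt (by omega) (by omega) (by omega) (by omega)
    exact nonneg_triple_of_two_mem hM h1 h2 (Set.pair_subset h3 h4) (by simp) (by simp)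
      (mem_closure_three_four (by omega))
  · have h7 : 7 ∈ allowedParts 9 4 := by simp [allowedParts]
    rcases (by omega : k = 2 ∨ k = 3 ∨ k = 4 ∨ 5 ≤ k) with rfl | rfl | rfl | hk5
    · exact nonneg_triple_of_two_mem hM h1 h2 (Set.pair_subset h3 h7) (by simp) (by simp)
        (mem_closure_self (by simp))
    · exact nonneg_triple_of_two_mem hM h1 h2 (Set.pair_subset h3 h7) (by simp) (by simp)
        (AddSubmonoid.nsmul_mem _ (mem_closure_self (show 3 ∈ ({3, 7} : Set ℕ) by simp)) 3)
    · have := nonneg_triple_of_one_mem (A := {2}) (B := {3, 7}) hM h1 hA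
        (Set.pair_subset h3 h7) (by simp) (by simp)
        (by simp) 11 (mem_closure_two_of_even (show 6 % 2 = 0 by norm_num))
        (mem_closure_three_seven (show 12 ≤ 17 by norm_num))
      convert this using 1; ring
    · exact nonneg_triple_of_two_mem hM h1 h2 (Set.pair_subset h3 h7) (by simp) (by simp)
        (mem_closure_three_seven (by omega))
  · have h5 : 5 ∈ allowedParts m 4 :=
      mem_allowedParts_of_lt (by omega) (by omega) (by omega) (by omega)
    rcases Nat.eq_or_lt_of_le hk with rfl | hk3
    · have := nonneg_triple_of_one_mem (A := {2}) (B := {3, 5}) hM h1 hA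
        (Set.pair_subset h3 h5) (by simp) (by simp)
        (by simp) 7 (mem_closure_two_of_even (show 4 % 2 = 0 by norm_num))
        (mem_closure_three_five (show 8 ≤ 11 by norm_num))
      convert this using 1; ring
    · exact nonneg_triple_of_two_mem hM h1 h2 (Set.pair_subset h3 h5) (by simp) (by simp)
        (mem_closure_three_five (by omega))

/-- The products of three factors that occur in the lower bound for the tails for `i ≥ 2`. -/
theorem nonneg_triple {m i k : ℕ} (hi : 2 ≤ i) (him : 2 * i < m) (hk : 2 ≤ k) :
    Nonneg ((1 - X ^ (k + 2)) * (1 - X ^ (2 * k + 3)) * (1 - X ^ (3 * k + 5)) *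
      partsSeries (allowedParts m i)) := by
  rcases (by omega : i = 2 ∨ i = 3 ∨ 4 ≤ i) with rfl | rfl | hi4
  · rcases (by omega : m = 5 ∨ m = 6 ∨ m = 7 ∨ 8 ≤ m) with rfl | rfl | rfl | hm
    · exact nonneg_triple_two_five hk
    · exact nonneg_triple_two_six hk
    · exact nonneg_triple_two_seven hk
    · exact nonneg_triple_two hm hk
  · exact nonneg_triple_three (by omega) hk
  · exact nonneg_triple_four_le hi4 him hk

/-- The allowed parts other than `1` generate all larger integers. -/
theorem mem_closure_allowedParts {m i a : ℕ} (hi : 2 ≤ i) (him : 2 * i < m) (ha : 7 ≤ a)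
    (h : a = 7 → ¬ (m = 5 ∧ i = 2)) :
    a ∈ AddSubmonoid.closure (allowedParts m i \ {1}) := by
  have hsub : ∀ {A : Set ℕ}, A ⊆ allowedParts m i → 1 ∉ A → A ⊆ allowedParts m i \ {1} :=
    fun hA h1 => Set.subset_sdiff.mpr ⟨hA, Set.disjoint_singleton_right.mpr h1⟩
  have hmem : ∀ n, 1 ≤ n → n < m → n ≠ i → n ≠ m - i → n ∈ allowedParts m i :=
    fun _ => mem_allowedParts_of_lt
  rcases (by omega : (i = 2 ∧ m = 5) ∨ (i = 2 ∧ m = 6) ∨ (i = 2 ∧ 7 ≤ m) ∨ (i = 3 ∧ m = 8) ∨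
    (i = 3 ∧ m ≠ 8) ∨ 4 ≤ i) with ⟨rfl, rfl⟩ | ⟨rfl, rfl⟩ | ⟨rfl, hm⟩ | ⟨rfl, rfl⟩ | ⟨rfl, hm⟩ | hi4
  · refine closure_mono (hsub ?_ ?_) (mem_closure_four_six_nine_eleven (by omega))
    · simp [Set.insert_subset_iff, allowedParts]
    · simp
  · refine closure_mono (hsub ?_ ?_) (mem_closure_three_five_seven (by omega))
    · simp [Set.insert_subset_iff, allowedParts]
    · simp
  · exact closure_mono (hsub (Set.pair_subset (hmem 3 (by omega) (by omega) (by omega) (by omega))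
      (hmem 4 (by omega) (by omega) (by omega) (by omega))) (by simp))
      (mem_closure_three_four (by omega))
  · refine closure_mono (hsub ?_ ?_) (mem_closure_two_seven (by omega))
    · simp [Set.insert_subset_iff, allowedParts]
    · simp
  · exact closure_mono (hsub (Set.pair_subset (hmem 2 (by omega) (by omega) (by omega) (by omega))
      (hmem 5 (by omega) (by omega) (by omega) (by omega))) (by simp))
      (mem_closure_two_five (by omega))
  · exact closure_mono (hsub (Set.pair_subset (hmem 2 (by omega) (by omega) (by omega) (by omega))
      (hmem 3 (by omega) (by omega) (by omega) (by omega))) (by simp))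
      (mem_closure_two_three (by omega))

/-- The lower bound for the tails used for `i ≥ 2`. -/
theorem nonneg_pentagonalTail_sub_of_two_le {m i k₀ k : ℕ} (hi : 2 ≤ i) (him : 2 * i < m)
    (hk₀ : 2 ≤ k₀) (h5 : k₀ = 2 → ¬ (m = 5 ∧ i = 2)) (hk : k₀ ≤ k) :
    Nonneg ((pentagonalTail k - X ^ pentExp k * (1 - X ^ (k - 1))) *
      partsSeries (allowedParts m i)) := by
  refine nonneg_pentagonalTail_sub (l := fun k => 1 - X ^ (k - 1)) (show 1 ≤ k₀ by omega) ?_ hk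
  intro k hk
  have hM : ∀ p ∈ allowedParts m i, 1 ≤ p := fun _ => one_le_of_mem_allowedParts
  have h1 : 1 ∈ allowedParts m i :=
    mem_allowedParts_of_lt (by omega) (by omega) (by omega) (by omega)
  have ha := nonneg_triple hi him (hk₀.trans hk)
  have hb := nonneg_mul_mul_partsSeries hM (Set.singleton_subset_iff.mpr h1)
    (Set.sdiff_subset (s := allowedParts m i) (t := {1}))
    Set.disjoint_sdiff_right (mem_closure_one 1)
    (mem_closure_allowedParts hi him (show 7 ≤ 2 * k + 3 by omega) (by omega))
  obtain ⟨j, rfl⟩ : ∃ j, k = j + 1 := ⟨k - 1, by omega⟩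
  simp only [Nat.add_sub_cancel, show j + 1 + 2 - 1 = j + 2 by omega]
  -- the two-step expression factors through `1 - q^(2 k + 3)`
  have e : (1 - X ^ (2 * (j + 1) + 1) - X ^ (3 * (j + 1) + 2) * (1 - X ^ (2 * (j + 1) + 3))
      - (1 - X ^ j) + X ^ (6 * (j + 1) + 7) * (1 - X ^ (j + 2))) * partsSeries (allowedParts m i) =
      X ^ j * ((1 - X ^ (j + 1 + 2)) * (1 - X ^ (2 * (j + 1) + 3)) * (1 - X ^ (3 * (j + 1) + 5)) *
        partsSeries (allowedParts m i)) + X ^ (5 * j + 10) * ((1 - X ^ 1) *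
        (1 - X ^ (2 * (j + 1) + 3)) * partsSeries (allowedParts m i)) := by ring
  rw [e]
  exact ((Nonneg.X_pow _).mul ha).add ((Nonneg.X_pow _).mul hb)

/-! ### Certified coefficient tables -/

/-- The polynomial with the given list of terms `(coefficient, exponent)`. -/
noncomputable def sparsePoly (t : List (ℤ × ℕ)) : PowerSeries ℤ :=
  (t.map fun x => x.1 • (X : PowerSeries ℤ) ^ x.2).sum

/-- The first `M` coefficients of `sparsePoly t`. -/
def sparseTable (t : List (ℤ × ℕ)) (M : ℕ) : List ℤ :=
  (List.range M).map fun n => (t.map fun x => if n = x.2 then x.1 else 0).sum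

/-- Division by `1 - q^p` on initial segments of coefficient lists; the accumulator holds the
coefficients of the quotient found so far, in reverse order. -/
def divTableAux (p : ℕ) : List ℤ → List ℤ → List ℤ
  | acc, [] => acc.reverse
  | acc, a :: l => divTableAux p ((a + acc.getD (p - 1) 0) :: acc) l

/-- The first `M` coefficients of `sparsePoly t` divided by the product of `1 - q^p`, `p ∈ S`. -/
def partsTable (t : List (ℤ × ℕ)) (S : List ℕ) (M : ℕ) : List ℤ :=
  S.foldr (fun p l => divTableAux p [] l) (sparseTable t M)

theorem coeff_sparsePoly (t : List (ℤ × ℕ)) (n : ℕ) :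
    coeff n (sparsePoly t) = (t.map fun x => if n = x.2 then x.1 else 0).sum := by
  unfold sparsePoly
  induction t with
  | nil => simp
  | cons x t ih =>
    simp only [List.map_cons, List.sum_cons, map_add, ih, map_zsmul, coeff_X_pow, smul_eq_mul,
      mul_ite, mul_one, mul_zero]

theorem length_sparseTable (t : List (ℤ × ℕ)) (M : ℕ) : (sparseTable t M).length = M := by
  simp [sparseTable]

theorem coeff_sparsePoly_eq_getD (t : List (ℤ × ℕ)) {M n : ℕ} (h : n < M) :
    coeff n (sparsePoly t) = (sparseTable t M).getD n 0 := by
  rw [coeff_sparsePoly, List.getD_eq_getElem _ _ (by rw [length_sparseTable]; exact h)]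
  simp [sparseTable]

theorem length_divTableAux (p : ℕ) (l acc : List ℤ) :
    (divTableAux p acc l).length = acc.length + l.length := by
  induction l generalizing acc with
  | nil => simp [divTableAux]
  | cons a l ih => rw [divTableAux, ih]; simp; omega

theorem coeff_of_one_sub_mul {f g : PowerSeries ℤ} {p : ℕ} (h : (1 - X ^ p) * g = f) (n : ℕ) :
    coeff n g = coeff n f + if p ≤ n then coeff (n - p) g else 0 := by
  rw [← h, sub_mul, one_mul, map_sub, coeff_X_pow_mul']
  ring

theorem coeff_eq_divTableAux {f g : PowerSeries ℤ} {p : ℕ} (hp : 1 ≤ p)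
    (h : (1 - X ^ p) * g = f) (l acc : List ℤ)
    (hacc : ∀ j < acc.length, acc.getD (acc.length - 1 - j) 0 = coeff j g)
    (hl : ∀ j < l.length, coeff (acc.length + j) f = l.getD j 0) :
    ∀ n < acc.length + l.length, coeff n g = (divTableAux p acc l).getD n 0 := by
  induction l generalizing acc with
  | nil =>
    intro n hn
    simp only [List.length_nil, add_zero] at hn
    rw [divTableAux, ← hacc n hn, List.getD_eq_getElem _ _ (by omega),
      List.getD_eq_getElem _ _ (by simpa using hn), List.getElem_reverse]
  | cons a l ih =>
    intro n hn
    rw [divTableAux]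
    refine ih _ ?_ ?_ n (by simp only [List.length_cons] at hn ⊢; omega)
    · intro j hj
      simp only [List.length_cons, Nat.add_sub_cancel] at hj ⊢
      rcases Nat.eq_or_lt_of_le (Nat.lt_succ_iff.mp hj) with rfl | hj'
      · rw [Nat.sub_self, List.getD_cons_zero, coeff_of_one_sub_mul h acc.length]
        have h1 := hl 0 (by simp)
        rw [add_zero, List.getD_cons_zero] at h1
        rw [h1]
        congr 1
        split_ifs with hpn
        · have h2 := hacc (acc.length - p) (by omega)
          rw [← h2]; congr 1; omega
        · exact List.getD_eq_default _ _ (by omega)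
      · rw [show acc.length - j = acc.length - 1 - j + 1 by omega, List.getD_cons_succ]
        exact hacc j hj'
    · intro j hj
      have h1 := hl (j + 1) (by simpa using hj)
      rw [List.getD_cons_succ] at h1
      rw [← h1, List.length_cons, show acc.length + 1 + j = acc.length + (j + 1) by omega]

theorem length_partsTable (t : List (ℤ × ℕ)) (S : List ℕ) (M : ℕ) :
    (partsTable t S M).length = M := by
  induction S with
  | nil => exact length_sparseTable t M
  | cons p S ih =>
    change (divTableAux p [] (partsTable t S M)).length = M
    rw [length_divTableAux, ih]; simp

/-- The quotient of a polynomial by the product of `1 - q^p`, `p ∈ S`. -/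
noncomputable def partsQuotient (t : List (ℤ × ℕ)) (S : List ℕ) : PowerSeries ℤ :=
  sparsePoly t * partsSeries {p | p ∈ S}

theorem partsQuotient_eq {t : List (ℤ × ℕ)} {f : PowerSeries ℤ} (h : sparsePoly t = f)
    (S : List ℕ) : partsQuotient t S = f * partsSeries {p | p ∈ S} := by
  rw [partsQuotient, h]

theorem partsSeries_empty : partsSeries ∅ = 1 := by
  refine (partsSeries_eq_of_mul_eq_one ?_).symm
  simp [partsProd]

theorem one_sub_mul_partsQuotient (t : List (ℤ × ℕ)) {p : ℕ} {S : List ℕ} (hp : 1 ≤ p)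
    (hpS : p ∉ S) : (1 - X ^ p) * partsQuotient t (p :: S) = partsQuotient t S := by
  have e : {x | x ∈ p :: S} \ {p} = {x | x ∈ S} := by
    ext x
    simp only [Set.mem_sdiff, Set.mem_ofPred_eq, List.mem_cons, Set.mem_singleton_iff]
    constructor
    · tauto
    · intro hx; exact ⟨Or.inr hx, fun h => hpS (h ▸ hx)⟩
  rw [partsQuotient, partsQuotient, ← e, ← one_sub_mul_partsSeries hp (by simp)]
  ring

theorem coeff_partsQuotient (t : List (ℤ × ℕ)) {S : List ℕ} (hS : S.Nodup) (hpos : ∀ p ∈ S, 1 ≤ p)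
    {M n : ℕ} (hn : n < M) : coeff n (partsQuotient t S) = (partsTable t S M).getD n 0 := by
  induction S generalizing n with
  | nil =>
    have : {p | p ∈ ([] : List ℕ)} = ∅ := by ext; simp
    rw [partsQuotient, this, partsSeries_empty, mul_one]
    exact coeff_sparsePoly_eq_getD t hn
  | cons p S ih =>
    rw [List.nodup_cons] at hS
    have hp : 1 ≤ p := hpos p (by simp)
    have := coeff_eq_divTableAux hp (one_sub_mul_partsQuotient t hp hS.1) (partsTable t S M) []
      (by simp) (fun j hj => by
        rw [length_partsTable] at hj
        rw [List.length_nil, zero_add]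
        exact ih hS.2 (fun q hq => hpos q (by simp [hq])) hj)
      n (by rw [length_partsTable]; simpa using hn)
    exact this

theorem le_getD_of_all {l : List ℤ} {N : ℕ} {c : ℤ}
    (h : ((l.drop N).all fun a => decide (c ≤ a)) = true) {n : ℕ} (hN : N ≤ n)
    (hn : n < l.length) : c ≤ l.getD n 0 := by
  rw [List.all_eq_true] at h
  rw [List.getD_eq_getElem _ _ hn]
  have hm : l[n] ∈ l.drop N := by
    rw [List.mem_iff_getElem]
    refine ⟨n - N, by rw [List.length_drop]; omega, ?_⟩
    rw [List.getElem_drop]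
    congr 1; omega
  simpa using h _ hm

theorem le_coeff_partsQuotient_of_lt (t : List (ℤ × ℕ)) {S : List ℕ} (hS : S.Nodup)
    (hpos : ∀ p ∈ S, 1 ≤ p) {M N : ℕ} {c : ℤ}
    (hc : (((partsTable t S M).drop N).all fun a => decide (c ≤ a)) = true) {n : ℕ} (hN : N ≤ n)
    (hn : n < M) : c ≤ coeff n (partsQuotient t S) := by
  rw [coeff_partsQuotient t hS hpos hn]
  exact le_getD_of_all hc hN (by rw [length_partsTable]; exact hn)

/-- If the coefficients are nonnegative from `N'` on before dividing by `1 - q^p`, then a lower bound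
after the division propagates from a finite table of more than `p` coefficients. -/
theorem le_coeff_partsQuotient_cons {t : List (ℤ × ℕ)} {p : ℕ} {S : List ℕ} {N' : ℕ}
    (h : ∀ n ≥ N', 0 ≤ coeff n (partsQuotient t S)) {c : ℤ} {N : ℕ} (M : ℕ)
    (hS : (p :: S).Nodup) (hpos : ∀ q ∈ p :: S, 1 ≤ q) (hM : N + p ≤ M ∧ N' ≤ M)
    (hc : (((partsTable t (p :: S) M).drop N).all fun a => decide (c ≤ a)) = true) :
    ∀ n ≥ N, c ≤ coeff n (partsQuotient t (p :: S)) := by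
  intro n
  induction n using Nat.strong_induction_on with
  | _ n ih =>
  intro hn
  have hp : 1 ≤ p := hpos p (by simp)
  rcases Nat.lt_or_ge n M with hlt | hge
  · exact le_coeff_partsQuotient_of_lt t hS hpos hc hn hlt
  · rw [coeff_of_one_sub_mul (one_sub_mul_partsQuotient t hp (List.nodup_cons.mp hS).1) n,
      if_pos (by omega)]
    have h1 := ih (n - p) (by omega) (by omega)
    have h2 := h n (by omega)
    linarith

theorem coeff_sparsePoly_eq_zero {t : List (ℤ × ℕ)} {N : ℕ} (h : ∀ x ∈ t, x.2 < N) {n : ℕ}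
    (hn : N ≤ n) : coeff n (sparsePoly t) = 0 := by
  rw [coeff_sparsePoly]
  refine List.sum_eq_zero fun y hy => ?_
  obtain ⟨x, hx, rfl⟩ := List.mem_map.mp hy
  have := h x hx
  rw [if_neg (by omega)]

/-- Quotients by three factors. If `Q = (1 - q)^2 (1 - q^L) / ∏_{p ∈ S} (1 - q^p)` is a polynomial,
then the difference of step `L` of the coefficients of `(1 - q) V / ∏_{p ∈ S} (1 - q^p)` is
eventually constant, so that lower bounds propagate from a finite table. -/
theorem le_coeff_partsQuotient_of_mul_eq {t V Q : List (ℤ × ℕ)} {S : List ℕ} {L a b : ℕ}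
    (hL : 1 ≤ L)
    (hV : sparsePoly t = (1 - X) * sparsePoly V)
    (hQ : (1 - X) ^ 2 * (1 - X ^ L) * partsSeries {p | p ∈ S} = sparsePoly Q)
    (hVa : ∀ x ∈ V, x.2 < a) (hQb : ∀ x ∈ Q, x.2 < b) {c : ℤ} {N M : ℕ}
    (hS : S.Nodup) (hpos : ∀ q ∈ S, 1 ≤ q) (hM : N + L + 1 ≤ M ∧ a + b < M)
    (hlast : (partsTable t S M).getD (M - 1 - L) 0 ≤ (partsTable t S M).getD (M - 1) 0)
    (hc : (((partsTable t S M).drop N).all fun a => decide (c ≤ a)) = true) :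
    ∀ n ≥ N, c ≤ coeff n (partsQuotient t S) := by
  set g := (1 - X ^ L) * partsQuotient t S with hg
  have hz : ∀ n ≥ a + b, coeff n ((1 - X ^ 1) * g) = 0 := by
    have e : (1 - X ^ 1) * g = sparsePoly V * sparsePoly Q := by
      rw [hg, partsQuotient, hV, ← hQ]; ring
    intro n hn
    rw [e, coeff_mul]
    refine Finset.sum_eq_zero fun x hx => ?_
    rw [Finset.HasAntidiagonal.mem_antidiagonal] at hx
    rcases Nat.lt_or_ge x.1 a with h1 | h1
    · rw [coeff_sparsePoly_eq_zero hQb (by omega), mul_zero]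
    · rw [coeff_sparsePoly_eq_zero hVa h1, zero_mul]
  have hg0 : ∀ n ≥ M - 1, 0 ≤ coeff n g := by
    intro n hn
    induction n, hn using Nat.le_induction with
    | base =>
      have h1 := coeff_of_one_sub_mul (f := g) (g := partsQuotient t S) rfl (M - 1)
      rw [if_pos (by omega)] at h1
      rw [coeff_partsQuotient t hS hpos (show M - 1 < M by omega),
        coeff_partsQuotient t hS hpos (show M - 1 - L < M by omega)] at h1
      linarith
    | succ n hn ih =>
      have h1 := coeff_of_one_sub_mul (f := (1 - X ^ 1) * g) (g := g) rfl (n + 1)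
      rw [if_pos (by omega), hz _ (by omega), Nat.add_sub_cancel] at h1
      linarith
  intro n
  induction n using Nat.strong_induction_on with
  | _ n ih =>
  intro hn
  rcases Nat.lt_or_ge n M with hlt | hge
  · exact le_coeff_partsQuotient_of_lt t hS hpos hc hn hlt
  · rw [coeff_of_one_sub_mul (f := g) (g := partsQuotient t S) rfl n, if_pos (by omega)]
    have h1 := ih (n - L) (by omega) (by omega)
    have h2 := hg0 n (by omega)
    linarith

/-! ### Quotients by three factors -/

/-- The polynomial `(1 - q)^2 (1 - q^42) / ((1 - q^2) (1 - q^3) (1 - q^7))`. -/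
def quotientTwoThreeSeven : List (ℤ × ℕ) :=
  [(1, 0), (-2, 1), (2, 2), (-1, 3), (1, 6), (-1, 7), (1, 9), (-1, 10), (1, 12), (-1, 13), (1, 14),
    (-1, 15), (1, 16), (-1, 17), (1, 18), (-1, 19), (1, 20), (-1, 22), (1, 23), (-1, 25), (1, 26),
    (-1, 29), (2, 30), (-2, 31), (1, 32)]

/-- The polynomial `(1 - q)^2 (1 - q^30) / ((1 - q^2) (1 - q^3) (1 - q^5))`. -/
def quotientTwoThreeFive : List (ℤ × ℕ) :=
  [(1, 0), (-2, 1), (2, 2), (-1, 3), (1, 5), (-1, 6), (1, 8), (-1, 9), (1, 10), (-1, 11), (1, 12),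
    (-1, 13), (1, 14), (-1, 16), (1, 17), (-1, 19), (2, 20), (-2, 21), (1, 22)]

/-- The polynomial `(1 - q)^2 (1 - q^36) / ((1 - q) (1 - q^4) (1 - q^9))`. -/
def quotientOneFourNine : List (ℤ × ℕ) :=
  [(1, 0), (-1, 1), (1, 4), (-1, 5), (1, 8), (-1, 10), (1, 12), (-1, 14), (1, 16), (-1, 19), (1, 20),
    (-1, 23), (1, 24)]

theorem mul_partsSeries_eq_of_mul_eq {a b c : ℕ} (ha : 1 ≤ a) (hb : 1 ≤ b) (hc : 1 ≤ c)
    (h : [c, b, a].Nodup) {f g : PowerSeries ℤ}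
    (hfg : f = g * ((1 - X ^ a) * (1 - X ^ b) * (1 - X ^ c))) :
    f * partsSeries {p | p ∈ [c, b, a]} = g := by
  simp only [List.nodup_cons, List.mem_cons, List.not_mem_nil, or_false, not_or] at h
  have e : (1 - X ^ a) * (1 - X ^ b) * (1 - X ^ c) * partsSeries {p | p ∈ [c, b, a]} = 1 := by
    rw [mul_assoc, one_sub_mul_partsSeries hc (by simp), mul_assoc,
      one_sub_mul_partsSeries hb (by simp; tauto),
      one_sub_mul_partsSeries ha (by simp; tauto)]
    have : (({p | p ∈ [c, b, a]} \ {c}) \ {b}) \ {a} = (∅ : Set ℕ) := by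
      ext x; simp; tauto
    rw [this, partsSeries_empty]
  rw [hfg, mul_assoc, e, mul_one]

theorem mul_partsSeries_two_three_seven :
    (1 - X) ^ 2 * (1 - X ^ 42) * partsSeries {p | p ∈ [7, 3, 2]} =
      sparsePoly quotientTwoThreeSeven := by
  refine mul_partsSeries_eq_of_mul_eq (by norm_num) (by norm_num) (by norm_num) (by simp) ?_
  simp only [sparsePoly, quotientTwoThreeSeven, List.map_cons, List.map_nil, List.sum_cons,
    List.sum_nil, zsmul_eq_mul]
  push_cast
  ring

theorem mul_partsSeries_two_three_five :
    (1 - X) ^ 2 * (1 - X ^ 30) * partsSeries {p | p ∈ [5, 3, 2]} =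
      sparsePoly quotientTwoThreeFive := by
  refine mul_partsSeries_eq_of_mul_eq (by norm_num) (by norm_num) (by norm_num) (by simp) ?_
  simp only [sparsePoly, quotientTwoThreeFive, List.map_cons, List.map_nil, List.sum_cons,
    List.sum_nil, zsmul_eq_mul]
  push_cast
  ring

theorem mul_partsSeries_one_four_nine :
    (1 - X) ^ 2 * (1 - X ^ 36) * partsSeries {p | p ∈ [9, 4, 1]} =
      sparsePoly quotientOneFourNine := by
  refine mul_partsSeries_eq_of_mul_eq (by norm_num) (by norm_num) (by norm_num) (by simp) ?_
  simp only [sparsePoly, quotientOneFourNine, List.map_cons, List.map_nil, List.sum_cons,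
    List.sum_nil, zsmul_eq_mul]
  push_cast
  ring

/-! ### Positivity for `i ≥ 2`, `k ≥ 2` -/

/-- `1 - q^5 - q^8 + q^15 + q^19 - q^22`. -/
def lowerTwo : List (ℤ × ℕ) := [(1, 0), (-1, 5), (-1, 8), (1, 15), (1, 19), (-1, 22)]

/-- The quotient of `lowerTwo` by `1 - q`. -/
def lowerTwoDiv : List (ℤ × ℕ) :=
  ((List.range 5).map fun n => (1, n)) ++ ((List.range 7).map fun n => (-1, n + 8)) ++
    ((List.range 3).map fun n => (1, n + 19))

theorem one_le_coeff_lowerTwo :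
    ∀ n ≥ 0, 1 ≤ coeff n (partsQuotient lowerTwo [6, 9, 4, 1]) := by
  have h : ∀ n ≥ 27, 0 ≤ coeff n (partsQuotient lowerTwo [9, 4, 1]) :=
    le_coeff_partsQuotient_of_mul_eq (V := lowerTwoDiv) (L := 36) (a := 22) (b := 25) (M := 70)
      (by norm_num)
      (by
        simp only [sparsePoly, lowerTwo, lowerTwoDiv, List.range_succ, List.range_zero,
          List.map_cons, List.map_nil, List.sum_cons, List.nil_append, List.cons_append,
          List.sum_nil, zsmul_eq_mul]
        push_cast
        ring)
      mul_partsSeries_one_four_nine (by decide) (by decide) (by simp) (by simp) (by norm_num)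
      (by decide +kernel) (by decide +kernel)
  exact le_coeff_partsQuotient_cons h 40 (by simp) (by simp) (by norm_num) (by decide +kernel)

theorem C_pos_of_two_le {m i k n : ℕ} (hi : 2 ≤ i) (him : 2 * i < m) (hk : 2 ≤ k)
    (hn : pentExp k ≤ n) : 0 < C k i m n := by
  obtain ⟨t, rfl⟩ := Nat.exists_eq_add_of_le hn
  rw [C_eq_coeff_pentagonalTail (by omega) him]
  set M := allowedParts m i with hMdef
  have hM : ∀ p ∈ M, 1 ≤ p := fun _ => one_le_of_mem_allowedParts
  have h1 : 1 ∈ M := mem_allowedParts_of_lt (by omega) (by omega) (by omega) (by omega)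
  rcases Nat.lt_or_ge t (3 * k + 2) with ht | ht
  · rw [coeff_pentagonalTail_mul_of_lt (by omega) ht]
    obtain ⟨p, hp, hp2, hpk⟩ : ∃ p ∈ M, 2 ≤ p ∧ p ≤ 2 * k + 1 := by
      rcases (by omega : 3 ≤ i ∨ (i = 2 ∧ m = 5) ∨ (i = 2 ∧ 6 ≤ m)) with h | h | h
      · exact ⟨2, mem_allowedParts_of_lt (by omega) (by omega) (by omega) (by omega),
          le_rfl, by omega⟩
      · exact ⟨4, mem_allowedParts_of_lt (by omega) (by omega) (by omega) (by omega),
          by omega, by omega⟩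
      · exact ⟨3, mem_allowedParts_of_lt (by omega) (by omega) (by omega) (by omega),
          by omega, by omega⟩
    refine lt_of_lt_of_le ?_
      (coeff_one_sub_mul_partsSeries_le hM hpk (mem_closure_of_one_mem h1 _) t)
    rw [one_sub_mul_partsSeries (by omega) hp]
    exact one_le_coeff_partsSeries (fun q hq => hM q hq.1)
      (mem_closure_of_one_mem (show 1 ∈ M \ {p} from ⟨h1, by simp; omega⟩) t)
  -- for `m = 5`, `i = k = 2` the number `7 = 2 k + 3` is not a sum of allowed parts other than
  -- `1`, and the lower bound is applied only to the tail with `k = 4`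
  · by_cases h5 : k = 2 ∧ m = 5 ∧ i = 2
    · obtain ⟨rfl, rfl, rfl⟩ := h5
      have hb := nonneg_pentagonalTail_sub_of_two_le (m := 5) (i := 2) (k := 4) le_rfl
        (by norm_num) (show 2 ≤ 3 by norm_num) (by norm_num) (by norm_num)
      have e := pentagonalTail_eq_add (show 1 ≤ 2 by norm_num)
      have hS : {p | p ∈ [6, 9, 4, 1]} ⊆ M := by
        intro p hp
        simp only [Set.mem_ofPred_eq, List.mem_cons, List.not_mem_nil, or_false] at hp
        rcases hp with rfl | rfl | rfl | rfl <;> simp [hMdef, allowedParts]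
      have hW : sparsePoly lowerTwo =
          1 - X ^ 5 - X ^ 8 + X ^ 15 + X ^ 19 - X ^ 22 := by
        simp only [sparsePoly, lowerTwo, List.map_cons, List.map_nil, List.sum_cons, List.sum_nil,
          zsmul_eq_mul]
        push_cast
        ring
      have h3 := coeff_le_coeff_mul_partsSeries hS
        (fun n => zero_le_one.trans (one_le_coeff_lowerTwo n (Nat.zero_le n))) t
      have h4 := one_le_coeff_lowerTwo t (Nat.zero_le t)
      refine zero_lt_one.trans_le (h4.trans (h3.trans ?_))
      have h6 : coeff t (sparsePoly lowerTwo * partsSeries M) =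
          coeff (pentExp 2 + t) (X ^ pentExp 2 * (sparsePoly lowerTwo * partsSeries M)) := by
        rw [coeff_X_pow_mul', if_pos (by omega), Nat.add_sub_cancel_left]
      rw [h6]
      refine Nonneg.coeff_le ?_ _
      convert hb using 1
      have e2 : pentExp 2 = 7 := rfl
      have e4 : pentExp 4 = 26 := rfl
      rw [e, hW, e2, e4]
      ring
    · obtain ⟨k₀, hk₀, hkk, h6⟩ : ∃ k₀, 2 ≤ k₀ ∧ k₀ ≤ k ∧ (k₀ = 2 → ¬ (m = 5 ∧ i = 2)) := by
        rcases Nat.eq_or_lt_of_le hk with rfl | hk3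
        · exact ⟨2, le_rfl, le_rfl, fun _ h => h5 ⟨rfl, h⟩⟩
        · exact ⟨3, by norm_num, hk3, by norm_num⟩
      have hb := (nonneg_pentagonalTail_sub_of_two_le hi him hk₀ h6 hkk) (pentExp k + t)
      rw [sub_mul, map_sub, mul_assoc, coeff_X_pow_mul', if_pos (by omega),
        Nat.add_sub_cancel_left] at hb
      have h7 := coeff_one_sub_mul_partsSeries_le hM (show 1 ≤ k - 1 by omega)
        (mem_closure_of_one_mem h1 _) t
      rw [one_sub_mul_partsSeries le_rfl h1] at h7
      have h8 := one_le_coeff_partsSeries (A := M \ {1}) (fun q hq => hM q hq.1)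
        (mem_closure_allowedParts hi him (show 7 ≤ t by omega) (by omega))
      linarith

/-! ### Positivity for `i ≥ 2`, `k = 1` -/

theorem two_le_coeff_partsSeries {A : Set ℕ} (hA : ∀ p ∈ A, 1 ≤ p) {p n : ℕ} (hp : p ∈ A)
    (hpn : p ≤ n) (h1 : n ∈ AddSubmonoid.closure (A \ {p}))
    (h2 : n - p ∈ AddSubmonoid.closure A) : 2 ≤ coeff n (partsSeries A) := by
  rw [coeff_of_one_sub_mul (one_sub_mul_partsSeries (hA p hp) hp) n, if_pos hpn]
  have := one_le_coeff_partsSeries (A := A \ {p}) (fun q hq => hA q hq.1) h1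
  have := one_le_coeff_partsSeries hA h2
  linarith

/-- Every exponent of the theta series with a positive sign, apart from `0` and small cases for
`m = 5`, has at least two partitions into allowed parts other than `1`. -/
theorem two_le_coeff_allowedParts {m i n : ℕ} (hi : 2 ≤ i) (him : 2 * i < m)
    (hn : m + 2 * i ≤ n) (h5 : m = 5 → 20 ≤ n) :
    2 ≤ coeff n (partsSeries (allowedParts m i \ {1})) := by
  have hA : ∀ p ∈ allowedParts m i \ {1}, 1 ≤ p := fun p hp => one_le_of_mem_allowedParts hp.1
  have hmem : ∀ n, 1 ≤ n → n < m → n ≠ i → n ≠ m - i → n ∈ allowedParts m i :=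
    fun _ => mem_allowedParts_of_lt
  have key : ∀ (p : ℕ) (B : Set ℕ), 2 ≤ p → (p ≤ 3 ∨ p = 4 ∧ m = 5) → p ∈ allowedParts m i →
      B ⊆ allowedParts m i → 1 ∉ B → p ∉ B → n ∈ AddSubmonoid.closure B →
      2 ≤ coeff n (partsSeries (allowedParts m i \ {1})) := by
    intro p B hp2 hp4 hp hB hB1 hBp hnB
    refine two_le_coeff_partsSeries hA (p := p) ⟨hp, by simp; omega⟩ (by omega)
      (closure_mono ?_ hnB) ?_
    · intro x hx
      exact ⟨⟨hB hx, fun h => hB1 (h ▸ hx)⟩, fun h => hBp (h ▸ hx)⟩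
    · exact mem_closure_allowedParts hi him (by omega) (by omega)
  rcases (by omega : i = 2 ∧ m = 5 ∨ i = 2 ∧ m = 6 ∨ i = 2 ∧ m = 7 ∨ i = 2 ∧ 8 ≤ m ∨ i = 3 ∧ m = 7 ∨
    i = 3 ∧ m = 8 ∨ i = 3 ∧ 9 ≤ m ∨ i = 4 ∧ m = 9 ∨ i = 4 ∧ 10 ≤ m ∨ 5 ≤ i) with
    ⟨rfl, rfl⟩ | ⟨rfl, rfl⟩ | ⟨rfl, rfl⟩ | ⟨rfl, hm⟩ | ⟨rfl, rfl⟩ | ⟨rfl, rfl⟩ | ⟨rfl, hm⟩ |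
    ⟨rfl, rfl⟩ | ⟨rfl, hm⟩ | hi5
  · refine key 4 {6, 9, 11, 14, 16} (by norm_num) (by norm_num) (by simp [allowedParts])
      (by simp [Set.insert_subset_iff, allowedParts]) (by simp) (by simp) ?_
    exact mem_closure_of_table (p := 6) (F := 20) [[], [9, 16], [14], [9], [16], [11]]
      (by norm_num) (by simp) (by simp) (by decide) (h5 rfl)
  · refine key 3 {5, 7, 9, 11, 13} (by norm_num) (by norm_num) (by simp [allowedParts])
      (by simp [Set.insert_subset_iff, allowedParts]) (by simp) (by simp) ?_
    exact mem_closure_of_table (p := 5) (F := 10) [[], [11], [7], [13], [9]]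
      (by norm_num) (by simp) (by simp) (by decide) (by omega)
  · refine key 3 {4, 6, 11, 13} (by norm_num) (by norm_num) (by simp [allowedParts])
      (by simp [Set.insert_subset_iff, allowedParts]) (by simp) (by simp) ?_
    exact mem_closure_of_table (p := 4) (F := 10) [[], [13], [6], [11]]
      (by norm_num) (by simp) (by simp) (by decide) (by omega)
  · exact key 3 {4, 5} (by norm_num) (by norm_num)
      (hmem _ (by omega) (by omega) (by omega) (by omega))
      (Set.pair_subset (hmem _ (by omega) (by omega) (by omega) (by omega))
        (hmem _ (by omega) (by omega) (by omega) (by omega))) (by simp) (by simp)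
      (mem_closure_four_five (by omega))
  · exact key 2 {5, 6, 8, 9} (by norm_num) (by norm_num) (by simp [allowedParts])
      (by simp [Set.insert_subset_iff, allowedParts]) (by simp) (by simp)
      (mem_closure_five_six_eight_nine (by omega))
  · exact key 2 {4, 7, 9} (by norm_num) (by norm_num) (by simp [allowedParts])
      (by simp [Set.insert_subset_iff, allowedParts]) (by simp) (by simp)
      (mem_closure_four_seven_nine (by omega))
  · exact key 2 {4, 5} (by norm_num) (by norm_num)
      (hmem _ (by omega) (by omega) (by omega) (by omega))
      (Set.pair_subset (hmem _ (by omega) (by omega) (by omega) (by omega))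
        (hmem _ (by omega) (by omega) (by omega) (by omega))) (by simp) (by simp)
      (mem_closure_four_five (by omega))
  · exact key 2 {3, 7} (by norm_num) (by norm_num) (by simp [allowedParts])
      (by simp [Set.insert_subset_iff, allowedParts]) (by simp) (by simp)
      (mem_closure_three_seven (by omega))
  · exact key 2 {3, 5} (by norm_num) (by norm_num)
      (hmem _ (by omega) (by omega) (by omega) (by omega))
      (Set.pair_subset (hmem _ (by omega) (by omega) (by omega) (by omega))
        (hmem _ (by omega) (by omega) (by omega) (by omega))) (by simp) (by simp)
      (mem_closure_three_five (by omega))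
  · exact key 2 {3, 4} (by norm_num) (by norm_num)
      (hmem _ (by omega) (by omega) (by omega) (by omega))
      (Set.pair_subset (hmem _ (by omega) (by omega) (by omega) (by omega))
        (hmem _ (by omega) (by omega) (by omega) (by omega))) (by simp) (by simp)
      (mem_closure_three_four (by omega))

theorem C_one_eq_of_two_le {m i : ℕ} (hi : 2 ≤ i) (him : 2 * i < m) (n : ℕ) :
    C 1 i m n = coeff n (partsSeries (allowedParts m i \ {1})) - thetaSign m i n := by
  have h1 : 1 ∈ allowedParts m i :=
    mem_allowedParts_of_lt (by omega) (by omega) (by omega) (by omega)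
  have h := one_sub_mul_partsSeries le_rfl h1
  rw [pow_one] at h
  rw [C_one_eq (by omega) him, h]

theorem C_one_pos_of_two_le {m i n : ℕ} (hi : 2 ≤ i) (him : 2 * i < m) (hn : 2 ≤ n)
    (h : ¬ (i = 2 ∧ m = 5 ∧ (n = 5 ∨ n = 7 ∨ n = 9 ∨ n = 11))) : 0 < C 1 i m n := by
  rw [C_one_eq_of_two_le hi him]
  have hA : ∀ p ∈ allowedParts m i \ {1}, 1 ≤ p := fun p hp => one_le_of_mem_allowedParts hp.1
  have h0 := nonneg_partsSeries (allowedParts m i \ {1}) n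
  have hle := thetaSign_le_one (show 1 ≤ i by omega) him n
  by_cases hb : n = i ∨ n = m - i
  · have : thetaSign m i n = -1 := by
      rcases hb with rfl | rfl
      · exact thetaSign_self (by omega) him
      · exact thetaSign_sub (by omega) him
    omega
  have hone : 1 ≤ coeff n (partsSeries (allowedParts m i \ {1})) := by
    refine one_le_coeff_partsSeries hA ?_
    rcases Nat.lt_or_ge n 7 with h7 | h7
    · rcases Nat.lt_or_ge n m with hnm | hnm
      · exact mem_closure_self
          ⟨mem_allowedParts_of_lt (by omega) hnm (by omega) (by omega), by simp; omega⟩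
      · rcases (by omega : m = 5 ∧ n = 6 ∨ m = 6 ∧ n = 6) with ⟨rfl, rfl⟩ | ⟨rfl, rfl⟩
        · obtain rfl : i = 2 := by omega
          exact mem_closure_self (by simp [allowedParts])
        · obtain rfl : i = 2 := by omega
          exact AddSubmonoid.nsmul_mem _ (mem_closure_self
            (show 3 ∈ allowedParts 6 2 \ {1} by simp [allowedParts])) 2
    · exact mem_closure_allowedParts hi him h7 (by omega)
  by_cases hs : n ≠ m + 2 * i ∧ n ≠ 3 * m - 2 * i ∧ n < 6 * m + 4 * i
  · have := thetaSign_nonpos (show 1 ≤ i by omega) him (by omega) hs.1 hs.2.1 hs.2.2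
    omega
  · have := two_le_coeff_allowedParts hi him (n := n) (by omega) (by omega)
    omega

theorem C_one_two_five_eq_zero {n : ℕ} (hn : n = 5 ∨ n = 7 ∨ n = 9 ∨ n = 11) :
    C 1 2 5 n = 0 := by
  rw [C_one_eq_of_two_le le_rfl (by norm_num)]
  have hS : {p | p ∈ [11, 9, 6, 4]} ⊆ allowedParts 5 2 \ {1} := by
    intro p hp
    simp only [Set.mem_ofPred_eq, List.mem_cons, List.not_mem_nil, or_false] at hp
    rcases hp with rfl | rfl | rfl | rfl <;> simp [allowedParts]
  have h1 := coeff_mul_partsSeries_eq (n := n) hS 1 (by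
    intro p hp _ hpn
    simp only [allowedParts, Set.mem_sdiff, Set.mem_ofPred_eq, Set.mem_singleton_iff] at hp
    simp only [Set.mem_ofPred_eq, List.mem_cons, List.not_mem_nil, or_false]
    omega)
  have h2 : sparsePoly [(1, 0)] = 1 := by simp [sparsePoly]
  rw [← partsQuotient_eq h2, coeff_partsQuotient _ (by simp) (by simp) (show n < 12 by omega),
    one_mul] at h1
  rw [h1]
  rcases hn with rfl | rfl | rfl | rfl
  · rw [thetaSign_eq_zero] <;> decide +kernel
  · rw [thetaSign_eq_zero] <;> decide +kernel
  · rw [thetaSign_of_eq (by norm_num) (by norm_num) 2 (by norm_num)]; decide +kernel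
  · rw [thetaSign_of_eq (by norm_num) (by norm_num) (-2) (by norm_num)]; decide +kernel

/-! ### The lower bound for the tails and positivity for `i = 1`, `k ≥ 4` -/

/-- If `2` is an allowed part, then a factor `1 - q^u` with `u` even is harmless. -/
theorem nonneg_triple_of_even {M B C : Set ℕ} (hM : ∀ p ∈ M, 1 ≤ p) (h2 : 2 ∈ M) (hB : B ⊆ M)
    (hC : C ⊆ M) (hB2 : 2 ∉ B) (hC2 : 2 ∉ C) (hBC : Disjoint B C) {u v w : ℕ} (hu : u % 2 = 0)
    (hv : v ∈ AddSubmonoid.closure B) (hw : w ∈ AddSubmonoid.closure C) :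
    Nonneg ((1 - X ^ u) * (1 - X ^ v) * (1 - X ^ w) * partsSeries M) :=
  nonneg_mul_mul_mul_partsSeries hM (Set.singleton_subset_iff.mpr h2) hB hC
    (Set.disjoint_singleton_left.mpr hB2) (Set.disjoint_singleton_left.mpr hC2) hBC
    (mem_closure_two_of_even hu) hv hw

/-- The products of three factors that occur in the lower bound for the tails for `i = 1`. One of the
exponents is even and uses the part `2` alone; the other two use `{3, 4}` and a set of parts from `5`
on, with exceptions for `k = 5`. -/
theorem nonneg_triples_one_of_seven_le {m k : ℕ} (hm : 7 ≤ m) (hm8 : m ≠ 8) (hk : 4 ≤ k) :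
    Nonneg ((1 - X ^ (k + 3)) * (1 - X ^ (2 * k + 3)) * (1 - X ^ (2 * k + 4)) *
      partsSeries (allowedParts m 1)) ∧
    Nonneg ((1 - X ^ k) * (1 - X ^ (k + 3)) * (1 - X ^ (2 * k + 3)) *
      partsSeries (allowedParts m 1)) := by
  have hM : ∀ p ∈ allowedParts m 1, 1 ≤ p := fun _ => one_le_of_mem_allowedParts
  have hmem : ∀ n, 2 ≤ n → n + 1 < m → n ∈ allowedParts m 1 := fun n h1 h2 =>
    mem_allowedParts_of_lt (by omega) (by omega) (by omega) (by omega)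
  have h2 : 2 ∈ allowedParts m 1 := hmem 2 (by omega) (by omega)
  have hB : ({3, 4} : Set ℕ) ⊆ allowedParts m 1 :=
    Set.pair_subset (hmem _ (by omega) (by omega)) (hmem _ (by omega) (by omega))
  obtain ⟨C, hC, hC2, hBC, hC5, hCk⟩ : ∃ C ⊆ allowedParts m 1, 2 ∉ C ∧
      Disjoint ({3, 4} : Set ℕ) C ∧ 5 ∈ C ∧
      ((k = 5 → m ≠ 7) → 2 * k + 3 ∈ AddSubmonoid.closure C) := by
    rcases (by omega : m = 7 ∨ 9 ≤ m) with rfl | hm9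
    · refine ⟨{5, 9, 10, 11, 12}, by simp [Set.insert_subset_iff, allowedParts], by simp, by simp,
        by simp, fun h => ?_⟩
      rcases (by omega : k = 4 ∨ 6 ≤ k) with rfl | hk6
      · exact mem_closure_self (by simp)
      · exact mem_closure_five_to_twelve (by omega)
    · exact ⟨{5, 6, 7}, Set.insert_subset (hmem _ (by omega) (by omega)) (Set.pair_subset
        (hmem _ (by omega) (by omega)) (hmem _ (by omega) (by omega))), by simp, by simp,
        by simp, fun _ => mem_closure_five_six_seven (by omega)⟩
  constructor
  · by_cases h : k = 5 ∧ m = 7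
    · obtain ⟨rfl, rfl⟩ := h
      have := nonneg_triple_of_even (B := {3, 5}) (C := {4, 9}) hM h2
        (by simp [Set.insert_subset_iff, allowedParts])
        (by simp [Set.insert_subset_iff, allowedParts]) (by simp) (by simp) (by simp)
        (show 14 % 2 = 0 by norm_num) (mem_closure_three_five (show 8 ≤ 8 by norm_num))
        (mem_closure_pair (show 4 + 9 = 13 by norm_num))
      convert this using 1; ring
    · have := nonneg_triple_of_even hM h2 hB hC (by simp) hC2 hBC
        (show (2 * k + 4) % 2 = 0 by omega) (mem_closure_three_four (show 6 ≤ k + 3 by omega))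
        (hCk (by omega))
      convert this using 1; ring
  · rcases (by omega : k = 5 ∨ k % 2 = 0 ∨ k % 2 = 1 ∧ 7 ≤ k) with rfl | h | ⟨h, hk7⟩
    · have := nonneg_triple_of_even hM h2 hB hC (by simp) hC2 hBC
        (show 8 % 2 = 0 by norm_num) (mem_closure_three_four (show 6 ≤ 13 by norm_num))
        (mem_closure_self hC5)
      convert this using 1; ring
    · exact nonneg_triple_of_even hM h2 hB hC (by simp) hC2 hBC h
        (mem_closure_three_four (show 6 ≤ k + 3 by omega)) (hCk (by omega))
    · have := nonneg_triple_of_even hM h2 hB hC (by simp) hC2 hBC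
        (show (k + 3) % 2 = 0 by omega) (mem_closure_three_four (show 6 ≤ k by omega))
        (hCk (by omega))
      convert this using 1; ring

/-- The same products for `m = 5`, where the allowed parts are those congruent to `±2` modulo `5`.
The sets `{3, 8}` and `{7, 12, 13, 17, 18, 22, 23}` cover the exponents for large `k`. -/
theorem nonneg_triples_one_five {k : ℕ} (hk : 4 ≤ k) :
    Nonneg ((1 - X ^ (k + 3)) * (1 - X ^ (2 * k + 3)) * (1 - X ^ (2 * k + 4)) *
      partsSeries (allowedParts 5 1)) ∧
    Nonneg ((1 - X ^ k) * (1 - X ^ (k + 3)) * (1 - X ^ (2 * k + 3)) *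
      partsSeries (allowedParts 5 1)) := by
  have hM : ∀ p ∈ allowedParts 5 1, 1 ≤ p := fun _ => one_le_of_mem_allowedParts
  have h2 : 2 ∈ allowedParts 5 1 := by simp [allowedParts]
  have hC : ({7, 12, 13, 17, 18, 22, 23} : Set ℕ) ⊆ allowedParts 5 1 := by
    simp [Set.insert_subset_iff, allowedParts]
  have h38 : ({3, 8} : Set ℕ) ⊆ allowedParts 5 1 := by simp [Set.insert_subset_iff, allowedParts]
  have h78 : ({7, 8} : Set ℕ) ⊆ allowedParts 5 1 := by simp [Set.insert_subset_iff, allowedParts]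
  -- an even exponent is a multiple of `2`, the other two are covered by disjoint sets of parts
  have pair : ∀ {u} v w, u % 2 = 0 → (∃ B C : Set ℕ, B ⊆ allowedParts 5 1 ∧ C ⊆ allowedParts 5 1 ∧
      2 ∉ B ∧ 2 ∉ C ∧ Disjoint B C ∧ v ∈ AddSubmonoid.closure B ∧ w ∈ AddSubmonoid.closure C) →
      Nonneg ((1 - X ^ u) * (1 - X ^ v) * (1 - X ^ w) * partsSeries (allowedParts 5 1)) := by
    rintro u v w hu ⟨B, C, hB, hC, hB2, hC2, hBC, hv, hw⟩
    exact nonneg_triple_of_even hM h2 hB hC hB2 hC2 hBC hu hv hw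
  have main : ∀ v w, (14 ≤ v ∨ v = 8 ∨ v = 9 ∨ v = 11 ∨ v = 12) → (17 ≤ w ∨ w = 7 ∨ w = 13) →
      ∃ B C : Set ℕ, B ⊆ allowedParts 5 1 ∧ C ⊆ allowedParts 5 1 ∧
      2 ∉ B ∧ 2 ∉ C ∧ Disjoint B C ∧ v ∈ AddSubmonoid.closure B ∧
      w ∈ AddSubmonoid.closure C := by
    intro v w hv hw
    refine ⟨{3, 8}, {7, 12, 13, 17, 18, 22, 23}, h38, hC, by simp, by simp, by simp, ?_, ?_⟩
    · rcases hv with h | rfl | rfl | rfl | rfl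
      · exact mem_closure_three_eight h
      · exact mem_closure_self (by simp)
      · exact mem_closure_of_sum_eq [3, 3, 3] (by simp) rfl
      · exact mem_closure_pair rfl
      · exact mem_closure_of_sum_eq [3, 3, 3, 3] (by simp) rfl
    · rcases hw with h | rfl | rfl
      · exact mem_closure_seven_to_twenty_three h
      · exact mem_closure_self (by simp)
      · exact mem_closure_self (by simp)
  have single : ∀ v w, v ∈ allowedParts 5 1 → w ∈ allowedParts 5 1 → v ≠ 2 → w ≠ 2 → v ≠ w →
      ∃ B C : Set ℕ, B ⊆ allowedParts 5 1 ∧ C ⊆ allowedParts 5 1 ∧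
      2 ∉ B ∧ 2 ∉ C ∧ Disjoint B C ∧ v ∈ AddSubmonoid.closure B ∧
      w ∈ AddSubmonoid.closure C := by
    intro v w hv hw hv2 hw2 hvw
    exact ⟨{v}, {w}, Set.singleton_subset_iff.mpr hv, Set.singleton_subset_iff.mpr hw,
      by simpa using hv2.symm, by simpa using hw2.symm, by simpa using hvw,
      mem_closure_self rfl, mem_closure_self rfl⟩
  have nine : ∃ B C : Set ℕ, B ⊆ allowedParts 5 1 ∧ C ⊆ allowedParts 5 1 ∧
      2 ∉ B ∧ 2 ∉ C ∧ Disjoint B C ∧ 9 ∈ AddSubmonoid.closure B ∧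
      15 ∈ AddSubmonoid.closure C :=
    ⟨{3}, {7, 8}, by simp [allowedParts], h78, by simp, by simp, by simp,
      mem_closure_of_sum_eq [3, 3, 3] (by simp) rfl, mem_closure_pair rfl⟩
  constructor
  · rcases (by omega : k = 4 ∨ k = 6 ∨ k = 7 ∨ k = 10 ∨ (k = 5 ∨ k = 8 ∨ k = 9 ∨ 11 ≤ k)) with
      rfl | rfl | rfl | rfl | h
    · have := pair (u := 12) _ _ (by norm_num) (main 11 7 (by norm_num) (by norm_num))
      convert this using 1; ring
    · have := pair (u := 16) _ _ (by norm_num) nine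
      convert this using 1; ring
    · exact pair _ _ (by norm_num) (single 17 18 (by simp [allowedParts]) (by simp [allowedParts])
        (by norm_num) (by norm_num) (by norm_num))
    · have := pair (u := 24) _ _ (by norm_num) (single 13 23 (by simp [allowedParts])
        (by simp [allowedParts]) (by norm_num) (by norm_num) (by norm_num))
      convert this using 1; ring
    · have := pair (u := 2 * k + 4) _ _ (by omega)
        (main (k + 3) (2 * k + 3) (by omega) (by omega))
      convert this using 1; ring
  · rcases (by omega : k = 4 ∨ k = 5 ∨ k = 6 ∨ k = 7 ∨ k = 10 ∨ k = 13 ∨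
      (k % 2 = 0 ∧ (k = 8 ∨ 12 ≤ k)) ∨ (k % 2 = 1 ∧ (k = 9 ∨ k = 11 ∨ 15 ≤ k))) with
      rfl | rfl | rfl | rfl | rfl | rfl | ⟨h0, h⟩ | ⟨h0, h⟩
    · have := pair (u := 4) _ _ (by norm_num) (main 11 7 (by norm_num) (by norm_num))
      convert this using 1; ring
    · exact nonneg_mul_mul_mul_partsSeries (A := {2, 3}) (B := {8}) (C := {13}) hM
        (by simp [Set.insert_subset_iff, allowedParts]) (by simp [allowedParts])
        (by simp [allowedParts]) (by simp) (by simp) (by simp) (mem_closure_pair rfl)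
        (mem_closure_self rfl) (mem_closure_self rfl)
    · exact pair _ _ (by norm_num) nine
    · have := pair (u := 10) _ _ (by norm_num) (single 7 17 (by simp [allowedParts])
        (by simp [allowedParts]) (by norm_num) (by norm_num) (by norm_num))
      convert this using 1; ring
    · exact pair _ _ (by norm_num) (single 13 23 (by simp [allowedParts])
        (by simp [allowedParts]) (by norm_num) (by norm_num) (by norm_num))
    · have := pair (u := 16) _ _ (by norm_num) (main 29 13 (by norm_num) (by norm_num))
      convert this using 1; ring
    · exact pair _ _ h0 (main (k + 3) (2 * k + 3) (by omega) (by omega))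
    · have := pair (u := k + 3) _ _ (by omega) (main k (2 * k + 3) (by omega) (by omega))
      convert this using 1; ring

/-- The allowed parts other than `2` generate all larger integers. -/
theorem mem_closure_allowedParts_one_sdiff_two {m a : ℕ} (hm : m = 5 ∨ 7 ≤ m) (ha : 6 ≤ a) :
    a ∈ AddSubmonoid.closure (allowedParts m 1 \ {2}) := by
  rcases hm with rfl | hm
  · exact closure_mono (by simp [Set.insert_subset_iff, allowedParts])
      (mem_closure_three_seven_eight ha)
  · have hmem : ∀ n, 3 ≤ n → n ≤ 4 → n ∈ allowedParts m 1 \ {2} := fun n h1 h2 =>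
      ⟨mem_allowedParts_of_lt (by omega) (by omega) (by omega) (by omega), by simp; omega⟩
    exact closure_mono (Set.pair_subset (hmem 3 le_rfl (by omega)) (hmem 4 (by omega) le_rfl))
      (mem_closure_three_four ha)

/-- The allowed parts other than `3` generate all larger integers. -/
theorem mem_closure_allowedParts_one_sdiff_three {m a : ℕ} (hm : m = 5 ∨ 7 ≤ m) (ha : 6 ≤ a) :
    a ∈ AddSubmonoid.closure (allowedParts m 1 \ {3}) := by
  rcases hm with rfl | hm
  · exact closure_mono (by simp [Set.insert_subset_iff, allowedParts])
      (mem_closure_two_seven ha)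
  · have hmem : ∀ n, 2 ≤ n → n ≤ 5 → n ≠ 3 → n ∈ allowedParts m 1 \ {3} := fun n h1 h2 h3 =>
      ⟨mem_allowedParts_of_lt (by omega) (by omega) (by omega) (by omega), by simpa using h3⟩
    exact closure_mono (Set.pair_subset (hmem 2 le_rfl (by omega) (by omega))
      (hmem 5 (by omega) le_rfl (by omega))) (mem_closure_two_five (show 4 ≤ a by omega))

/-- The lower bound for the tails used for `i = 1`. -/
theorem nonneg_pentagonalTail_sub_one {m k : ℕ} (hm : m = 5 ∨ m = 7 ∨ 9 ≤ m) (hk : 4 ≤ k) :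
    Nonneg ((pentagonalTail k - X ^ pentExp k * (1 - X ^ (k - 2))) *
      partsSeries (allowedParts m 1)) := by
  refine nonneg_pentagonalTail_sub (l := fun k => 1 - X ^ (k - 2)) (show 1 ≤ 4 by omega) ?_ hk
  intro k hk
  have hM : ∀ p ∈ allowedParts m 1, 1 ≤ p := fun _ => one_le_of_mem_allowedParts
  have h2 : 2 ∈ allowedParts m 1 :=
    mem_allowedParts_of_lt (by omega) (by omega) (by omega) (by omega)
  obtain ⟨ha, hb⟩ : Nonneg ((1 - X ^ (k + 3)) * (1 - X ^ (2 * k + 3)) * (1 - X ^ (2 * k + 4)) *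
      partsSeries (allowedParts m 1)) ∧
    Nonneg ((1 - X ^ k) * (1 - X ^ (k + 3)) * (1 - X ^ (2 * k + 3)) *
      partsSeries (allowedParts m 1)) := by
    rcases hm with rfl | hm
    · exact nonneg_triples_one_five hk
    · exact nonneg_triples_one_of_seven_le (by omega) (by omega) hk
  have hc := nonneg_mul_mul_partsSeries hM (Set.singleton_subset_iff.mpr h2)
    (Set.sdiff_subset (s := allowedParts m 1) (t := {2}))
    Set.disjoint_sdiff_right (mem_closure_two_of_even (show 4 % 2 = 0 by norm_num))
    (mem_closure_allowedParts_one_sdiff_two (by omega) (show 6 ≤ 2 * k + 3 by omega))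
  obtain ⟨j, rfl⟩ : ∃ j, k = j + 2 := ⟨k - 2, by omega⟩
  simp only [Nat.add_sub_cancel]
  -- the two-step expression factors through `1 - q^(2 k + 3)`
  have e : (1 - X ^ (2 * (j + 2) + 1) - X ^ (3 * (j + 2) + 2) * (1 - X ^ (2 * (j + 2) + 3))
      - (1 - X ^ j) + X ^ (6 * (j + 2) + 7) * (1 - X ^ (j + 2))) * partsSeries (allowedParts m 1) =
      X ^ j * ((1 - X ^ (j + 2 + 3)) * (1 - X ^ (2 * (j + 2) + 3)) * (1 - X ^ (2 * (j + 2) + 4)) *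
        partsSeries (allowedParts m 1)) +
      X ^ (3 * j + 7) * ((1 - X ^ (j + 2)) * (1 - X ^ (j + 2 + 3)) * (1 - X ^ (2 * (j + 2) + 3)) *
        partsSeries (allowedParts m 1)) +
      X ^ (4 * j + 9) * ((1 - X ^ 4) * (1 - X ^ (2 * (j + 2) + 3)) *
        partsSeries (allowedParts m 1)) := by ring
  rw [e]
  exact (((Nonneg.X_pow _).mul ha).add ((Nonneg.X_pow _).mul hb)).add ((Nonneg.X_pow _).mul hc)

/-- One of `a - 2` and `a - 3` is even, hence a sum of parts `2`, so that the factor `1 - q^a` can be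
compared with `1 - q^2` or `1 - q^3`. -/
theorem coeff_one_sub_mul_partsSeries_pos {m a n : ℕ} (hm : m = 5 ∨ 7 ≤ m) (ha : 2 ≤ a)
    (hn : 6 ≤ n) : 0 < coeff n ((1 - X ^ a) * partsSeries (allowedParts m 1)) := by
  have hM : ∀ p ∈ allowedParts m 1, 1 ≤ p := fun _ => one_le_of_mem_allowedParts
  have h2 : 2 ∈ allowedParts m 1 :=
    mem_allowedParts_of_lt (by omega) (by omega) (by omega) (by omega)
  have h3 : 3 ∈ allowedParts m 1 := by
    rcases hm with rfl | hm
    · simp [allowedParts]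
    · exact mem_allowedParts_of_lt (by omega) (by omega) (by omega) (by omega)
  have heven : ∀ b, b % 2 = 0 → b ∈ AddSubmonoid.closure (allowedParts m 1) := fun b hb =>
    closure_mono (Set.singleton_subset_iff.mpr h2) (mem_closure_two_of_even hb)
  rcases Nat.mod_two_eq_zero_or_one a with h | h
  · refine lt_of_lt_of_le ?_ (coeff_one_sub_mul_partsSeries_le hM ha (heven _ (by omega)) n)
    rw [one_sub_mul_partsSeries (by omega) h2]
    exact one_le_coeff_partsSeries (fun q hq => hM q hq.1)
      (mem_closure_allowedParts_one_sdiff_two hm hn)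
  · refine lt_of_lt_of_le ?_ (coeff_one_sub_mul_partsSeries_le hM (show 3 ≤ a by omega)
      (heven _ (by omega)) n)
    rw [one_sub_mul_partsSeries (by omega) h3]
    exact one_le_coeff_partsSeries (fun q hq => hM q hq.1)
      (mem_closure_allowedParts_one_sdiff_three hm hn)

theorem one_le_coeff_partsSeries_allowedParts_one {m n : ℕ} (hm : m = 5 ∨ 7 ≤ m) (hn : n ≠ 1) :
    1 ≤ coeff n (partsSeries (allowedParts m 1)) := by
  refine one_le_coeff_partsSeries (fun _ => one_le_of_mem_allowedParts) ?_
  rcases Nat.eq_zero_or_pos n with rfl | h0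
  · exact zero_mem _
  refine closure_mono (Set.pair_subset ?_ ?_) (mem_closure_two_three (show 2 ≤ n by omega))
  · exact mem_allowedParts_of_lt (by omega) (by omega) (by omega) (by omega)
  · rcases hm with rfl | hm
    · simp [allowedParts]
    · exact mem_allowedParts_of_lt (by omega) (by omega) (by omega) (by omega)

theorem C_pos_of_four_le {m k n : ℕ} (hm : m = 5 ∨ m = 7 ∨ 9 ≤ m) (hk : 4 ≤ k)
    (hn : pentExp k ≤ n) (hn1 : n ≠ pentExp k + 1) : 0 < C k 1 m n := by
  obtain ⟨t, rfl⟩ := Nat.exists_eq_add_of_le hn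
  rw [C_eq_coeff_pentagonalTail le_rfl (by omega)]
  rcases Nat.lt_or_ge t (3 * k + 2) with ht | ht
  · rw [coeff_pentagonalTail_mul_of_lt (by omega) ht]
    rcases Nat.lt_or_ge t (2 * k + 1) with ht' | ht'
    · rw [sub_mul, one_mul, map_sub, coeff_X_pow_mul', if_neg (by omega), sub_zero]
      exact one_le_coeff_partsSeries_allowedParts_one (by omega) (by omega)
    · exact coeff_one_sub_mul_partsSeries_pos (by omega) (by omega) (by omega)
  · have hb := nonneg_pentagonalTail_sub_one hm hk (pentExp k + t)
    rw [sub_mul, map_sub, mul_assoc, coeff_X_pow_mul', if_pos (by omega),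
      Nat.add_sub_cancel_left] at hb
    have := coeff_one_sub_mul_partsSeries_pos (m := m) (a := k - 2) (n := t) (by omega) (by omega)
      (by omega)
    linarith

/-- The coefficient just after the first one vanishes, since `1` is not an allowed part. -/
theorem C_pentExp_add_one {m k : ℕ} (hm : 2 < m) (hk : 1 ≤ k) : C k 1 m (pentExp k + 1) = 0 := by
  rw [C_eq_coeff_pentagonalTail le_rfl (by omega), coeff_pentagonalTail_mul_of_lt hk (by omega),
    coeff_mul_partsSeries_eq (Set.empty_subset _), partsSeries_empty, mul_one, map_sub, coeff_one,
    coeff_X_pow, if_neg one_ne_zero, if_neg (by omega), sub_zero]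
  intro p hp h1 h2
  obtain rfl : p = 1 := by omega
  rw [allowedParts, Set.mem_ofPred_eq, Nat.mod_eq_of_lt (by omega)] at hp
  omega

/-! ### Positivity for `i = 1`, `k = 2, 3` -/

/-- `1 - q^5 - q^8 + q^15 + q^19 - q^21`, the first terms of the tail for `k = 2` together with the
lower bound for `k = 4`. -/
def tailTwo : List (ℤ × ℕ) := [(1, 0), (-1, 5), (-1, 8), (1, 15), (1, 19), (-1, 21)]

/-- The quotient of `tailTwo` by `1 - q`. -/
def tailTwoDiv : List (ℤ × ℕ) :=
  ((List.range 5).map fun n => (1, n)) ++ ((List.range 7).map fun n => (-1, n + 8)) ++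
    ((List.range 2).map fun n => (1, n + 19))

/-- `1 - q^7 - q^11 + q^20 + q^25 - q^28`, the first terms of the tail for `k = 3` together with the
lower bound for `k = 5`. -/
def tailThree : List (ℤ × ℕ) := [(1, 0), (-1, 7), (-1, 11), (1, 20), (1, 25), (-1, 28)]

/-- The quotient of `tailThree` by `1 - q`. -/
def tailThreeDiv : List (ℤ × ℕ) :=
  ((List.range 7).map fun n => (1, n)) ++ ((List.range 9).map fun n => (-1, n + 11)) ++
    ((List.range 3).map fun n => (1, n + 25))

theorem sparsePoly_tailTwo_eq : sparsePoly tailTwo = (1 - X) * sparsePoly tailTwoDiv := by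
  simp only [sparsePoly, tailTwo, tailTwoDiv, List.range_succ, List.range_zero,
    List.map_cons, List.map_nil, List.sum_cons, List.nil_append, List.cons_append,
    List.sum_nil, zsmul_eq_mul]
  push_cast
  ring

theorem sparsePoly_tailThree_eq : sparsePoly tailThree = (1 - X) * sparsePoly tailThreeDiv := by
  simp only [sparsePoly, tailThree, tailThreeDiv, List.range_succ, List.range_zero,
    List.map_cons, List.map_nil, List.sum_cons, List.nil_append, List.cons_append,
    List.sum_nil, zsmul_eq_mul]
  push_cast
  ring

theorem coeff_tailTwo_seven : (∀ n, 0 ≤ coeff n (partsQuotient tailTwo [8, 7, 3, 2])) ∧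
    ∀ n, n ≠ 1 → n ≠ 5 → 1 ≤ coeff n (partsQuotient tailTwo [8, 7, 3, 2]) := by
  have h : ∀ n ≥ 0, 0 ≤ coeff n (partsQuotient tailTwo [7, 3, 2]) :=
    le_coeff_partsQuotient_of_mul_eq (L := 42) (a := 21) (b := 33) (M := 56) (by norm_num)
      sparsePoly_tailTwo_eq mul_partsSeries_two_three_seven (by decide) (by decide) (by simp)
      (by simp) (by norm_num) (by decide +kernel) (by decide +kernel)
  refine ⟨fun n => le_coeff_partsQuotient_cons h 20 (by simp) (by simp) (by norm_num)
    (by decide +kernel) n (Nat.zero_le n), fun n h1 h5 => ?_⟩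
  rcases Nat.lt_or_ge n 6 with h6 | h6
  · rw [coeff_partsQuotient _ (by simp) (by simp) h6]
    interval_cases n <;> first | decide +kernel | omega
  · exact le_coeff_partsQuotient_cons h 20 (by simp) (by simp) (by norm_num)
      (by decide +kernel) n h6

theorem coeff_tailTwo_five : (∀ n, 0 ≤ coeff n (partsQuotient tailTwo [4, 5, 3, 2])) ∧
    ∀ n, n ≠ 1 → 1 ≤ coeff n (partsQuotient tailTwo [4, 5, 3, 2]) := by
  have h : ∀ n ≥ 0, 0 ≤ coeff n (partsQuotient tailTwo [5, 3, 2]) :=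
    le_coeff_partsQuotient_of_mul_eq (L := 30) (a := 21) (b := 23) (M := 46) (by norm_num)
      sparsePoly_tailTwo_eq mul_partsSeries_two_three_five (by decide) (by decide) (by simp)
      (by simp) (by norm_num) (by decide +kernel) (by decide +kernel)
  refine ⟨fun n => le_coeff_partsQuotient_cons h 20 (by simp) (by simp) (by norm_num)
    (by decide +kernel) n (Nat.zero_le n), fun n h1 => ?_⟩
  rcases Nat.lt_or_ge n 2 with h6 | h6
  · rw [coeff_partsQuotient _ (by simp) (by simp) h6]
    interval_cases n <;> first | decide +kernel | omega
  · exact le_coeff_partsQuotient_cons h 20 (by simp) (by simp) (by norm_num)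
      (by decide +kernel) n h6

theorem coeff_tailThree_seven : (∀ n, 0 ≤ coeff n (partsQuotient tailThree [8, 7, 3, 2])) ∧
    ∀ n, n ≠ 1 → 1 ≤ coeff n (partsQuotient tailThree [8, 7, 3, 2]) := by
  have h : ∀ n ≥ 0, 0 ≤ coeff n (partsQuotient tailThree [7, 3, 2]) :=
    le_coeff_partsQuotient_of_mul_eq (L := 42) (a := 28) (b := 33) (M := 63) (by norm_num)
      sparsePoly_tailThree_eq mul_partsSeries_two_three_seven (by decide) (by decide) (by simp)
      (by simp) (by norm_num) (by decide +kernel) (by decide +kernel)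
  refine ⟨fun n => le_coeff_partsQuotient_cons h 20 (by simp) (by simp) (by norm_num)
    (by decide +kernel) n (Nat.zero_le n), fun n h1 => ?_⟩
  rcases Nat.lt_or_ge n 2 with h6 | h6
  · rw [coeff_partsQuotient _ (by simp) (by simp) h6]
    interval_cases n <;> first | decide +kernel | omega
  · exact le_coeff_partsQuotient_cons h 20 (by simp) (by simp) (by norm_num)
      (by decide +kernel) n h6

theorem coeff_tailThree_five : (∀ n, 0 ≤ coeff n (partsQuotient tailThree [4, 5, 3, 2])) ∧
    ∀ n, n ≠ 1 → 1 ≤ coeff n (partsQuotient tailThree [4, 5, 3, 2]) := by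
  have h : ∀ n ≥ 0, 0 ≤ coeff n (partsQuotient tailThree [5, 3, 2]) :=
    le_coeff_partsQuotient_of_mul_eq (L := 30) (a := 28) (b := 23) (M := 54) (by norm_num)
      sparsePoly_tailThree_eq mul_partsSeries_two_three_five (by decide) (by decide) (by simp)
      (by simp) (by norm_num) (by decide +kernel) (by decide +kernel)
  refine ⟨fun n => le_coeff_partsQuotient_cons h 20 (by simp) (by simp) (by norm_num)
    (by decide +kernel) n (Nat.zero_le n), fun n h1 => ?_⟩
  rcases Nat.lt_or_ge n 2 with h6 | h6
  · rw [coeff_partsQuotient _ (by simp) (by simp) h6]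
    interval_cases n <;> first | decide +kernel | omega
  · exact le_coeff_partsQuotient_cons h 20 (by simp) (by simp) (by norm_num)
      (by decide +kernel) n h6

/-- Two steps of the tail recursion followed by the lower bound for the tail `k + 2`. -/
theorem coeff_mul_le_C {m k : ℕ} (hm : m = 5 ∨ m = 7 ∨ 9 ≤ m) (hk : 2 ≤ k) (t : ℕ) :
    coeff t ((1 - X ^ (2 * k + 1) - X ^ (3 * k + 2) * (1 - X ^ (2 * k + 3)) +
      X ^ (6 * k + 7) * (1 - X ^ k)) * partsSeries (allowedParts m 1)) ≤
      C k 1 m (pentExp k + t) := by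
  rw [C_eq_coeff_pentagonalTail le_rfl (by omega)]
  have hb := nonneg_pentagonalTail_sub_one hm (show 4 ≤ k + 2 by omega) (pentExp k + t)
  have e : (pentagonalTail (k + 2) - X ^ pentExp (k + 2) * (1 - X ^ (k + 2 - 2))) *
      partsSeries (allowedParts m 1) = pentagonalTail k * partsSeries (allowedParts m 1) -
      X ^ pentExp k * ((1 - X ^ (2 * k + 1) - X ^ (3 * k + 2) * (1 - X ^ (2 * k + 3)) +
      X ^ (6 * k + 7) * (1 - X ^ k)) * partsSeries (allowedParts m 1)) := by
    have h1 : pentExp (k + 2) = pentExp k + (6 * k + 7) := by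
      rw [pentExp_succ, pentExp_succ]; ring
    rw [pentagonalTail_eq_add (show 1 ≤ k by omega), h1, Nat.add_sub_cancel, pow_add]
    ring
  rw [e, map_sub, coeff_X_pow_mul', if_pos (by omega), Nat.add_sub_cancel_left] at hb
  linarith

theorem C_two_or_three_pos {m k n : ℕ} (hm : m = 5 ∨ m = 7 ∨ 9 ≤ m) (hk : k = 2 ∨ k = 3)
    (hn : pentExp k ≤ n) (hn1 : n ≠ pentExp k + 1) (h5 : ¬ (k = 2 ∧ m = 5 ∧ n = 12)) :
    0 < C k 1 m n := by
  obtain ⟨t, rfl⟩ := Nat.exists_eq_add_of_le hn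
  refine lt_of_lt_of_le ?_ (coeff_mul_le_C hm (by omega) t)
  have e2 : (1 - X ^ (2 * 2 + 1) - X ^ (3 * 2 + 2) * (1 - X ^ (2 * 2 + 3)) +
      X ^ (6 * 2 + 7) * (1 - X ^ 2)) = sparsePoly tailTwo := by
    simp only [sparsePoly, tailTwo, List.map_cons, List.map_nil, List.sum_cons, List.sum_nil,
      zsmul_eq_mul]
    push_cast; ring
  have e3 : (1 - X ^ (2 * 3 + 1) - X ^ (3 * 3 + 2) * (1 - X ^ (2 * 3 + 3)) +
      X ^ (6 * 3 + 7) * (1 - X ^ 3)) = sparsePoly tailThree := by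
    simp only [sparsePoly, tailThree, List.map_cons, List.map_nil, List.sum_cons, List.sum_nil,
      zsmul_eq_mul]
    push_cast; ring
  have e7 : pentExp 2 = 7 := rfl
  rcases hm with rfl | hm
  · have hS : {p | p ∈ [8, 7, 3, 2]} ⊆ allowedParts 5 1 := by
      intro p hp
      simp only [Set.mem_ofPred_eq, List.mem_cons, List.not_mem_nil, or_false] at hp
      rcases hp with rfl | rfl | rfl | rfl <;> simp [allowedParts]
    rcases hk with rfl | rfl
    · rw [e2]
      exact zero_lt_one.trans_le ((coeff_tailTwo_seven.2 t (by omega) (by omega)).trans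
        (coeff_le_coeff_mul_partsSeries hS coeff_tailTwo_seven.1 t))
    · rw [e3]
      exact zero_lt_one.trans_le ((coeff_tailThree_seven.2 t (by omega)).trans
        (coeff_le_coeff_mul_partsSeries hS coeff_tailThree_seven.1 t))
  · have hS : {p | p ∈ [4, 5, 3, 2]} ⊆ allowedParts m 1 := by
      intro p hp
      simp only [Set.mem_ofPred_eq, List.mem_cons, List.not_mem_nil, or_false] at hp
      exact mem_allowedParts_of_lt (by omega) (by omega) (by omega) (by omega)
    rcases hk with rfl | rfl
    · rw [e2]
      exact zero_lt_one.trans_le ((coeff_tailTwo_five.2 t (by omega)).trans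
        (coeff_le_coeff_mul_partsSeries hS coeff_tailTwo_five.1 t))
    · rw [e3]
      exact zero_lt_one.trans_le ((coeff_tailThree_five.2 t (by omega)).trans
        (coeff_le_coeff_mul_partsSeries hS coeff_tailThree_five.1 t))

/-- The coefficient is the number of partitions of `5` into allowed parts minus that of `0`. -/
theorem C_two_one_five_twelve : C 2 1 5 12 = 0 := by
  have hS : {p | p ∈ [3, 2]} ⊆ allowedParts 5 1 := by
    intro p hp
    simp only [Set.mem_ofPred_eq, List.mem_cons, List.not_mem_nil, or_false] at hp
    rcases hp with rfl | rfl <;> simp [allowedParts]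
  have h2 : sparsePoly [(1, 0), (-1, 5)] = 1 - X ^ (2 * 2 + 1) := by
    simp [sparsePoly, sub_eq_add_neg]
  rw [C_eq_coeff_pentagonalTail le_rfl (by norm_num)]
  have h := coeff_pentagonalTail_mul_of_lt (k := 2) (t := 5) (by norm_num) (by norm_num)
    (partsSeries (allowedParts 5 1))
  rw [coeff_mul_partsSeries_eq hS (1 - X ^ (2 * 2 + 1)), ← partsQuotient_eq h2,
    coeff_partsQuotient _ (by simp) (by simp) (show 5 < 6 by omega)] at h
  · rw [show (12 : ℕ) = pentExp 2 + 5 from rfl, h]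
    decide +kernel
  · intro p hp _ hpn
    simp only [allowedParts, Set.mem_ofPred_eq] at hp
    simp only [Set.mem_ofPred_eq, List.mem_cons, List.not_mem_nil, or_false]
    omega

/-! ### Positivity and exceptional values for `i = k = 1` -/

/-- The terms of `1 - q`. -/
def oneSub : List (ℤ × ℕ) := [(1, 0), (-1, 1)]

theorem sparsePoly_oneSub : sparsePoly oneSub = 1 - X := by
  simp [sparsePoly, oneSub, sub_eq_add_neg]

/-- If all coefficients of `f` from `P + 1` on are positive and the coefficient of `q` is the only
negative one, then allowing further parts `p ≥ P` can decrease only the coefficients of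
`q^(p + 1)`, and these by at most `1`. -/
theorem sub_le_coeff_mul_partsSeries {f : PowerSeries ℤ} {P : ℕ} (h1 : -1 ≤ coeff 1 f)
    (h0 : ∀ n, n ≠ 1 → 0 ≤ coeff n f) (hP : ∀ n, P < n → 1 ≤ coeff n f) (T : Finset ℕ)
    (hT : ∀ p ∈ T, 1 ≤ p ∧ P ≤ p) (n : ℕ) :
    coeff n f - (if ∃ p ∈ T, n = p + 1 then 1 else 0) ≤ coeff n (f * partsSeries T) := by
  classical
  induction T using Finset.induction_on generalizing n with
  | empty => simp [partsSeries_empty]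
  | insert p T hpT ih =>
    have hp := hT p (Finset.mem_insert_self p T)
    have hT' := fun q hq => hT q (Finset.mem_insert_of_mem hq)
    have e : (1 - X ^ p) * (f * partsSeries (insert p T : Finset ℕ)) = f * partsSeries T := by
      have : ((insert p T : Finset ℕ) : Set ℕ) \ {p} = T := by
        rw [Finset.coe_insert, Set.insert_sdiff_self_of_notMem (by simpa using hpT)]
      rw [mul_left_comm, one_sub_mul_partsSeries hp.1 (by simp), this]
    induction n using Nat.strong_induction_on with
    | _ n ihn =>
    rw [coeff_of_one_sub_mul e n]
    have h2 := ih hT' n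
    by_cases hpn : p ≤ n
    · rw [if_pos hpn]
      have h3 := ihn (n - p) (by omega)
      by_cases hn1 : n = p + 1
      · subst hn1
        rw [if_pos ⟨p, Finset.mem_insert_self p T, rfl⟩]
        rw [if_neg (by rintro ⟨q, hq, hqp⟩; obtain rfl : p = q := by omega
                       exact hpT hq)] at h2
        rw [if_neg (by rintro ⟨q, hq, hqp⟩; have := hT q hq; omega), Nat.add_sub_cancel_left] at h3
        rw [Nat.add_sub_cancel_left]
        linarith
      · have h4 : 0 ≤ coeff (n - p) f - (if ∃ q ∈ insert p T, n - p = q + 1 then 1 else 0) := by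
          split_ifs with h
          · obtain ⟨q, hq, hqp⟩ := h
            have := hP (n - p) (by have := hT q hq; omega)
            linarith
          · rw [sub_zero]; exact h0 _ (by omega)
        have h5 : (∃ q ∈ insert p T, n = q + 1) ↔ ∃ q ∈ T, n = q + 1 := by
          simp only [Finset.mem_insert, exists_eq_or_imp]
          exact or_iff_right hn1
        simp only [h5]
        linarith
    · rw [if_neg hpn, add_zero]
      refine le_trans ?_ h2
      have h5 : (∃ q ∈ insert p T, n = q + 1) ↔ ∃ q ∈ T, n = q + 1 := by
        simp only [Finset.mem_insert, exists_eq_or_imp]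
        exact or_iff_right (by omega)
      simp only [h5]
      exact le_rfl

open Classical in
/-- The passage from finitely many parts `S` to all allowed parts for `i = k = 1`. -/
theorem sub_le_C_one {m : ℕ} (hm : 2 < m) {S : List ℕ} (hS : {p | p ∈ S} ⊆ allowedParts m 1)
    (hnd : S.Nodup) {P : ℕ} (hP : ∀ p ∈ allowedParts m 1, p ∉ S → P ≤ p)
    (h0 : (partsTable oneSub S 2).getD 0 0 = 1 ∧ (partsTable oneSub S 2).getD 1 0 = -1)
    (h2 : ∀ n ≥ 2, 0 ≤ coeff n (partsQuotient oneSub S))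
    (hf : ∀ n, P < n → 1 ≤ coeff n (partsQuotient oneSub S)) (n : ℕ) :
    coeff n (partsQuotient oneSub S) -
      (if ∃ p ∈ allowedParts m 1, P ≤ p ∧ n = p + 1 then 1 else 0) - thetaSign m 1 n ≤
      C 1 1 m n := by
  have hpos : ∀ p ∈ S, 1 ≤ p := fun p hp => one_le_of_mem_allowedParts (hS hp)
  set T : Finset ℕ := (Finset.range (n + 1)).filter fun p => p ∈ allowedParts m 1 ∧ p ∉ S with hTdef
  have hT : ∀ p, p ∈ T ↔ p ≤ n ∧ p ∈ allowedParts m 1 ∧ p ∉ S := by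
    intro p; simp [hTdef]
  rw [C_one_eq le_rfl hm]
  have h1 := sub_le_coeff_mul_partsSeries (f := partsQuotient oneSub S) (P := P)
    (by rw [coeff_partsQuotient _ hnd hpos (show 1 < 2 by norm_num), h0.2])
    (by
      intro j hj
      rcases Nat.eq_zero_or_pos j with rfl | hj0
      · rw [coeff_partsQuotient _ hnd hpos (show 0 < 2 by norm_num), h0.1]; norm_num
      · exact h2 j (by omega))
    hf T (fun p hp => by
      have hp' := (hT p).mp hp
      exact ⟨one_le_of_mem_allowedParts hp'.2.1, hP p hp'.2.1 hp'.2.2⟩) n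
  have h3 : partsQuotient oneSub S * partsSeries T =
      (1 - X) * partsSeries ({p | p ∈ S} ∪ T) := by
    rw [partsQuotient_eq sparsePoly_oneSub, mul_assoc,
      partsSeries_subset (Set.subset_union_left (s := {p | p ∈ S}) (t := (T : Set ℕ))),
      Set.union_sdiff_cancel_left]
    rintro p ⟨hp1, hp2⟩
    exact ((hT p).mp hp2).2.2 hp1
  have h4 : coeff n ((1 - X) * partsSeries (allowedParts m 1)) =
      coeff n ((1 - X) * partsSeries ({p | p ∈ S} ∪ T)) := by
    refine coeff_mul_partsSeries_eq (Set.union_subset hS ?_) _ ?_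
    · exact fun p hp => ((hT p).mp hp).2.1
    · intro p hp _ hpn
      by_cases hpS : p ∈ S
      · exact Or.inl hpS
      · exact Or.inr ((hT p).mpr ⟨hpn, hp, hpS⟩)
  rw [h4, ← h3]
  have h5 : (if ∃ p ∈ T, n = p + 1 then (1 : ℤ) else 0) ≤
      if ∃ p ∈ allowedParts m 1, P ≤ p ∧ n = p + 1 then 1 else 0 := by
    split_ifs with ha hb
    · exact le_rfl
    · obtain ⟨p, hp, hpn⟩ := ha
      have hp' := (hT p).mp hp
      exact absurd ⟨p, hp'.2.1, hP p hp'.2.1 hp'.2.2, hpn⟩ hb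
    · exact zero_le_one
    · exact le_rfl
  linarith

/-- Exact values of the coefficients below the first omitted part. -/
theorem C_one_eq_getD {m n : ℕ} (hm : 2 < m) {S : List ℕ} (hS : {p | p ∈ S} ⊆ allowedParts m 1)
    (hnd : S.Nodup) (hP : ∀ p ∈ allowedParts m 1, p ≤ n → p ∈ S) :
    C 1 1 m n = (partsTable oneSub S (n + 1)).getD n 0 - thetaSign m 1 n := by
  rw [C_one_eq le_rfl hm, coeff_mul_partsSeries_eq hS (1 - X) (fun p hp _ hpn => hP p hp hpn),
    ← partsQuotient_eq sparsePoly_oneSub, coeff_partsQuotient _ hnd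
    (fun p hp => one_le_of_mem_allowedParts (hS hp)) (Nat.lt_succ_self n)]

theorem partsQuotient_oneSub_two_three_seven :
    ∀ n ≥ 2, 0 ≤ coeff n (partsQuotient oneSub [7, 3, 2]) :=
  le_coeff_partsQuotient_of_mul_eq (V := [(1, 0)]) (L := 42) (a := 1) (b := 33) (M := 46)
    (by norm_num) (by rw [sparsePoly_oneSub]; simp [sparsePoly]) mul_partsSeries_two_three_seven
    (by decide) (by decide) (by simp) (by simp) (by norm_num) (by decide +kernel)
    (by decide +kernel)

theorem partsQuotient_oneSub_two_three_five :
    ∀ n ≥ 2, 0 ≤ coeff n (partsQuotient oneSub [5, 3, 2]) :=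
  le_coeff_partsQuotient_of_mul_eq (V := [(1, 0)]) (L := 30) (a := 1) (b := 23) (M := 35)
    (by norm_num) (by rw [sparsePoly_oneSub]; simp [sparsePoly]) mul_partsSeries_two_three_five
    (by decide) (by decide) (by simp) (by simp) (by norm_num) (by decide +kernel)
    (by decide +kernel)

theorem partsQuotient_oneSub_four :
    ∀ n ≥ 2, 0 ≤ coeff n (partsQuotient oneSub [4, 5, 3, 2]) :=
  le_coeff_partsQuotient_cons partsQuotient_oneSub_two_three_five 10 (by simp) (by simp)
    (by norm_num) (by decide +kernel)

theorem partsQuotient_oneSub_seven_six :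
    ∀ n ≥ 2, 0 ≤ coeff n (partsQuotient oneSub [7, 6, 4, 5, 3, 2]) := by
  have h : ∀ n ≥ 14, 0 ≤ coeff n (partsQuotient oneSub [6, 4, 5, 3, 2]) :=
    le_coeff_partsQuotient_cons partsQuotient_oneSub_four 24 (by simp) (by simp)
      (by norm_num) (by decide +kernel)
  exact le_coeff_partsQuotient_cons h 24 (by simp) (by simp) (by norm_num) (by decide +kernel)

theorem C_one_one_five_pos {n : ℕ} (hn : 2 ≤ n)
    (h : n ≠ 3 ∧ n ≠ 5 ∧ n ≠ 7 ∧ n ≠ 9 ∧ n ≠ 11 ∧ n ≠ 13) : 0 < C 1 1 5 n := by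
  have h8 : ∀ n ≥ 2, 0 ≤ coeff n (partsQuotient oneSub [8, 7, 3, 2]) :=
    le_coeff_partsQuotient_cons partsQuotient_oneSub_two_three_seven 20 (by simp) (by simp)
      (by norm_num) (by decide +kernel)
  have h12 : ∀ n ≥ 26, 0 ≤ coeff n (partsQuotient oneSub [12, 8, 7, 3, 2]) :=
    le_coeff_partsQuotient_cons h8 40 (by simp) (by simp) (by norm_num) (by decide +kernel)
  have h13 : ∀ n ≥ 2, 0 ≤ coeff n (partsQuotient oneSub [13, 12, 8, 7, 3, 2]) :=
    le_coeff_partsQuotient_cons h12 40 (by simp) (by simp) (by norm_num) (by decide +kernel)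
  have h17 : ∀ n ≥ 2, 0 ≤ coeff n (partsQuotient oneSub [17, 13, 12, 8, 7, 3, 2]) :=
    le_coeff_partsQuotient_cons h13 40 (by simp) (by simp) (by norm_num) (by decide +kernel)
  have h18 : ∀ n ≥ 2, 0 ≤ coeff n (partsQuotient oneSub [18, 17, 13, 12, 8, 7, 3, 2]) :=
    le_coeff_partsQuotient_cons h17 40 (by simp) (by simp) (by norm_num) (by decide +kernel)
  have h14 : ∀ n ≥ 14, 1 ≤ coeff n (partsQuotient oneSub [18, 17, 13, 12, 8, 7, 3, 2]) :=
    le_coeff_partsQuotient_cons h17 40 (by simp) (by simp) (by norm_num) (by decide +kernel)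
  have h22 : ∀ n ≥ 22, 2 ≤ coeff n (partsQuotient oneSub [18, 17, 13, 12, 8, 7, 3, 2]) :=
    le_coeff_partsQuotient_cons h17 40 (by simp) (by simp) (by norm_num) (by decide +kernel)
  have h26 : ∀ n ≥ 26, 3 ≤ coeff n (partsQuotient oneSub [18, 17, 13, 12, 8, 7, 3, 2]) :=
    le_coeff_partsQuotient_cons h17 46 (by simp) (by simp) (by norm_num) (by decide +kernel)
  have hS : {p | p ∈ [18, 17, 13, 12, 8, 7, 3, 2]} ⊆ allowedParts 5 1 := by
    intro p hp
    simp only [Set.mem_ofPred_eq, List.mem_cons, List.not_mem_nil, or_false] at hp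
    simp only [allowedParts, Set.mem_ofPred_eq]
    omega
  have hb := sub_le_C_one (n := n) (P := 22) (by norm_num) hS (by simp) (by
      intro p hp hpS
      simp only [List.mem_cons, List.not_mem_nil, or_false] at hpS
      simp only [allowedParts, Set.mem_ofPred_eq] at hp
      omega) (by decide +kernel) h18 (fun n hn => h14 n (by omega))
  refine lt_of_lt_of_le ?_ hb
  have hθ : n < 34 → thetaSign 5 1 n ≤ 0 := fun hn => thetaSign_nonpos le_rfl (by norm_num)
    (by omega) (by omega) (by omega) (by omega)
  have hθ1 := thetaSign_le_one (i := 1) (m := 5) le_rfl (by norm_num) n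
  split_ifs with hT
  · have h23 : 22 < n := by obtain ⟨p, -, hp, hpn⟩ := hT; omega
    have := h22 n (by omega)
    rcases Nat.lt_or_ge n 34 with hlt | hge
    · have := hθ hlt; linarith
    · have := h26 n (by omega); linarith
  · rcases Nat.lt_or_ge n 14 with hlt | hge
    · by_cases h4 : n = 4
      · subst h4
        have e : thetaSign 5 1 (5 - 1) = -1 := thetaSign_sub le_rfl (by norm_num)
        rw [show thetaSign 5 1 4 = -1 from e]
        have := h18 4 (by norm_num)
        linarith
      · have : 1 ≤ coeff n (partsQuotient oneSub [18, 17, 13, 12, 8, 7, 3, 2]) := by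
          rw [coeff_partsQuotient _ (by simp) (by simp) hlt]
          interval_cases n <;> first | omega | decide +kernel
        have := hθ (by omega)
        linarith
    · have := h14 n hge
      rcases Nat.lt_or_ge n 34 with hlt | hge
      · have := hθ hlt; linarith
      · have := h26 n (by omega); linarith

/-- For `m ≥ 7`, positivity follows from lower bounds for the coefficients of
`(1 - q) / ∏_{p ∈ S} (1 - q^p)`. A positive value of `thetaSign` at `m + 2` does not meet a loss
from a further part, since `m + 1` is not an allowed part. -/
theorem C_one_one_pos_of_le_coeff {m n P : ℕ} (hm : 7 ≤ m) {S : List ℕ}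
    (hS : {p | p ∈ S} ⊆ allowedParts m 1) (hnd : S.Nodup)
    (hP : ∀ p ∈ allowedParts m 1, p ∉ S → P ≤ p)
    (h0 : (partsTable oneSub S 2).getD 0 0 = 1 ∧ (partsTable oneSub S 2).getD 1 0 = -1)
    (h2 : ∀ n ≥ 2, 0 ≤ coeff n (partsQuotient oneSub S))
    (h8 : ∀ n ≥ 8, 1 ≤ coeff n (partsQuotient oneSub S))
    (h14 : ∀ n ≥ 14, 3 ≤ coeff n (partsQuotient oneSub S))
    (hfP : ∀ n, P < n → 2 ≤ coeff n (partsQuotient oneSub S))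
    (hfm : m ≠ 7 → 2 ≤ coeff (m + 2) (partsQuotient oneSub S))
    (h6 : ∀ n, n = 2 ∨ n = 4 ∨ n = 6 → 1 ≤ (partsTable oneSub S 7).getD n 0)
    (hn : 2 ≤ n) (h : n ≠ 3 ∧ n ≠ 5 ∧ n ≠ 7) (h9 : m = 7 → n ≠ 9) : 0 < C 1 1 m n := by
  have hpos : ∀ p ∈ S, 1 ≤ p := fun p hp => one_le_of_mem_allowedParts (hS hp)
  have hf1 : 1 ≤ coeff n (partsQuotient oneSub S) := by
    rcases Nat.lt_or_ge n 8 with hlt | hge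
    · rw [coeff_partsQuotient _ hnd hpos (show n < 7 by omega)]
      exact h6 n (by omega)
    · exact h8 n hge
  refine lt_of_lt_of_le ?_ (sub_le_C_one (by omega) hS hnd hP h0 h2 (fun n hn => by
    have := hfP n hn; linarith) n)
  have hθ1 := thetaSign_le_one (i := 1) (m := m) le_rfl (by omega) n
  by_cases hnm : n = m + 2
  · have hne : ¬ ∃ p ∈ allowedParts m 1, P ≤ p ∧ n = p + 1 := by
      rintro ⟨p, hp, -, hpn⟩
      obtain rfl : p = m + 1 := Nat.succ_injective (hpn.symm.trans hnm)
      rw [allowedParts, Set.mem_ofPred_eq, Nat.add_mod_left, Nat.mod_eq_of_lt (by omega)] at hp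
      omega
    rw [if_neg hne]
    have := hfm (by omega)
    rw [← hnm] at this
    linarith
  · have hf : n < 14 → thetaSign m 1 n ≤ 0 := fun hn =>
      thetaSign_nonpos le_rfl (by omega) (by omega) (by omega) (by omega) (by omega)
    split_ifs with hE
    · have hPn : P < n := by obtain ⟨p, -, hp, rfl⟩ := hE; exact Nat.lt_succ_of_le hp
      have := hfP n hPn
      rcases Nat.lt_or_ge n 14 with hlt | hge
      · have := hf hlt; linarith
      · have := h14 n hge; linarith
    · rcases Nat.lt_or_ge n 14 with hlt | hge
      · have := hf hlt; linarith
      · have := h14 n hge; linarith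

theorem C_one_one_pos {m n : ℕ} (hm : m = 7 ∨ 9 ≤ m) (hm10 : m ≠ 10) (hn : 2 ≤ n)
    (h : n ≠ 3 ∧ n ≠ 5 ∧ n ≠ 7) (h9 : m = 7 → n ≠ 9) : 0 < C 1 1 m n := by
  rcases (by omega : m = 7 ∨ m = 9 ∨ 11 ≤ m) with rfl | rfl | hm11
  · have ha : ∀ n ≥ 2, 0 ≤ coeff n (partsQuotient oneSub [9, 4, 5, 3, 2]) :=
      le_coeff_partsQuotient_cons partsQuotient_oneSub_four 30 (by simp) (by simp)
        (by norm_num) (by decide +kernel)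
    have hb : ∀ n ≥ 2, 0 ≤ coeff n (partsQuotient oneSub [10, 9, 4, 5, 3, 2]) :=
      le_coeff_partsQuotient_cons ha 30 (by simp) (by simp) (by norm_num) (by decide +kernel)
    have hc : ∀ n ≥ 2, 0 ≤ coeff n (partsQuotient oneSub [11, 10, 9, 4, 5, 3, 2]) :=
      le_coeff_partsQuotient_cons hb 30 (by simp) (by simp) (by norm_num) (by decide +kernel)
    have h14 : ∀ n ≥ 14, 3 ≤ coeff n (partsQuotient oneSub [12, 11, 10, 9, 4, 5, 3, 2]) :=
      le_coeff_partsQuotient_cons hc 30 (by simp) (by simp) (by norm_num) (by decide +kernel)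
    refine C_one_one_pos_of_le_coeff (P := 16) (S := [12, 11, 10, 9, 4, 5, 3, 2]) le_rfl ?_
      (by simp) ?_ (by decide +kernel) ?_ ?_ h14
      (fun n hn => le_trans (by norm_num) (h14 n (by omega))) (fun h => absurd rfl h) ?_ hn h h9
    · intro p hp
      simp only [Set.mem_ofPred_eq, List.mem_cons, List.not_mem_nil, or_false] at hp
      simp only [allowedParts, Set.mem_ofPred_eq]
      omega
    · intro p hp hpS
      simp only [List.mem_cons, List.not_mem_nil, or_false] at hpS
      simp only [allowedParts, Set.mem_ofPred_eq] at hp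
      omega
    · exact le_coeff_partsQuotient_cons hc 30 (by simp) (by simp) (by norm_num)
        (by decide +kernel)
    · exact le_coeff_partsQuotient_cons hc 30 (by simp) (by simp) (by norm_num)
        (by decide +kernel)
    · rintro n (rfl | rfl | rfl) <;> decide +kernel
  · have ha : ∀ n ≥ 2, 0 ≤ coeff n (partsQuotient oneSub [11, 7, 6, 4, 5, 3, 2]) :=
      le_coeff_partsQuotient_cons partsQuotient_oneSub_seven_six 30 (by simp) (by simp)
        (by norm_num) (by decide +kernel)
    have h14 : ∀ n ≥ 14, 3 ≤ coeff n (partsQuotient oneSub [12, 11, 7, 6, 4, 5, 3, 2]) :=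
      le_coeff_partsQuotient_cons ha 30 (by simp) (by simp) (by norm_num) (by decide +kernel)
    refine C_one_one_pos_of_le_coeff (P := 13) (S := [12, 11, 7, 6, 4, 5, 3, 2]) (by norm_num) ?_
      (by simp) ?_ (by decide +kernel) ?_ ?_ h14
      (fun n hn => le_trans (by norm_num) (h14 n (by omega))) (fun _ => ?_) ?_ hn h h9
    · intro p hp
      simp only [Set.mem_ofPred_eq, List.mem_cons, List.not_mem_nil, or_false] at hp
      simp only [allowedParts, Set.mem_ofPred_eq]
      omega
    · intro p hp hpS
      simp only [List.mem_cons, List.not_mem_nil, or_false] at hpS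
      simp only [allowedParts, Set.mem_ofPred_eq] at hp
      omega
    · exact le_coeff_partsQuotient_cons ha 30 (by simp) (by simp) (by norm_num)
        (by decide +kernel)
    · exact le_coeff_partsQuotient_cons ha 30 (by simp) (by simp) (by norm_num)
        (by decide +kernel)
    · rw [coeff_partsQuotient _ (by simp) (by simp) (show 9 + 2 < 12 by norm_num)]
      decide +kernel
    · rintro n (rfl | rfl | rfl) <;> decide +kernel
  · have ha : ∀ n ≥ 2, 0 ≤ coeff n (partsQuotient oneSub [8, 7, 6, 4, 5, 3, 2]) :=
      le_coeff_partsQuotient_cons partsQuotient_oneSub_seven_six 30 (by simp) (by simp)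
        (by norm_num) (by decide +kernel)
    have hP : ∀ n ≥ 11, 2 ≤ coeff n (partsQuotient oneSub [9, 8, 7, 6, 4, 5, 3, 2]) :=
      le_coeff_partsQuotient_cons ha 30 (by simp) (by simp) (by norm_num) (by decide +kernel)
    refine C_one_one_pos_of_le_coeff (P := 10) (S := [9, 8, 7, 6, 4, 5, 3, 2]) (by omega) ?_
      (by simp) ?_ (by decide +kernel) ?_ ?_ ?_ hP
      (fun _ => hP _ (by omega)) ?_ hn h h9
    · intro p hp
      simp only [Set.mem_ofPred_eq, List.mem_cons, List.not_mem_nil, or_false] at hp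
      exact mem_allowedParts_of_lt (by omega) (by omega) (by omega) (by omega)
    · intro p hp hpS
      simp only [List.mem_cons, List.not_mem_nil, or_false] at hpS
      by_contra hlt
      obtain rfl : p = 1 := by have := one_le_of_mem_allowedParts hp; omega
      rw [allowedParts, Set.mem_ofPred_eq, Nat.mod_eq_of_lt (by omega)] at hp
      omega
    · exact le_coeff_partsQuotient_cons ha 30 (by simp) (by simp) (by norm_num)
        (by decide +kernel)
    · exact le_coeff_partsQuotient_cons ha 30 (by simp) (by simp) (by norm_num)
        (by decide +kernel)
    · exact le_coeff_partsQuotient_cons ha 30 (by simp) (by simp) (by norm_num)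
        (by decide +kernel)
    · rintro n (rfl | rfl | rfl) <;> decide +kernel

theorem C_one_one_five {n : ℕ} (hn : n ≤ 16) :
    C 1 1 5 n = (partsTable oneSub [13, 12, 8, 7, 3, 2] (n + 1)).getD n 0 - thetaSign 5 1 n := by
  refine C_one_eq_getD (by norm_num) ?_ (by simp) ?_
  · intro p hp
    simp only [Set.mem_ofPred_eq, List.mem_cons, List.not_mem_nil, or_false] at hp
    simp only [allowedParts, Set.mem_ofPred_eq]
    omega
  · intro p hp hpn
    simp only [allowedParts, Set.mem_ofPred_eq] at hp
    simp only [List.mem_cons, List.not_mem_nil, or_false]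
    omega

theorem C_one_one_five_eq_neg_one {n : ℕ} (hn : n = 7 ∨ n = 13) : C 1 1 5 n = -1 := by
  rw [C_one_one_five (by omega)]
  rcases hn with rfl | rfl
  · rw [thetaSign_of_eq le_rfl (by norm_num) 2 (by norm_num)]; decide +kernel
  · rw [thetaSign_of_eq le_rfl (by norm_num) (-2) (by norm_num)]; decide +kernel

theorem C_one_one_five_eq_zero {n : ℕ} (hn : n = 5 ∨ n = 9 ∨ n = 11) : C 1 1 5 n = 0 := by
  rw [C_one_one_five (by omega), thetaSign_eq_zero le_rfl (by norm_num) (by omega) (by omega)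
    (by omega) (by omega) (by omega) (by omega)]
  rcases hn with rfl | rfl | rfl <;> decide +kernel

theorem C_one_one_seven_nine : C 1 1 7 9 = 0 := by
  rw [C_one_eq_getD (S := [9, 4, 5, 3, 2]) (by norm_num) ?_ (by simp) ?_,
    thetaSign_of_eq le_rfl (by norm_num) 2 (by norm_num)]
  · decide +kernel
  · intro p hp
    simp only [Set.mem_ofPred_eq, List.mem_cons, List.not_mem_nil, or_false] at hp
    simp only [allowedParts, Set.mem_ofPred_eq]
    omega
  · intro p hp hpn
    simp only [allowedParts, Set.mem_ofPred_eq] at hp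
    simp only [List.mem_cons, List.not_mem_nil, or_false]
    omega

theorem C_one_one_eq_zero {m n : ℕ} (hm : m = 7 ∨ 9 ≤ m) (hn : n = 5 ∨ n = 7) :
    C 1 1 m n = 0 := by
  have hθ : thetaSign m 1 n = 0 := thetaSign_eq_zero le_rfl (by omega) (by omega) (by omega)
    (by omega) (by omega) (by omega) (by omega)
  rcases hm with rfl | hm
  · rw [C_one_eq_getD (S := [4, 5, 3, 2]) (by norm_num) ?_ (by simp) ?_, hθ]
    · rcases hn with rfl | rfl <;> decide +kernel
    · intro p hp
      simp only [Set.mem_ofPred_eq, List.mem_cons, List.not_mem_nil, or_false] at hp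
      exact mem_allowedParts_of_lt (by omega) (by omega) (by omega) (by omega)
    · intro p hp hpn
      simp only [allowedParts, Set.mem_ofPred_eq] at hp
      simp only [List.mem_cons, List.not_mem_nil, or_false]
      omega
  · rw [C_one_eq_getD (S := [7, 6, 4, 5, 3, 2]) (by omega) ?_ (by simp) ?_, hθ]
    · rcases hn with rfl | rfl <;> decide +kernel
    · intro p hp
      simp only [Set.mem_ofPred_eq, List.mem_cons, List.not_mem_nil, or_false] at hp
      exact mem_allowedParts_of_lt (by omega) (by omega) (by omega) (by omega)
    · intro p hp hpn
      simp only [List.mem_cons, List.not_mem_nil, or_false]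
      by_contra hne
      obtain rfl : p = 1 := by have := one_le_of_mem_allowedParts hp; omega
      rw [allowedParts, Set.mem_ofPred_eq, Nat.mod_eq_of_lt (by omega)] at hp
      omega

end TruncatedPentagonal

theorem theorem4 (τ d i k : ℕ) (hτ : τ = 0 ∨ τ = 1) (hd : 1 ≤ d)
    (hi : 2 ≤ i + τ) (hi' : i ≤ d + τ) (hk : 1 ≤ k) :
    (∀ n : ℕ, TruncatedPentagonal.C k i (2 * d + 2 + τ) n =
        (-1) ^ (k - 1) * (∑ ℓ ∈ Finset.Ioc (-(k : ℤ)) (k : ℤ),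
          (Int.negOnePow ℓ : ℤ) * TruncatedPentagonal.D τ d i ((n : ℤ) - ℓ * (3 * ℓ - 1) / 2))
        + (-1) ^ k * TruncatedPentagonal.thetaSign (2 * d + 2 + τ) i n) ∧
    (∀ n : ℕ, n < k * (3 * k + 1) / 2 → TruncatedPentagonal.C k i (2 * d + 2 + τ) n = 0) ∧
    (∀ n : ℕ, k * (3 * k + 1) / 2 ≤ n →
      (TruncatedPentagonal.IsNegCase k i (2 * d + 2 + τ) n →
        TruncatedPentagonal.C k i (2 * d + 2 + τ) n = -1) ∧
      (TruncatedPentagonal.IsZeroCase k i (2 * d + 2 + τ) n →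
        TruncatedPentagonal.C k i (2 * d + 2 + τ) n = 0) ∧
      (¬ TruncatedPentagonal.IsNegCase k i (2 * d + 2 + τ) n →
        ¬ TruncatedPentagonal.IsZeroCase k i (2 * d + 2 + τ) n →
        0 < TruncatedPentagonal.C k i (2 * d + 2 + τ) n)) := by
  open TruncatedPentagonal in
  have hi1 : 1 ≤ i := by omega
  have him : 2 * i < 2 * d + 2 + τ := by omega
  refine ⟨fun n => C_eq_sum_D hi1 (by omega) hk n, fun n hn => ?_, fun n hn => ⟨?_, ?_, ?_⟩⟩
  · rw [C_eq_coeff_pentagonalTail hi1 him]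
    exact coeff_pentagonalTail_mul_eq_zero hn _
  · rintro ⟨rfl, rfl, hm, hn7⟩
    rw [hm]
    exact C_one_one_five_eq_neg_one hn7
  · rintro (⟨rfl, rfl, hm, h⟩ | ⟨rfl, rfl, hm, h⟩ | ⟨rfl, rfl, hm, rfl⟩ | ⟨rfl, rfl, hm, rfl⟩ |
      ⟨rfl, rfl, ⟨e, he, hm⟩, rfl⟩ | ⟨rfl, rfl, ⟨e, he, hm⟩, rfl⟩ | ⟨rfl, ⟨e, he, hm⟩, h⟩)
    · rw [hm]; exact C_one_two_five_eq_zero h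
    · rw [hm]; exact C_one_one_five_eq_zero (Or.inr h)
    · rw [hm]; exact C_two_one_five_twelve
    · rw [hm]; exact C_one_one_seven_nine
    · rcases (by omega : e = 1 ∨ e = 2 ∨ 3 ≤ e) with rfl | he2
      · rw [hm]; exact C_one_one_five_eq_zero (Or.inl rfl)
      · exact C_one_one_eq_zero (by omega) (Or.inl rfl)
    · exact C_one_one_eq_zero (by omega) (Or.inr rfl)
    · rw [h]; exact C_pentExp_add_one (by omega) hk
  · intro hneg hzero
    have hcase : 2 ≤ i ∨ i = 1 ∧ τ = 1 := by omega
    have hm : 2 * d + 2 + 1 = 5 ∨ 2 * d + 2 + 1 = 7 ∨ 9 ≤ 2 * d + 2 + 1 := by omega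
    have hk' : k = 1 ∨ (k = 2 ∨ k = 3) ∨ 4 ≤ k := by omega
    have h10 : 2 * d + 2 + 1 ≠ 10 := by omega
    have hd3 : 2 * d + 2 + 1 = 2 * d + 3 := rfl
    rw [IsNegCase] at hneg
    simp only [IsZeroCase, not_or] at hzero
    obtain ⟨hz1, hz2, hz3, hz4, hz5, hz6, hz7⟩ := hzero
    rcases hcase with hi2 | ⟨rfl, rfl⟩
    · rcases Nat.eq_or_lt_of_le hk with rfl | hk2
      · exact C_one_pos_of_two_le hi2 him hn fun h => hz1 ⟨rfl, h⟩
      · exact C_pos_of_two_le hi2 him hk2 hn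
    · have hn1 : n ≠ pentExp k + 1 := fun h => hz7 ⟨rfl, ⟨d, hd, hd3⟩, h⟩
      rcases hk' with rfl | hk2 | hk4
      · have h3 : n ≠ 3 := hn1
        have h5 : n ≠ 5 := fun h => hz5 ⟨rfl, rfl, ⟨d, hd, hd3⟩, h⟩
        rcases hm with hm | hm
        · rw [hm] at hneg hz2 ⊢
          exact C_one_one_five_pos hn ⟨h3, h5, fun h => hneg ⟨rfl, rfl, rfl, Or.inl h⟩,
            fun h => hz2 ⟨rfl, rfl, rfl, Or.inl h⟩, fun h => hz2 ⟨rfl, rfl, rfl, Or.inr h⟩,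
            fun h => hneg ⟨rfl, rfl, rfl, Or.inr h⟩⟩
        · have hd2 : 2 ≤ d := by clear * - hm; omega
          exact C_one_one_pos hm h10 hn ⟨h3, h5, fun h => hz6 ⟨rfl, rfl, ⟨d, hd2, hd3⟩, h⟩⟩
            fun h h' => hz4 ⟨rfl, rfl, h, h'⟩
      · exact C_two_or_three_pos hm hk2 hn hn1 fun h => hz3 ⟨h.1, rfl, h.2⟩
      · exact C_pos_of_four_le hm hk4 hn hn1
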